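/- Let $n\in\mathbb N$, $0\le\delta<1$, and let $B\subset\mathbb R^n$ be the open unit ball. Write $S^2(\mathbb R^n)$ for the space of real symmetric $n\times n$ matrices and $\lambda(S)=(\lambda_1\le\dots\le\lambda_n)$ for the ordered eigenvalues of $S\in S^2(\mathbb R^n)$. Let $w:B\to\mathbb R$ be odd, homogeneous of order $2-\delta$ (that is, $w(tx)=t^{2-\delta}w(x)$ whenever $t>0$ and $x,tx\in B$), and smooth ($C^\infty$) in $B\setminus\{0\}$. Put $$M:=\{(\lambda_{\sigma(1)},\dots,\lambda_{\sigma(n)}) : \lambda=\lambda(D^2w(x)),\ x\in B\setminus\{0\},\ \sigma \text{ a permutation of } \{1,\dots,n\}\}\subset\mathbb R^n .$$ Assume: (1) there are an open set $U\supset M$ and a smooth function $g:U\to\mathbb R$ with $g|_M=0$ and $$\min_{1\le i\le n}\ \inf_{\lambda\in M}\frac{\partial g}{\partial\lambda_i}(\lambda)>0;$$ (2) there is a constant $C>0$ such that for all $a,b\in B\setminus\{0\}$ and every orthogonal matrix $O\in O(n)$ the matrix $D^2w(a)-{}^tO\,D^2w(b)\,O$ is either zero or its smallest eigenvalue $\mu_1$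 and its largest eigenvalue $\mu_n$ satisfy $\mu_n\ne0$ and $$\frac1C\le-\frac{\mu_1}{\mu_n}\le C;$$ (3) if $\delta>0$, then $w$ changes sign in $B$ (it takes both a positive and a negative value). Then the following two assertions hold. (i) There is a $C^\infty$ function $F:S^2(\mathbb R^n)\to\mathbb R$ such that $F(S)=f(\lambda(S))$ for some function $f$ on $\mathbb R^n$ invariant under permutations of the coordinates, such that $F$ is uniformly elliptic, i.e. for some constant $C_F\ge1$ $$C_F^{-1}\|N\|\le F(S+N)-F(S)\le C_F\|N\|\qquad\text{for all } S,N\in S^2(\mathbb R^n),\ N\ge0,$$ and such that $w$ is a viscosity solution of $F(D^2w)=0$ in $B$. (ii) $w$ is a viscosity solution in $B$ of a uniformly elliptic Isaacs equation $$\sup_b\inf_a\Big(\sum_{i,j}a^{(ab)}_{ij}\frac{\partial^2w}{\partial x_i\partial x_j}+f_{ab}\Big)=0,$$ where $a$ and $b$ range over nonempty index sets, the constant symmetric matrices $(a^{(ab)}_{ij})$ satisfy $c^{-1}|\xi|^2\le\sum_{i,j} a^{(ab)}_{ij}\xi_i\xi_j\le c|\xi|^2$ for all $\xi\in\mathbb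 R^n$ with one constant $c>0$ for all $a,b$, and the real constants $f_{ab}$ are bounded. If $\delta>0$, one can take all $f_{ab}=0$. Here a continuous function $u$ on $B$ is a viscosity solution of $F(D^2u)=0$ in $B$ if for every $x\in B$ and every function $\varphi$ that is $C^2$ near $x$: $F(D^2\varphi(x))\ge0$ when $u-\varphi$ has a local maximum at $x$, and $F(D^2\varphi(x))\le0$ when $u-\varphi$ has a local minimum at $x$. -/

import Mathlib

open scoped ContDiff

namespace HessianEq

/-- Euclidean space `ℝⁿ`. -/
abbrev E (n : ℕ) : Type := EuclideanSpace ℝ (Fin n)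

/-- The open unit ball of `ℝⁿ`. -/
def unitBall (n : ℕ) : Set (E n) := Metric.ball 0 1

/-- The space `S²(ℝⁿ)` of real symmetric `n × n` matrices. -/
def SymMat (n : ℕ) : Submodule ℝ (Matrix (Fin n) (Fin n) ℝ) where
  carrier := {A | A.IsSymm}
  add_mem' := fun ha hb => ha.add hb
  zero_mem' := Matrix.isSymm_zero
  smul_mem' := fun c _ ha => ha.smul c

/- `S²(ℝⁿ)` carries the Frobenius norm; any other norm would only change the ellipticity
constants. -/
attribute [local instance] Matrix.frobeniusNormedAddCommGroup Matrix.frobeniusNormedSpace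

theorem isHermitian_coe {n : ℕ} (S : SymMat n) :
    (S : Matrix (Fin n) (Fin n) ℝ).IsHermitian := by
  have h : (S : Matrix (Fin n) (Fin n) ℝ).IsSymm := S.2
  rw [Matrix.IsHermitian, Matrix.conjTranspose_eq_transpose_of_trivial]
  exact h

/-- The matrix `ᵗO S O`. -/
def conj {n : ℕ} (O : Matrix.orthogonalGroup (Fin n) ℝ) (S : SymMat n) : SymMat n :=
  ⟨(O : Matrix (Fin n) (Fin n) ℝ).transpose * (S : Matrix (Fin n) (Fin n) ℝ)
      * (O : Matrix (Fin n) (Fin n) ℝ), by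
    have h : (S : Matrix (Fin n) (Fin n) ℝ).transpose = S := S.2
    change (_ : Matrix (Fin n) (Fin n) ℝ).transpose = _
    simp only [Matrix.transpose_mul, Matrix.transpose_transpose, h, Matrix.mul_assoc]⟩

/-- The eigenvalues `λ₁ ≤ … ≤ λₙ` of a symmetric matrix, with multiplicity, in nondecreasing
order. -/
noncomputable def ordEig {n : ℕ} (S : SymMat n) : Fin n → ℝ :=
  (isHermitian_coe S).eigenvalues ∘ Tuple.sort (isHermitian_coe S).eigenvalues

/-- The smallest eigenvalue. -/
noncomputable def minEig {n : ℕ} (S : SymMat n) : ℝ := ⨅ i, ordEig S i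

/-- The largest eigenvalue. -/
noncomputable def maxEig {n : ℕ} (S : SymMat n) : ℝ := ⨆ i, ordEig S i

/-- The partial derivative `∂²u/∂xᵢ∂xⱼ` at `x`. -/
noncomputable def secondPartial {n : ℕ} (u : E n → ℝ) (x : E n) (i j : Fin n) : ℝ :=
  fderiv ℝ (fun y => fderiv ℝ u y (EuclideanSpace.single j 1)) x (EuclideanSpace.single i 1)

/-- The Hessian `D²u(x)`. Symmetrizing changes nothing where `u` is twice continuously
differentiable, the only points at which it is used; it makes the value a symmetric matrix
by definition. -/
noncomputable def hess {n : ℕ} (u : E n → ℝ) (x : E n) : SymMat n :=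
  ⟨Matrix.of fun i j => (secondPartial u x i j + secondPartial u x j i) / 2, by
    change (_ : Matrix (Fin n) (Fin n) ℝ).transpose = _
    ext i j
    simp [Matrix.transpose_apply, add_comm]⟩

/-- The symmetrized image `M = ⋃_σ T_σ Λ(B ∖ {0})` of the eigenvalue map `Λ(x) = λ(D²w(x))`. -/
def eigImage {n : ℕ} (w : E n → ℝ) : Set (Fin n → ℝ) :=
  {v | ∃ x ∈ unitBall n \ {0}, ∃ σ : Equiv.Perm (Fin n), v = ordEig (hess w x) ∘ σ}

/-- Uniform ellipticity of `F : S²(ℝⁿ) → ℝ`. -/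
def UniformlyElliptic {n : ℕ} (F : SymMat n → ℝ) : Prop :=
  ∃ C : ℝ, 1 ≤ C ∧ ∀ S N : SymMat n, (N : Matrix (Fin n) (Fin n) ℝ).PosSemidef →
    C⁻¹ * ‖N‖ ≤ F (S + N) - F S ∧ F (S + N) - F S ≤ C * ‖N‖

/-- `F(D²u) = 0` is a Hessian equation: `F(S) = f(λ(S))` with `f` invariant under permutations
of the coordinates. -/
def IsHessianOperator {n : ℕ} (F : SymMat n → ℝ) : Prop :=
  ∃ f : (Fin n → ℝ) → ℝ, (∀ (σ : Equiv.Perm (Fin n)) (v : Fin n → ℝ), f (v ∘ σ) = f v) ∧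
    ∀ S, F S = f (ordEig S)

/-- `F` is smooth on `S²(ℝⁿ)`. -/
def SmoothOperator {n : ℕ} (F : SymMat n → ℝ) : Prop := ContDiff ℝ ∞ F

/-- `u` is a viscosity solution of `F(D²u) = 0` in the open set `Ω` (`F` nondecreasing). -/
def IsViscositySolution {n : ℕ} (F : SymMat n → ℝ) (u : E n → ℝ) (Ω : Set (E n)) : Prop :=
  ContinuousOn u Ω ∧
  (∀ x ∈ Ω, ∀ φ : E n → ℝ, ContDiffAt ℝ 2 φ x →
    IsLocalMax (fun y => u y - φ y) x → 0 ≤ F (hess φ x)) ∧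
  (∀ x ∈ Ω, ∀ φ : E n → ℝ, ContDiffAt ℝ 2 φ x →
    IsLocalMin (fun y => u y - φ y) x → F (hess φ x) ≤ 0)

/-- The family of linear operators `L_{ab} = ∑ aᵢⱼ ∂²/∂xᵢ∂xⱼ` with coefficient matrices `A a b`
is uniformly elliptic, with one constant for the whole family. -/
def UniformlyEllipticFamily {n : ℕ} {α β : Type} (A : α → β → SymMat n) : Prop :=
  ∃ C : ℝ, 0 < C ∧ ∀ a b, ∀ ξ : Fin n → ℝ,
    C⁻¹ * (ξ ⬝ᵥ ξ) ≤ ξ ⬝ᵥ (A a b : Matrix (Fin n) (Fin n) ℝ).mulVec ξ ∧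
    ξ ⬝ᵥ (A a b : Matrix (Fin n) (Fin n) ℝ).mulVec ξ ≤ C * (ξ ⬝ᵥ ξ)

/-- The Isaacs operator `S ↦ sup_b inf_a (∑ aᵢⱼ Sᵢⱼ + f_{ab})`. For a uniformly elliptic family
`A`, bounded `f` and nonempty index sets, every supremum and infimum here is that of a nonempty
bounded set. -/
noncomputable def isaacs {n : ℕ} {α β : Type} (A : α → β → SymMat n) (f : α → β → ℝ)
    (S : SymMat n) : ℝ :=
  ⨆ b, ⨅ a, ((∑ i, ∑ j, (A a b : Matrix (Fin n) (Fin n) ℝ) i j *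
    (S : Matrix (Fin n) (Fin n) ℝ) i j) + f a b)

end HessianEq

open HessianEq
attribute [local instance] Matrix.frobeniusNormedAddCommGroup Matrix.frobeniusNormedSpace

/-! ### Spectral theory of real symmetric matrices -/

namespace HessianEq

open Matrix

variable {n : ℕ}

/-! For (i) it suffices to find a smooth symmetric `f` on all of ℝⁿ that vanishes on `M` and has all
partial derivatives between two positive constants: then `F = f ∘ λ` is elliptic, and `w` solves the
equation classically off the origin. The given `g` does this only near `M`. Choosing the rotation in
hypothesis (2) to align eigenvectors shows that the difference of two points of `M` is zero or has
positive and negative parts of comparable size. On such a vector `z` the Pucci function `p(z) = ∑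
min(a zᵢ, b zᵢ)` is at most `-‖z‖` when `b` is large compared with `a` (`pucci_le_neg_norm`). Hence,
on a uniform neighbourhood of `M`, a suitable extension `G` of `g` satisfies `G(y) + p(x - y) ≤
G(x)`, and the sup-convolution of `G` with `p` extends it to ℝⁿ with the same ellipticity
(`exists_extension`). Mollifying, gluing `G` back in near `M` and averaging over permutations gives
`f` (`exists_global_function`, `exists_operator`).

The uniform neighbourhood requires `∇G` to be uniformly continuous. Since `D²w` is homogeneous of
degree `-δ`, the set `M` is compact for `δ = 0` and a truncated cone over a compact set for `δ > 0`.
A cutoff of `g` serves in the first case, a function homogeneous of degree one away from the origin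
in the second (`exists_defining_function_of_cone`).

Smoothness of `f ∘ λ` is not immediate, because the ordered eigenvalues are only Lipschitz. Cramer's
rule for the Vandermonde matrix writes the gradient of `f` through the power fields `(vᵢᵏ)ᵢ` with
smooth symmetric coefficients `cₖ`. The derivative of `f ∘ λ` at `S` is then `H ↦ ∑ cₖ(λ(S)) tr(Sᵏ
H)`, and induction on the order of differentiability closes (`contDiff_comp_ordEig`).

At the origin a test function touching `w` from above has zero gradient. If `δ > 0`, its quadratic
growth would force `w ≤ 0`, which the sign change forbids. If `δ = 0`, its Hessian paraboloid lies
above `w` and can be lowered until it touches `w` away from the origin, where the equation holds.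
Contact from below reduces to this by passing to `-w` (`OddHomogeneous.isViscositySolution`).

For (ii), every difference of two Hessians of `w` is made nonpositive by some matrix in a fixed
compact convex set of elliptic matrices. If `δ = 0`, the operator `sup_b inf_L L·(S - D²w(b))`
vanishes at every Hessian of `w`. If `δ > 0`, homogeneity and oddness turn every linear combination
of two Hessians into a nonnegative multiple of a difference of Hessians. Separation in ℝ² then
yields an elliptic `L_{ab}` that annihilates both `D²w(a)` and `D²w(b)`
(`OddHomogeneous.exists_pair_eq_zero`), and no constant terms are needed. -/

/-- The diagonal matrix with entries `v`. -/
def diagS (v : Fin n → ℝ) : SymMat n := ⟨Matrix.diagonal v, Matrix.isSymm_diagonal v⟩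

/-- The identity matrix. -/
def oneS (n : ℕ) : SymMat n := ⟨1, Matrix.isSymm_one⟩

/-- The quadratic form of a symmetric matrix. -/
noncomputable def quad (S : SymMat n) (x : Fin n → ℝ) : ℝ :=
  x ⬝ᵥ (S : Matrix (Fin n) (Fin n) ℝ).mulVec x

theorem quad_add (S T : SymMat n) (x : Fin n → ℝ) : quad (S + T) x = quad S x + quad T x := by
  simp [quad, Matrix.add_mulVec, dotProduct_add]

theorem quad_sub (S T : SymMat n) (x : Fin n → ℝ) : quad (S - T) x = quad S x - quad T x := by
  simp [quad, Matrix.sub_mulVec, dotProduct_sub]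

theorem quad_smul (c : ℝ) (S : SymMat n) (x : Fin n → ℝ) : quad (c • S) x = c * quad S x := by
  simp [quad, Matrix.smul_mulVec, dotProduct_smul]

theorem quad_neg (S : SymMat n) (x : Fin n → ℝ) : quad (-S) x = - quad S x := by
  simp [quad, Matrix.neg_mulVec, dotProduct_neg]

theorem quad_one (x : Fin n → ℝ) : quad (oneS n) x = x ⬝ᵥ x := by
  simp [quad, oneS]

theorem orth_mul_transpose (P : Matrix.orthogonalGroup (Fin n) ℝ) :
    (P : Matrix (Fin n) (Fin n) ℝ) * (P : Matrix (Fin n) (Fin n) ℝ)ᵀ = 1 :=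
  Matrix.mem_orthogonalGroup_iff (Fin n) ℝ |>.1 P.2

theorem orth_transpose_mul (P : Matrix.orthogonalGroup (Fin n) ℝ) :
    (P : Matrix (Fin n) (Fin n) ℝ)ᵀ * (P : Matrix (Fin n) (Fin n) ℝ) = 1 :=
  Matrix.mem_orthogonalGroup_iff' (Fin n) ℝ |>.1 P.2

theorem coe_conj (P : Matrix.orthogonalGroup (Fin n) ℝ) (S : SymMat n) :
    (conj P S : Matrix (Fin n) (Fin n) ℝ) =
      (P : Matrix (Fin n) (Fin n) ℝ)ᵀ * (S : Matrix (Fin n) (Fin n) ℝ) * P := rfl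

theorem quad_conj (P : Matrix.orthogonalGroup (Fin n) ℝ) (S : SymMat n) (x : Fin n → ℝ) :
    quad (conj P S) x = quad S ((P : Matrix (Fin n) (Fin n) ℝ).mulVec x) := by
  rw [quad, quad, coe_conj, ← Matrix.mulVec_mulVec, ← Matrix.mulVec_mulVec,
    Matrix.dotProduct_mulVec, Matrix.vecMul_transpose]

theorem quad_diagS (v x : Fin n → ℝ) : quad (diagS v) x = ∑ i, v i * x i ^ 2 := by
  simp only [quad, diagS, dotProduct, Matrix.mulVec_diagonal]
  exact Finset.sum_congr rfl fun i _ => by ring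

theorem orth_dot (P : Matrix.orthogonalGroup (Fin n) ℝ) (x : Fin n → ℝ) :
    ∑ i, ((P : Matrix (Fin n) (Fin n) ℝ).mulVec x i) ^ 2 = x ⬝ᵥ x := by
  have h := quad_conj P (oneS n) x
  have h1 : conj P (oneS n) = oneS n := by
    apply Subtype.ext
    rw [coe_conj]
    simp [oneS, orth_transpose_mul]
  rw [h1, quad_one, quad_one] at h
  rw [h, dotProduct]
  exact Finset.sum_congr rfl fun i _ => by ring

/-- The rows of `P` are the eigenvectors of `conj P (diagS v)`; permuting the rows together with the
diagonal changes nothing. -/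
theorem exists_conj_diagS_comp (P : Matrix.orthogonalGroup (Fin n) ℝ) (v : Fin n → ℝ)
    (σ : Equiv.Perm (Fin n)) :
    ∃ Q : Matrix.orthogonalGroup (Fin n) ℝ, conj P (diagS v) = conj Q (diagS (v ∘ σ)) := by
  have hmem : (P : Matrix (Fin n) (Fin n) ℝ).submatrix σ id ∈ Matrix.orthogonalGroup (Fin n) ℝ := by
    rw [Matrix.mem_orthogonalGroup_iff]
    change (P : Matrix (Fin n) (Fin n) ℝ).submatrix σ id *
      ((P : Matrix (Fin n) (Fin n) ℝ).submatrix σ id)ᵀ = 1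
    rw [Matrix.transpose_submatrix, ← Matrix.submatrix_mul _ _ σ id σ Function.bijective_id,
      orth_mul_transpose]
    simp
  refine ⟨⟨_, hmem⟩, Subtype.ext ?_⟩
  rw [coe_conj]
  change _ = ((P : Matrix (Fin n) (Fin n) ℝ).submatrix σ id)ᵀ * Matrix.diagonal (v ∘ σ) *
    (P : Matrix (Fin n) (Fin n) ℝ).submatrix σ id
  rw [← Matrix.submatrix_diagonal_equiv, Matrix.transpose_submatrix,
    ← Matrix.submatrix_mul _ _ id σ σ σ.bijective, ← Matrix.submatrix_mul _ _ id σ id σ.bijective]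
  rfl

/-- Spectral decomposition, with the eigenvalues in a prescribed order. -/
theorem exists_conj_diagS (S : SymMat n) (σ : Equiv.Perm (Fin n)) :
    ∃ P : Matrix.orthogonalGroup (Fin n) ℝ, S = conj P (diagS (ordEig S ∘ σ)) := by
  have hS := isHermitian_coe S
  have hmem : (hS.eigenvectorUnitary : Matrix (Fin n) (Fin n) ℝ)ᵀ ∈
      Matrix.orthogonalGroup (Fin n) ℝ := by
    rw [Matrix.mem_orthogonalGroup_iff]
    exact orth_transpose_mul hS.eigenvectorUnitary
  have hsp : S = conj ⟨_, hmem⟩ (diagS hS.eigenvalues) := by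
    apply Subtype.ext
    have := hS.spectral_theorem
    rw [Unitary.conjStarAlgAut_apply] at this
    rw [coe_conj]
    exact this
  obtain ⟨Q, hQ⟩ := exists_conj_diagS_comp ⟨_, hmem⟩ hS.eigenvalues
    (σ.trans (Tuple.sort hS.eigenvalues))
  exact ⟨Q, hsp.trans hQ⟩

theorem ordEig_mono (S : SymMat n) : Monotone (ordEig S) := Tuple.monotone_sort _

/-- The dimension count of Courant–Fischer: a nonzero `x` orthogonal to the eigenvectors of index
below `i` of the first matrix and above `i` of the second meets only `n - 1` linear conditions. At
this `x` the two quadratic forms are bounded by `u i` from below and by `v i` from above. -/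
theorem le_of_quad_conj_diagS_le {P Q : Matrix.orthogonalGroup (Fin n) ℝ} {u v : Fin n → ℝ}
    (hu : Monotone u) (hv : Monotone v)
    (h : ∀ x, quad (conj P (diagS u)) x ≤ quad (conj Q (diagS v)) x) (i : Fin n) :
    u i ≤ v i := by
  by_contra! hlt
  let Φ : (Fin n → ℝ) →ₗ[ℝ] ({j : Fin n // j ≠ i} → ℝ) := LinearMap.pi fun j =>
    if j.1 < i then LinearMap.proj j.1 ∘ₗ Matrix.mulVecLin (P : Matrix (Fin n) (Fin n) ℝ)
    else LinearMap.proj j.1 ∘ₗ Matrix.mulVecLin (Q : Matrix (Fin n) (Fin n) ℝ)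
  have hker : LinearMap.ker Φ ≠ ⊥ := by
    apply LinearMap.ker_ne_bot_of_finrank_lt
    have : 0 < n := i.pos
    simp
    omega
  obtain ⟨x, hx, hx0⟩ := (Submodule.ne_bot_iff _).1 hker
  have h1 : ∀ j, j < i → (P : Matrix (Fin n) (Fin n) ℝ).mulVec x j = 0 := by
    intro j hj
    have := congrFun (LinearMap.mem_ker.1 hx) ⟨j, hj.ne⟩
    simpa [Φ, hj] using this
  have h2 : ∀ j, i < j → (Q : Matrix (Fin n) (Fin n) ℝ).mulVec x j = 0 := by
    intro j hj
    have := congrFun (LinearMap.mem_ker.1 hx) ⟨j, hj.ne'⟩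
    simpa [Φ, hj.le, not_lt.2 hj.le] using this
  have hS : u i * (x ⬝ᵥ x) ≤ quad (conj P (diagS u)) x := by
    rw [quad_conj, quad_diagS, ← orth_dot P, Finset.mul_sum]
    refine Finset.sum_le_sum fun j _ => ?_
    rcases lt_or_ge j i with hj | hj
    · simp [h1 j hj]
    · exact mul_le_mul_of_nonneg_right (hu hj) (sq_nonneg _)
  have hT : quad (conj Q (diagS v)) x ≤ v i * (x ⬝ᵥ x) := by
    rw [quad_conj, quad_diagS, ← orth_dot Q, Finset.mul_sum]
    refine Finset.sum_le_sum fun j _ => ?_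
    rcases lt_or_ge i j with hj | hj
    · simp [h2 j hj]
    · exact mul_le_mul_of_nonneg_right (hv hj) (sq_nonneg _)
  have hpos : 0 < x ⬝ᵥ x := by
    have := Matrix.dotProduct_star_self_pos_iff (v := x) |>.2 hx0
    simpa using this
  nlinarith [h x]

theorem exists_conj_diagS_ordEig (S : SymMat n) :
    ∃ P : Matrix.orthogonalGroup (Fin n) ℝ, S = conj P (diagS (ordEig S)) :=
  exists_conj_diagS S 1

theorem ordEig_le_of_quad_le {S T : SymMat n} (h : ∀ x, quad S x ≤ quad T x) (i : Fin n) :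
    ordEig S i ≤ ordEig T i := by
  obtain ⟨P, hP⟩ := exists_conj_diagS_ordEig S
  obtain ⟨Q, hQ⟩ := exists_conj_diagS_ordEig T
  refine le_of_quad_conj_diagS_le (P := P) (Q := Q) (ordEig_mono S) (ordEig_mono T) ?_ i
  rwa [← hP, ← hQ]

/-- The ordered eigenvalues are determined by any ordered diagonalization. -/
theorem ordEig_conj_diagS (P : Matrix.orthogonalGroup (Fin n) ℝ) {v : Fin n → ℝ}
    (hv : Monotone v) : ordEig (conj P (diagS v)) = v := by
  obtain ⟨Q, hQ⟩ := exists_conj_diagS_ordEig (conj P (diagS v))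
  funext i
  refine le_antisymm (le_of_quad_conj_diagS_le (P := Q) (Q := P) (ordEig_mono _) hv ?_ i)
    (le_of_quad_conj_diagS_le (P := P) (Q := Q) hv (ordEig_mono _) ?_ i)
  · rw [← hQ]; exact fun _ => le_rfl
  · rw [← hQ]; exact fun _ => le_rfl

/-- The ordered eigenvalues are a permutation of the diagonal of any diagonalization. -/
theorem exists_perm_ordEig (P : Matrix.orthogonalGroup (Fin n) ℝ) (v : Fin n → ℝ) :
    ∃ σ : Equiv.Perm (Fin n), ordEig (conj P (diagS v)) = v ∘ σ := by
  obtain ⟨Q, hQ⟩ := exists_conj_diagS_comp P v (Tuple.sort v)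
  exact ⟨Tuple.sort v, by rw [hQ, ordEig_conj_diagS Q (Tuple.monotone_sort v)]⟩

theorem conj_diagS_smul (P : Matrix.orthogonalGroup (Fin n) ℝ) (v : Fin n → ℝ) (c : ℝ) :
    conj P (diagS (c • v)) = c • conj P (diagS v) := by
  apply Subtype.ext
  simp only [coe_conj, diagS, Submodule.coe_smul, Matrix.diagonal_smul]
  simp

theorem conj_diagS_sub (P : Matrix.orthogonalGroup (Fin n) ℝ) (u v : Fin n → ℝ) :
    conj P (diagS (u - v)) = conj P (diagS u) - conj P (diagS v) := by
  apply Subtype.ext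
  have : Matrix.diagonal (u - v) = Matrix.diagonal u - Matrix.diagonal v :=
    (Matrix.diagonal_sub u v).symm
  simp only [coe_conj, diagS, Submodule.coe_sub, this, Matrix.mul_sub, Matrix.sub_mul]

theorem conj_diagS_add_one (P : Matrix.orthogonalGroup (Fin n) ℝ) (v : Fin n → ℝ) (c : ℝ) :
    conj P (diagS (fun i => v i + c)) = conj P (diagS v) + c • oneS n := by
  apply Subtype.ext
  have : Matrix.diagonal (fun i => v i + c) = Matrix.diagonal v + c • 1 := by
    rw [← Matrix.diagonal_one, ← Matrix.diagonal_smul, Matrix.diagonal_add]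
    simp
  simp only [coe_conj, diagS, oneS, Submodule.coe_add, Submodule.coe_smul, this, Matrix.mul_add,
    Matrix.add_mul]
  simp [orth_transpose_mul]

theorem conj_mul (P Q : Matrix.orthogonalGroup (Fin n) ℝ) (S : SymMat n) :
    conj (P * Q) S = conj Q (conj P S) := by
  apply Subtype.ext
  simp [coe_conj, Matrix.mul_assoc, Matrix.transpose_mul]

theorem conj_one (S : SymMat n) : conj 1 S = S := by
  apply Subtype.ext
  simp [coe_conj]

theorem ordEig_smul {c : ℝ} (hc : 0 ≤ c) (S : SymMat n) : ordEig (c • S) = c • ordEig S := by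
  obtain ⟨P, hP⟩ := exists_conj_diagS_ordEig S
  conv_lhs => rw [hP, ← conj_diagS_smul]
  exact ordEig_conj_diagS P fun i j hij => mul_le_mul_of_nonneg_left (ordEig_mono S hij) hc

theorem ordEig_add_one (S : SymMat n) (c : ℝ) :
    ordEig (S + c • oneS n) = fun i => ordEig S i + c := by
  obtain ⟨P, hP⟩ := exists_conj_diagS_ordEig S
  conv_lhs => rw [hP, ← conj_diagS_add_one]
  exact ordEig_conj_diagS P fun i j hij => add_le_add_left (ordEig_mono S hij) c

theorem frobenius_norm_sq (S : SymMat n) :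
    ‖S‖ ^ 2 = ∑ i, ∑ j, (S : Matrix (Fin n) (Fin n) ℝ) i j ^ 2 := by
  have h : ‖S‖ = (∑ i, ∑ j, ‖(S : Matrix (Fin n) (Fin n) ℝ) i j‖ ^ (2 : ℝ)) ^ (1 / 2 : ℝ) :=
    Matrix.frobenius_norm_def _
  rw [h, ← Real.sqrt_eq_rpow, Real.sq_sqrt]
  · simp
  · positivity

theorem trace_mul_self (S : SymMat n) :
    ((S : Matrix (Fin n) (Fin n) ℝ) * (S : Matrix (Fin n) (Fin n) ℝ)).trace = ‖S‖ ^ 2 := by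
  rw [frobenius_norm_sq, Matrix.trace]
  refine Finset.sum_congr rfl fun i _ => ?_
  rw [Matrix.diag_apply, Matrix.mul_apply]
  refine Finset.sum_congr rfl fun j _ => ?_
  have h : (S : Matrix (Fin n) (Fin n) ℝ).transpose = S := S.2
  have : (S : Matrix (Fin n) (Fin n) ℝ) j i = (S : Matrix (Fin n) (Fin n) ℝ) i j := by
    conv_lhs => rw [← h]
    rfl
  rw [this, sq]

theorem conj_diagS_pow (P : Matrix.orthogonalGroup (Fin n) ℝ) (v : Fin n → ℝ) (m : ℕ) :
    (conj P (diagS v) : Matrix (Fin n) (Fin n) ℝ) ^ m =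
      (P : Matrix (Fin n) (Fin n) ℝ)ᵀ * Matrix.diagonal (v ^ m) * P := by
  induction m with
  | zero => simp [orth_transpose_mul]
  | succ m ih =>
    rw [pow_succ, ih, coe_conj]
    change _ * (_ * Matrix.diagonal v * _) = _
    rw [show v ^ (m + 1) = fun i => (v ^ m) i * v i from pow_succ v m,
      ← Matrix.diagonal_mul_diagonal]
    simp only [Matrix.mul_assoc]
    rw [← Matrix.mul_assoc (P : Matrix (Fin n) (Fin n) ℝ) (P : Matrix (Fin n) (Fin n) ℝ)ᵀ,
      orth_mul_transpose, Matrix.one_mul]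

/-- Power sums of the eigenvalues are polynomial in the entries; smoothness of spectral functions is
reduced to this. -/
theorem trace_pow_eq_sum (S : SymMat n) (m : ℕ) :
    ((S : Matrix (Fin n) (Fin n) ℝ) ^ m).trace = ∑ i, ordEig S i ^ m := by
  obtain ⟨P, hP⟩ := exists_conj_diagS_ordEig S
  conv_lhs => rw [hP]
  rw [conj_diagS_pow, Matrix.trace_mul_comm, ← Matrix.mul_assoc, orth_mul_transpose,
    Matrix.one_mul, Matrix.trace_diagonal]
  rfl

theorem norm_sq_eq_sum (S : SymMat n) : ‖S‖ ^ 2 = ∑ i, ordEig S i ^ 2 := by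
  rw [← trace_mul_self, ← sq, trace_pow_eq_sum]

theorem abs_ordEig_le (S : SymMat n) (i : Fin n) : |ordEig S i| ≤ ‖S‖ := by
  apply abs_le_of_sq_le_sq _ (norm_nonneg S)
  rw [norm_sq_eq_sum]
  exact Finset.single_le_sum (f := fun i => ordEig S i ^ 2) (fun _ _ => sq_nonneg _)
    (Finset.mem_univ i)

theorem abs_quad_le (S : SymMat n) (x : Fin n → ℝ) : |quad S x| ≤ ‖S‖ * (x ⬝ᵥ x) := by
  obtain ⟨P, hP⟩ := exists_conj_diagS_ordEig S
  conv_lhs => rw [hP]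
  rw [quad_conj, quad_diagS, ← orth_dot P, Finset.mul_sum]
  refine (Finset.abs_sum_le_sum_abs _ _).trans (Finset.sum_le_sum fun i _ => ?_)
  rw [abs_mul, abs_of_nonneg (sq_nonneg ((P : Matrix (Fin n) (Fin n) ℝ).mulVec x i))]
  exact mul_le_mul_of_nonneg_right (abs_ordEig_le S i) (sq_nonneg _)

/-- Weyl's inequality, from `S ≤ T + ‖S - T‖ I` and monotonicity of the ordered eigenvalues. -/
theorem abs_ordEig_sub_le (S T : SymMat n) (i : Fin n) :
    |ordEig S i - ordEig T i| ≤ ‖S - T‖ := by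
  have key : ∀ S T : SymMat n, ordEig S i ≤ ordEig T i + ‖S - T‖ := by
    intro S T
    have := ordEig_le_of_quad_le (S := S) (T := T + ‖S - T‖ • oneS n) (fun x => by
      have := (abs_le.1 (abs_quad_le (S - T) x)).2
      rw [quad_sub] at this
      rw [quad_add, quad_smul, quad_one]
      linarith) i
    rwa [ordEig_add_one] at this
  rw [abs_le]
  have h1 := key S T
  have h2 := key T S
  rw [norm_sub_rev] at h2
  constructor <;> linarith

theorem norm_ordEig_sub_le (S T : SymMat n) : ‖ordEig S - ordEig T‖ ≤ ‖S - T‖ :=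
  (pi_norm_le_iff_of_nonneg (norm_nonneg _)).2 fun i => abs_ordEig_sub_le S T i

theorem continuous_ordEig : Continuous (ordEig : SymMat n → Fin n → ℝ) :=
  (LipschitzWith.of_dist_le_mul (K := 1) fun S T => by
    rw [dist_eq_norm, dist_eq_norm, NNReal.coe_one, one_mul]
    exact norm_ordEig_sub_le S T).continuous

theorem trace_eq_sum_ordEig (S : SymMat n) :
    (S : Matrix (Fin n) (Fin n) ℝ).trace = ∑ i, ordEig S i := by
  simpa using trace_pow_eq_sum S 1

theorem minEig_conj_diagS (P : Matrix.orthogonalGroup (Fin n) ℝ) (v : Fin n → ℝ) :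
    minEig (conj P (diagS v)) = ⨅ i, v i := by
  obtain ⟨σ, hσ⟩ := exists_perm_ordEig P v
  rw [minEig, hσ]
  exact σ.surjective.iInf_comp v

theorem maxEig_conj_diagS (P : Matrix.orthogonalGroup (Fin n) ℝ) (v : Fin n → ℝ) :
    maxEig (conj P (diagS v)) = ⨆ i, v i := by
  obtain ⟨σ, hσ⟩ := exists_perm_ordEig P v
  rw [maxEig, hσ]
  exact σ.surjective.iSup_comp v

theorem conj_eq_zero_iff (P : Matrix.orthogonalGroup (Fin n) ℝ) (v : Fin n → ℝ) :
    conj P (diagS v) = 0 ↔ v = 0 := by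
  constructor
  · intro h
    obtain ⟨σ, hσ⟩ := exists_perm_ordEig P v
    have h1 := norm_sq_eq_sum (conj P (diagS v))
    rw [h, norm_zero, ← h, hσ] at h1
    have h2 := (Finset.sum_eq_zero_iff_of_nonneg fun i _ => sq_nonneg _).1 (h1.symm.trans (by simp))
    funext i
    obtain ⟨j, rfl⟩ := σ.surjective i
    simpa using h2 j (Finset.mem_univ j)
  · rintro rfl
    apply Subtype.ext
    rw [coe_conj]
    simp [diagS]

theorem quad_nonneg_of_posSemidef {N : SymMat n}
    (hN : (N : Matrix (Fin n) (Fin n) ℝ).PosSemidef) (x : Fin n → ℝ) : 0 ≤ quad N x := by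
  have := hN.dotProduct_mulVec_nonneg x
  simpa [quad] using this

theorem posSemidef_of_quad_nonneg {N : SymMat n} (h : ∀ x, 0 ≤ quad N x) :
    (N : Matrix (Fin n) (Fin n) ℝ).PosSemidef :=
  Matrix.PosSemidef.of_dotProduct_mulVec_nonneg (isHermitian_coe N) fun x => by
    simpa [quad] using h x

end HessianEq

/-! ### Division of smooth functions and smooth equivariant vector fields -/

namespace HessianEq

open Matrix

variable {n : ℕ}

/-- Integrals of smooth functions depend smoothly on parameters. -/
theorem contDiff_intervalIntegral_param {V : Type*} [NormedAddCommGroup V] [NormedSpace ℝ V]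
    [FiniteDimensional ℝ V] (f : V × ℝ → ℝ) (hf : ContDiff ℝ ∞ f) :
    ContDiff ℝ ∞ fun x => ∫ t in (0 : ℝ)..1, f (x, t) := by
  rw [contDiff_infty]
  intro k
  induction k generalizing f with
  | zero =>
    rw [Nat.cast_zero, contDiff_zero]
    exact intervalIntegral.continuous_parametric_intervalIntegral_of_continuous'
      (f := fun x t => f (x, t)) hf.continuous 0 1
  | succ k ih =>
    have hf1 : ContDiff ℝ ∞ (fderiv ℝ f) := (contDiff_infty_iff_fderiv.1 hf).2
    set F' : V → ℝ → V →L[ℝ] ℝ := fun x t =>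
      (fderiv ℝ f (x, t)).comp (ContinuousLinearMap.inl ℝ V ℝ) with hF'
    have hF'c : Continuous fun p : V × ℝ => F' p.1 p.2 :=
      ((ContinuousLinearMap.compL ℝ V (V × ℝ) ℝ).flip
        (ContinuousLinearMap.inl ℝ V ℝ)).continuous.comp hf1.continuous
    have hder : ∀ x₀, HasFDerivAt (fun x => ∫ t in (0 : ℝ)..1, f (x, t))
        (∫ t in (0 : ℝ)..1, F' x₀ t) x₀ := by
      intro x₀
      obtain ⟨C, hC⟩ := ((isCompact_closedBall x₀ 1).prod
        (isCompact_uIcc (a := (0 : ℝ)) (b := 1))).exists_bound_of_continuousOn hF'c.continuousOn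
      refine intervalIntegral.hasFDerivAt_integral_of_dominated_of_fderiv_le (bound := fun _ => C)
        (F := fun x t => f (x, t)) (F' := F') (Metric.closedBall_mem_nhds x₀ one_pos) ?_ ?_ ?_ ?_ ?_ ?_
      · exact Filter.Eventually.of_forall fun x =>
          (hf.continuous.comp (by fun_prop : Continuous fun t : ℝ => (x, t))).aestronglyMeasurable
      · exact (hf.continuous.comp (by fun_prop : Continuous fun t : ℝ => (x₀, t))).intervalIntegrable _ _
      · exact (hF'c.comp (by fun_prop : Continuous fun t : ℝ => (x₀, t))).aestronglyMeasurable
      · exact Filter.Eventually.of_forall fun t ht x hx =>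
          hC (x, t) ⟨hx, Set.uIoc_subset_uIcc ht⟩
      · exact intervalIntegrable_const
      · refine Filter.Eventually.of_forall fun t _ x _ => ?_
        have h1 : HasFDerivAt f (fderiv ℝ f (x, t)) (x, t) :=
          (hf.differentiable (by simp) (x, t)).hasFDerivAt
        exact h1.comp x (hasFDerivAt_prodMk_left x t)
    push_cast
    rw [contDiff_succ_iff_fderiv_apply]
    refine ⟨fun x => (hder x).differentiableAt, by simp, fun v => ?_⟩
    -- A directional derivative is again a parameter integral of a smooth function, so the induction
    -- hypothesis, stated for all integrands, applies to it.
    have heq : (fun x => fderiv ℝ (fun x => ∫ t in (0 : ℝ)..1, f (x, t)) x v) =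
        fun x => ∫ t in (0 : ℝ)..1, fderiv ℝ f (x, t) (v, 0) := by
      funext x
      rw [(hder x).fderiv, ContinuousLinearMap.intervalIntegral_apply]
      · rfl
      · exact (hF'c.comp (by fun_prop : Continuous fun t : ℝ => (x, t))).intervalIntegrable _ _
    rw [heq]
    exact ih (fun p => fderiv ℝ f p (v, 0)) (hf1.clm_apply contDiff_const)

/-- A smooth function vanishing on the hyperplane `λᵢ = λⱼ` is divisible by `λⱼ - λᵢ`. -/
theorem exists_smooth_div_sub {i j : Fin n} (hij : i ≠ j) {h : (Fin n → ℝ) → ℝ}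
    (hh : ContDiff ℝ ∞ h) (h0 : ∀ v : Fin n → ℝ, v i = v j → h v = 0) :
    ∃ k : (Fin n → ℝ) → ℝ, ContDiff ℝ ∞ k ∧ ∀ v, h v = (v j - v i) * k v := by
  have hh1 : ContDiff ℝ ∞ (fderiv ℝ h) := (contDiff_infty_iff_fderiv.1 hh).2
  set e : Fin n → ℝ := Pi.single j 1 with he
  -- The segment that ends at `v` for `t = 1` and starts at `t = 0` on the hyperplane, with `v j`
  -- replaced by `v i`. Hadamard's lemma along it gives the quotient as an integral of the `j`-th
  -- partial derivative.
  set γ : (Fin n → ℝ) × ℝ → (Fin n → ℝ) := fun p =>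
    p.1 - ((1 - p.2) * (p.1 j - p.1 i)) • e with hγ
  have hγs : ContDiff ℝ ∞ γ := by
    have h1 : ∀ k : Fin n, ContDiff ℝ ∞ fun p : (Fin n → ℝ) × ℝ => p.1 k := fun k =>
      (contDiff_apply ℝ ℝ k).comp contDiff_fst
    exact contDiff_fst.sub ((((contDiff_const.sub contDiff_snd)).mul
      ((h1 j).sub (h1 i))).smul contDiff_const)
  refine ⟨fun v => ∫ t in (0 : ℝ)..1, fderiv ℝ h (γ (v, t)) e,
    contDiff_intervalIntegral_param (fun p => fderiv ℝ h (γ p) e)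
      ((hh1.comp hγs).clm_apply contDiff_const), fun v => ?_⟩
  have hcont : Continuous fun t : ℝ => fderiv ℝ h (γ (v, t)) e :=
    ((hh1.comp hγs).clm_apply contDiff_const).continuous.comp
      (by fun_prop : Continuous fun t : ℝ => (v, t))
  have hd : ∀ t : ℝ, HasDerivAt (fun t => h (γ (v, t)))
      ((v j - v i) * fderiv ℝ h (γ (v, t)) e) t := by
    intro t
    have h1 : HasDerivAt (fun t => γ (v, t)) ((v j - v i) • e) t := by
      have h2 : HasDerivAt (fun t : ℝ => (1 - t) * (v j - v i)) (-1 * (v j - v i)) t :=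
        ((hasDerivAt_id t).const_sub 1).mul_const _
      have := (h2.smul_const e).const_sub v
      rw [neg_one_mul, neg_smul, neg_neg] at this
      exact this
    have := (hh.differentiable (by simp) (γ (v, t))).hasFDerivAt.comp_hasDerivAt t h1
    rw [map_smul, smul_eq_mul] at this
    exact this
  have hFTC := intervalIntegral.integral_eq_sub_of_hasDerivAt (a := 0) (b := 1)
    (fun t _ => hd t) ((continuous_const.mul hcont).intervalIntegrable _ _)
  rw [intervalIntegral.integral_const_mul] at hFTC
  rw [hFTC]
  have h1 : γ (v, 1) = v := by simp [hγ]
  have h2 : h (γ (v, 0)) = 0 := by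
    apply h0
    simp [hγ, he, hij]
  rw [h1, h2, sub_zero]

/-- Off the hyperplane the factor cancels; on it, `v` is a limit of points of the line along `e`,
which leaves the hyperplane. Only one line is needed, so `v` may be confined to another hyperplane
that contains `e`. -/
theorem eq_zero_of_sub_mul_eq_zero {i j : Fin n} {k : (Fin n → ℝ) → ℝ}
    (hk : Continuous k) (v e : Fin n → ℝ) (he : e i ≠ e j)
    (h : ∀ t : ℝ, ((v + t • e) j - (v + t • e) i) * k (v + t • e) = 0) : k v = 0 := by
  by_cases hv : v j - v i = 0
  · have hlim : Filter.Tendsto (fun t : ℝ => k (v + t • e)) (nhdsWithin 0 {0}ᶜ) (nhds (k v)) := by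
      have : Continuous fun t : ℝ => k (v + t • e) := by fun_prop
      simpa using this.continuousAt.tendsto.mono_left (nhdsWithin_le_nhds (s := {0}ᶜ) (a := (0:ℝ)))
    refine tendsto_nhds_unique hlim (tendsto_const_nhds.congr' ?_)
    filter_upwards [self_mem_nhdsWithin] with t ht
    have h1 := h t
    rcases mul_eq_zero.1 h1 with h2 | h2
    · exfalso
      have h3 : t * (e j - e i) = 0 := by
        simp only [Pi.add_apply, Pi.smul_apply, smul_eq_mul] at h2
        linear_combination h2 - hv
      rcases mul_eq_zero.1 h3 with h4 | h4
      · exact ht h4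
      · exact he (sub_eq_zero.1 h4).symm
    · exact h2.symm
  · have := h 0
    simpa [hv] using this

/-- The factors are divided out one at a time: after division by the factor of `p`, the quotient
still vanishes on the other hyperplanes, since each contains a direction transverse to that of `p`.
-/
theorem exists_smooth_div_prod (s : Finset (Fin n × Fin n)) (hs : ∀ p ∈ s, p.1 < p.2)
    {h : (Fin n → ℝ) → ℝ} (hh : ContDiff ℝ ∞ h)
    (h0 : ∀ p ∈ s, ∀ v : Fin n → ℝ, v p.1 = v p.2 → h v = 0) :
    ∃ k : (Fin n → ℝ) → ℝ, ContDiff ℝ ∞ k ∧ ∀ v, h v = (∏ p ∈ s, (v p.2 - v p.1)) * k v := by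
  induction s using Finset.induction_on generalizing h with
  | empty => exact ⟨h, hh, by simp⟩
  | insert p s hp ih =>
    have hpl : p.1 < p.2 := hs p (Finset.mem_insert_self _ _)
    obtain ⟨h1, hh1, he1⟩ := exists_smooth_div_sub hpl.ne hh (h0 p (Finset.mem_insert_self _ _))
    have hz : ∀ q ∈ s, ∀ v : Fin n → ℝ, v q.1 = v q.2 → h1 v = 0 := by
      intro q hq v hv
      have hql := hs q (Finset.mem_insert_of_mem hq)
      have hpq : p ≠ q := fun h => hp (h ▸ hq)
      -- A unit vector at an index of `p` that does not occur in `q`; one exists because distinct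
      -- ordered pairs are distinct as sets.
      obtain ⟨e, he, heq⟩ : ∃ e : Fin n → ℝ, e p.1 ≠ e p.2 ∧ e q.1 = e q.2 := by
        by_cases h1 : p.1 = q.1 ∨ p.1 = q.2
        · by_cases h2 : p.2 = q.1 ∨ p.2 = q.2
          · exfalso
            apply hpq
            apply Prod.ext <;> omega
          · push Not at h2
            refine ⟨Pi.single p.2 1, ?_, ?_⟩
            · simp [hpl.ne]
            · rw [Pi.single_eq_of_ne h2.1.symm, Pi.single_eq_of_ne h2.2.symm]
        · push Not at h1
          refine ⟨Pi.single p.1 1, ?_, ?_⟩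
          · simp [hpl.ne']
          · rw [Pi.single_eq_of_ne h1.1.symm, Pi.single_eq_of_ne h1.2.symm]
      refine eq_zero_of_sub_mul_eq_zero hh1.continuous v e he fun t => ?_
      rw [← he1]
      exact h0 q (Finset.mem_insert_of_mem hq) _ (by simp [hv, heq])
    obtain ⟨k, hk, hke⟩ := ih (fun q hq => hs q (Finset.mem_insert_of_mem hq)) hh1 hz
    refine ⟨k, hk, fun v => ?_⟩
    rw [he1, hke, Finset.prod_insert hp, mul_assoc]

theorem eq_zero_of_prod_mul_eq_zero (s : Finset (Fin n × Fin n)) (hs : ∀ p ∈ s, p.1 < p.2)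
    {k : (Fin n → ℝ) → ℝ} (hk : Continuous k)
    (h : ∀ v, (∏ p ∈ s, (v p.2 - v p.1)) * k v = 0) : ∀ v, k v = 0 := by
  induction s using Finset.induction_on generalizing k with
  | empty => simpa using h
  | insert p s hp ih =>
    have hpl : p.1 < p.2 := hs p (Finset.mem_insert_self _ _)
    have h1 := ih (fun q hq => hs q (Finset.mem_insert_of_mem hq))
      (k := fun v => (v p.2 - v p.1) * k v) (by fun_prop) (fun v => by
        rw [← h v, Finset.prod_insert hp]; ring)
    intro v
    refine eq_zero_of_sub_mul_eq_zero hk v (Pi.single p.1 1) ?_ fun t => h1 _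
    simp [hpl.ne']

theorem det_vandermonde_eq_prod_filter (v : Fin n → ℝ) :
    (Matrix.vandermonde v).det =
      ∏ p ∈ Finset.univ.filter (fun p : Fin n × Fin n => p.1 < p.2), (v p.2 - v p.1) := by
  rw [Matrix.det_vandermonde, Finset.prod_sigma']
  refine Finset.prod_bij' (fun p _ => (p.1, p.2)) (fun p _ => ⟨p.1, p.2⟩) ?_ ?_ ?_ ?_ ?_ <;> simp

/-- Smooth equivariant vector fields on `ℝⁿ` are combinations of the power fields
`v ↦ (vᵢᵏ)ᵢ` with smooth symmetric coefficients. -/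
theorem exists_smooth_symm_coeff (u : Fin n → (Fin n → ℝ) → ℝ) (hu : ∀ i, ContDiff ℝ ∞ (u i))
    (hσ : ∀ (σ : Equiv.Perm (Fin n)) i v, u i (v ∘ σ) = u (σ i) v) :
    ∃ c : Fin n → (Fin n → ℝ) → ℝ, (∀ k, ContDiff ℝ ∞ (c k)) ∧
      (∀ k (σ : Equiv.Perm (Fin n)) v, c k (v ∘ σ) = c k v) ∧
      ∀ v i, ∑ k, c k v * v i ^ (k : ℕ) = u i v := by
  have huij : ∀ i j v, v i = v j → u i v = u j v := by
    intro i j v hv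
    have h1 : v ∘ Equiv.swap i j = v := by
      funext k
      simp only [Function.comp_apply, Equiv.swap_apply_def]
      split_ifs with h1 h2
      · rw [h1, hv]
      · rw [h2, hv]
      · rfl
    have := hσ (Equiv.swap i j) i v
    rwa [h1, Equiv.swap_apply_left] at this
  set s := Finset.univ.filter (fun p : Fin n × Fin n => p.1 < p.2) with hs
  have hsl : ∀ p ∈ s, p.1 < p.2 := by simp [hs]
  -- These are the Cramer numerators for the Vandermonde system. Equivariance makes two rows
  -- coincide when `v i = v j`, so they are divisible by the Vandermonde determinant.
  have hN : ∀ k : Fin n, ContDiff ℝ ∞ fun v =>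
      ((Matrix.vandermonde v).updateCol k fun i => u i v).det := by
    intro k
    simp only [Matrix.det_apply]
    refine ContDiff.sum fun τ _ => ContDiff.const_smul _ (contDiff_prod fun i _ => ?_)
    simp only [Matrix.updateCol_apply, Matrix.vandermonde_apply]
    split_ifs
    · exact hu _
    · exact (contDiff_apply ℝ ℝ _).pow _
  have hN0 : ∀ k : Fin n, ∀ p ∈ s, ∀ v : Fin n → ℝ, v p.1 = v p.2 →
      ((Matrix.vandermonde v).updateCol k fun i => u i v).det = 0 := by
    intro k p hp v hv
    refine Matrix.det_zero_of_row_eq (hsl p hp).ne ?_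
    funext l
    simp only [Matrix.updateCol_apply, Matrix.vandermonde_apply, hv, huij _ _ v hv]
  choose c₀ hc₀ hc₀e using fun k => exists_smooth_div_prod s hsl (hN k) (hN0 k)
  have hc₁ : ∀ i v, ∑ k, c₀ k v * v i ^ (k : ℕ) = u i v := by
    intro i v
    have hcont : Continuous fun v => ∑ k, c₀ k v * v i ^ (k : ℕ) - u i v :=
      (continuous_finsetSum _ fun k _ => (hc₀ k).continuous.mul
        ((continuous_apply i).pow _)).sub (hu i).continuous
    refine sub_eq_zero.1 (eq_zero_of_prod_mul_eq_zero s hsl hcont (fun v => ?_) v)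
    have h1 := congrFun (Matrix.mulVec_cramer (Matrix.vandermonde v) fun i => u i v) i
    rw [Pi.smul_apply, smul_eq_mul, det_vandermonde_eq_prod_filter, Matrix.mulVec, dotProduct] at h1
    rw [mul_sub, ← h1, Finset.mul_sum, sub_eq_zero]
    refine Finset.sum_congr rfl fun k _ => ?_
    rw [Matrix.cramer_apply, hc₀e k v, Matrix.vandermonde_apply]
    ring
  -- Averaging over permutations makes the coefficients symmetric and keeps the identity, as `u` and
  -- the power fields are both equivariant.
  refine ⟨fun k v => (Fintype.card (Equiv.Perm (Fin n)) : ℝ)⁻¹ *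
    ∑ σ : Equiv.Perm (Fin n), c₀ k (v ∘ σ), ?_, ?_, ?_⟩
  · intro k
    refine contDiff_const.mul (ContDiff.sum fun σ _ => (hc₀ k).comp ?_)
    exact contDiff_pi.2 fun i => contDiff_apply ℝ ℝ (σ i)
  · intro k τ v
    exact congrArg _ (Fintype.sum_equiv (Equiv.mulLeft τ) (fun σ => c₀ k ((v ∘ τ) ∘ σ))
      (fun σ => c₀ k (v ∘ σ)) fun σ => rfl)
  · intro v i
    have h1 : ∀ σ : Equiv.Perm (Fin n), ∑ k, c₀ k (v ∘ σ) * v i ^ (k : ℕ) = u i v := by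
      intro σ
      have := hc₁ (σ.symm i) (v ∘ σ)
      rw [hσ] at this
      simpa using this
    simp_rw [mul_assoc, Finset.sum_mul]
    rw [← Finset.mul_sum, Finset.sum_comm, Finset.sum_congr rfl fun σ _ => h1 σ]
    simp

end HessianEq

/-! ### Smoothness of symmetric functions of the eigenvalues -/

namespace HessianEq

open Matrix

variable {n : ℕ}

/-- The linear form `H ↦ tr (A H)`. -/
noncomputable def trMul (A : Matrix (Fin n) (Fin n) ℝ) : SymMat n →L[ℝ] ℝ :=
  LinearMap.toContinuousLinearMap
    (Matrix.traceLinearMap (Fin n) ℝ ℝ ∘ₗ LinearMap.mulLeft ℝ A ∘ₗ (SymMat n).subtype)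

theorem trMul_apply (A : Matrix (Fin n) (Fin n) ℝ) (H : SymMat n) :
    trMul A H = (A * (H : Matrix (Fin n) (Fin n) ℝ)).trace := rfl

-- The noncommutative product rule gives `m` terms `A^(m-1-i) H A^i`, and cyclicity of the trace
-- makes them equal.
open scoped RightActions in
attribute [local instance] Matrix.frobeniusNormedRing Matrix.frobeniusNormedAlgebra in
theorem hasFDerivAt_trace_pow (S : SymMat n) (m : ℕ) :
    HasFDerivAt (fun S : SymMat n => ((S : Matrix (Fin n) (Fin n) ℝ) ^ m).trace)
      ((m : ℝ) • trMul ((S : Matrix (Fin n) (Fin n) ℝ) ^ (m - 1))) S := by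
  have h1 := hasFDerivAt_pow' (𝕜 := ℝ) m (x := (S : Matrix (Fin n) (Fin n) ℝ))
  have h2 := (LinearMap.toContinuousLinearMap (Matrix.traceLinearMap (Fin n) ℝ ℝ)).hasFDerivAt.comp
    (S : Matrix (Fin n) (Fin n) ℝ) h1
  have h3 := h2.comp S (SymMat n).subtypeL.hasFDerivAt
  refine h3.congr_fderiv ?_
  ext H
  set A : Matrix (Fin n) (Fin n) ℝ := S.1
  set B : Matrix (Fin n) (Fin n) ℝ := H.1
  change Matrix.trace ((∑ i ∈ Finset.range m, A ^ (m.pred - i) •> ContinuousLinearMap.id ℝ _ <• A ^ i :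
    Matrix (Fin n) (Fin n) ℝ →L[ℝ] Matrix (Fin n) (Fin n) ℝ) B) = m * (A ^ (m - 1) * B).trace
  rw [_root_.sum_apply, Matrix.trace_sum, Finset.sum_congr rfl (g := fun _ => (A ^ (m - 1) * B).trace)]
  · simp
  · intro i hi
    change (A ^ (m.pred - i) * B * A ^ i).trace = _
    rw [Matrix.trace_mul_comm, ← Matrix.mul_assoc, ← pow_add]
    congr 3
    have := Finset.mem_range.1 hi
    rw [Nat.pred_eq_sub_one]
    omega

theorem contDiff_pow_entry (m : ℕ) (i j : Fin n) :
    ContDiff ℝ ∞ fun S : SymMat n => ((S : Matrix (Fin n) (Fin n) ℝ) ^ m) i j := by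
  induction m generalizing i j with
  | zero => simp only [pow_zero]; exact contDiff_const
  | succ m ih =>
    simp only [pow_succ, Matrix.mul_apply]
    refine ContDiff.sum fun k _ => (ih i k).mul ?_
    exact (LinearMap.toContinuousLinearMap
      (Matrix.entryLinearMap ℝ ℝ k j ∘ₗ (SymMat n).subtype)).contDiff

theorem contDiff_trMul_pow (m : ℕ) (H : SymMat n) :
    ContDiff ℝ ∞ fun S : SymMat n => trMul ((S : Matrix (Fin n) (Fin n) ℝ) ^ m) H := by
  simp only [trMul_apply, Matrix.trace, Matrix.diag_apply, Matrix.mul_apply]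
  exact ContDiff.sum fun i _ => ContDiff.sum fun j _ =>
    (contDiff_pow_entry m i j).mul contDiff_const

/-- The chain rule is unavailable because `ordEig` need not be differentiable. Instead, `f` is
compared with a combination `q` of power sums having the same gradient at `ordEig S`. There `f - q`
is stationary, so composing it with the Lipschitz map `ordEig` gives derivative zero, while `q ∘
ordEig` is a combination of traces of powers. -/
theorem hasFDerivAt_comp_ordEig {f : (Fin n → ℝ) → ℝ} (S : SymMat n)
    (hf : DifferentiableAt ℝ f (ordEig S)) (c : Fin n → ℝ)
    (hc : ∀ i, ∑ k, c k * ordEig S i ^ (k : ℕ) = fderiv ℝ f (ordEig S) (Pi.single i 1)) :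
    HasFDerivAt (fun S => f (ordEig S))
      (∑ k, c k • trMul ((S : Matrix (Fin n) (Fin n) ℝ) ^ (k : ℕ))) S := by
  set q : (Fin n → ℝ) → ℝ := fun v => ∑ k : Fin n, c k / ((k : ℕ) + 1 : ℝ) * ∑ i, v i ^ ((k : ℕ) + 1)
  have hq : HasFDerivAt q (fderiv ℝ f (ordEig S)) (ordEig S) := by
    have h1 : HasFDerivAt q (∑ k : Fin n, (c k / ((k : ℕ) + 1 : ℝ)) • ∑ i,
        (((k : ℕ) + 1 : ℕ) * ordEig S i ^ (k : ℕ)) •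
          (ContinuousLinearMap.proj i : (Fin n → ℝ) →L[ℝ] ℝ)) (ordEig S) := by
      refine HasFDerivAt.fun_sum fun k _ => HasFDerivAt.const_mul
        (HasFDerivAt.fun_sum fun i _ => ?_) _
      have := (hasFDerivAt_apply (𝕜 := ℝ) i (ordEig S)).pow (k + 1)
      simpa using this
    refine h1.congr_fderiv ?_
    refine ContinuousLinearMap.coe_injective (LinearMap.pi_ext' fun i => LinearMap.ext_ring ?_)
    simp only [LinearMap.comp_apply, LinearMap.single_apply, ContinuousLinearMap.coe_coe]
    rw [← hc i]
    simp only [_root_.sum_apply, _root_.smul_apply,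
      ContinuousLinearMap.proj_apply, smul_eq_mul]
    refine Finset.sum_congr rfl fun k _ => ?_
    rw [Finset.sum_eq_single i]
    · have : ((k : ℕ) + 1 : ℝ) ≠ 0 := by positivity
      simp
      field_simp
    · intro j _ hj
      simp [hj]
    · simp
  have hdiff : HasFDerivAt (fun v => f v - q v) (0 : (Fin n → ℝ) →L[ℝ] ℝ) (ordEig S) := by
    have := hf.hasFDerivAt.sub hq
    rw [sub_self] at this
    exact this
  have h1 : HasFDerivAt (fun T => f (ordEig T) - q (ordEig T)) (0 : SymMat n →L[ℝ] ℝ) S := by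
    refine HasFDerivAt.of_isLittleO ?_
    have h2 := hdiff.isLittleO.comp_tendsto (continuous_ordEig.tendsto S)
    have h3 : (fun T : SymMat n => ordEig T - ordEig S) =O[nhds S] fun T => T - S :=
      Asymptotics.IsBigO.of_bound 1 (Filter.Eventually.of_forall fun T => by
        rw [one_mul]; exact norm_ordEig_sub_le T S)
    have h4 := h2.trans_isBigO h3
    refine h4.congr' (Filter.Eventually.of_forall fun T => ?_) Filter.EventuallyEq.rfl
    change _ - (0 : ℝ) = _ - (0 : ℝ)
    rfl
  have h2 : HasFDerivAt (fun T : SymMat n => q (ordEig T))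
      (∑ k, c k • trMul ((S : Matrix (Fin n) (Fin n) ℝ) ^ (k : ℕ))) S := by
    have heq : (fun T : SymMat n => q (ordEig T)) = fun T : SymMat n => ∑ k : Fin n,
        c k / ((k : ℕ) + 1 : ℝ) * ((T : Matrix (Fin n) (Fin n) ℝ) ^ ((k : ℕ) + 1)).trace := by
      funext T
      simp only [q, trace_pow_eq_sum]
    rw [heq]
    have := HasFDerivAt.fun_sum (u := Finset.univ) fun (k : Fin n) _ =>
      (hasFDerivAt_trace_pow S ((k : ℕ) + 1)).const_mul (c k / ((k : ℕ) + 1 : ℝ))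
    refine this.congr_fderiv (Finset.sum_congr rfl fun k _ => ?_)
    ext H
    have : ((k : ℕ) + 1 : ℝ) ≠ 0 := by positivity
    change c k / ((k : ℕ) + 1 : ℝ) * ((((k : ℕ) + 1 : ℕ) : ℝ) *
      trMul ((S : Matrix (Fin n) (Fin n) ℝ) ^ (k : ℕ)) H) = c k * trMul _ H
    push_cast
    field_simp
  have h3 := h1.add h2
  refine (h3.congr_fderiv (by ext H; exact zero_add _)).congr_of_eventuallyEq (Filter.Eventually.of_forall fun T => (sub_add_cancel _ _).symm)

/-- A smooth symmetric function of the eigenvalues is a smooth function of the matrix. -/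
theorem contDiff_comp_ordEig {f : (Fin n → ℝ) → ℝ} (hf : ContDiff ℝ ∞ f)
    (hσ : ∀ (σ : Equiv.Perm (Fin n)) v, f (v ∘ σ) = f v) :
    ContDiff ℝ ∞ fun S : SymMat n => f (ordEig S) := by
  rw [contDiff_infty]
  intro m
  induction m generalizing f with
  | zero =>
    rw [Nat.cast_zero, contDiff_zero]
    exact hf.continuous.comp continuous_ordEig
  | succ m ih =>
    have hf1 : ContDiff ℝ ∞ (fderiv ℝ f) := (contDiff_infty_iff_fderiv.1 hf).2
    -- Symmetry of `f` makes its gradient equivariant. The coefficients obtained are again smooth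
    -- and symmetric, which is what lets the induction on `m` apply to them.
    obtain ⟨c, hc, hcσ, hce⟩ := exists_smooth_symm_coeff
      (fun i v => fderiv ℝ f v (Pi.single i 1)) (fun i => hf1.clm_apply contDiff_const) (by
        intro σ i v
        set T : (Fin n → ℝ) ≃L[ℝ] (Fin n → ℝ) :=
          (LinearEquiv.funCongrLeft ℝ ℝ σ).toContinuousLinearEquiv
        have h1 : f ∘ T = f := funext fun v => hσ σ v
        have h2 := T.comp_right_fderiv (f := f) (x := v)
        rw [h1] at h2
        have h3 := congrArg (fun L => L (Pi.single (σ i) 1)) h2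
        have h4 : T (Pi.single (σ i) 1) = Pi.single i 1 := by
          funext j
          change (Pi.single (σ i) (1 : ℝ) : Fin n → ℝ) (σ j) = _
          simp [Pi.single_apply]
        rw [h3, ContinuousLinearMap.comp_apply, ContinuousLinearEquiv.coe_coe, h4]
        rfl)
    have hder : ∀ S : SymMat n, HasFDerivAt (fun S => f (ordEig S))
        (∑ k, c k (ordEig S) • trMul ((S : Matrix (Fin n) (Fin n) ℝ) ^ (k : ℕ))) S := fun S =>
      hasFDerivAt_comp_ordEig S (hf.differentiable (by simp) _) _ fun i => hce _ i
    push_cast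
    rw [contDiff_succ_iff_fderiv_apply]
    refine ⟨fun S => (hder S).differentiableAt, by simp, fun H => ?_⟩
    have heq : (fun S => fderiv ℝ (fun S : SymMat n => f (ordEig S)) S H) = fun S => ∑ k,
        c k (ordEig S) * trMul ((S : Matrix (Fin n) (Fin n) ℝ) ^ (k : ℕ)) H := by
      funext S
      rw [(hder S).fderiv]
      simp
    have hsum : ContDiff ℝ m fun S : SymMat n => ∑ k,
        c k (ordEig S) * trMul ((S : Matrix (Fin n) (Fin n) ℝ) ^ (k : ℕ)) H :=
      ContDiff.sum fun k _ => (ih (hc k) (hcσ k)).mul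
        ((contDiff_trMul_pow k H).of_le (by exact_mod_cast le_top))
    rw [← heq] at hsum
    exact hsum

end HessianEq

/-! ### Pucci functions, elliptic extension, mollification and cutoffs -/

namespace HessianEq

open MeasureTheory

variable {n : ℕ}

/-- The Pucci-type function `v ↦ ∑ min (a vᵢ) (b vᵢ)`. -/
noncomputable def pucci (a b : ℝ) (v : Fin n → ℝ) : ℝ := ∑ i, min (a * v i) (b * v i)

theorem pucci_add_le {a b : ℝ} (u v : Fin n → ℝ) :
    pucci a b u + pucci a b v ≤ pucci a b (u + v) := by
  rw [pucci, pucci, pucci, ← Finset.sum_add_distrib]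
  refine Finset.sum_le_sum fun i _ => le_min ?_ ?_
  · rw [Pi.add_apply, mul_add]; exact add_le_add (min_le_left _ _) (min_le_left _ _)
  · rw [Pi.add_apply, mul_add]; exact add_le_add (min_le_right _ _) (min_le_right _ _)

theorem abs_pucci_le {a b : ℝ} (ha : 0 ≤ a) (hab : a ≤ b) (v : Fin n → ℝ) :
    |pucci a b v| ≤ n * b * ‖v‖ := by
  refine (Finset.abs_sum_le_sum_abs _ _).trans ?_
  have : ∀ i ∈ Finset.univ, |min (a * v i) (b * v i)| ≤ b * ‖v‖ := by
    intro i _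
    have h1 : |v i| ≤ ‖v‖ := norm_le_pi_norm v i
    have h2 : |a * v i| ≤ b * ‖v‖ := by
      rw [abs_mul, abs_of_nonneg ha]
      exact mul_le_mul hab h1 (abs_nonneg _) (ha.trans hab)
    have h3 : |b * v i| ≤ b * ‖v‖ := by
      rw [abs_mul, abs_of_nonneg (ha.trans hab)]
      exact mul_le_mul_of_nonneg_left h1 (ha.trans hab)
    rcases min_choice (a * v i) (b * v i) with h | h <;> rw [h] <;> assumption
  refine (Finset.sum_le_card_nsmul _ _ _ this).trans_eq ?_
  simp [mul_assoc]

theorem pucci_le_sum {a b : ℝ} {l v : Fin n → ℝ} (hl : ∀ i, a ≤ l i ∧ l i ≤ b) :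
    pucci a b v ≤ ∑ i, l i * v i := by
  refine Finset.sum_le_sum fun i _ => ?_
  rcases le_total 0 (v i) with h | h
  · exact (min_le_left _ _).trans (mul_le_mul_of_nonneg_right (hl i).1 h)
  · exact (min_le_right _ _).trans (mul_le_mul_of_nonpos_right (hl i).2 h)

theorem pucci_single {a b : ℝ} (hab : a ≤ b) (i : Fin n) {t : ℝ} (ht : 0 ≤ t) :
    pucci a b (t • Pi.single i 1) = t * a := by
  rw [pucci, Finset.sum_eq_single i]
  · simp only [Pi.smul_apply, Pi.single_eq_same, smul_eq_mul, mul_one]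
    rw [min_eq_left (mul_le_mul_of_nonneg_right hab ht), mul_comm]
  · intro j _ hj
    simp [hj]
  · simp

theorem pucci_neg_single {a b : ℝ} (hab : a ≤ b) (i : Fin n) {t : ℝ} (ht : 0 ≤ t) :
    pucci a b (t • -Pi.single i 1) = t * -b := by
  rw [pucci, Finset.sum_eq_single i]
  · simp only [Pi.smul_apply, Pi.neg_apply, Pi.single_eq_same, smul_eq_mul]
    rw [min_eq_right (mul_le_mul_of_nonpos_right hab (by linarith))]
    ring
  · intro j _ hj
    simp [hj]
  · simp

/-- Vectors that are zero or have comparable positive and negative parts are strictly negative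
for the Pucci function with large ratio. -/
theorem pucci_le_neg_norm {a b C : ℝ} (ha : 0 ≤ a) (hC : 0 < C) (hb : C * (n * a + 1 + C) ≤ b)
    {z : Fin n → ℝ} (hz : z = 0 ∨ (1 / C ≤ -((⨅ i, z i) / ⨆ i, z i) ∧ -((⨅ i, z i) / ⨆ i, z i) ≤ C)) :
    pucci a b z ≤ -‖z‖ := by
  rcases hz with rfl | ⟨h1, h2⟩
  · simp [pucci]
  set m := ⨅ i, z i with hm
  set X := ⨆ i, z i with hX
  -- Division by zero gives zero in Lean, so the lower bound `1 / C` already excludes a vanishing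
  -- supremum; below, it also excludes a negative one.
  have hX0 : X ≠ 0 := by
    intro h
    rw [h, div_zero, neg_zero] at h1
    have : 0 < 1 / C := by positivity
    linarith
  have hne : Nonempty (Fin n) := by
    by_contra hne
    rw [not_nonempty_iff] at hne
    exact hX0 (Real.iSup_of_isEmpty _)
  have hbdd : BddBelow (Set.range z) := (Set.finite_range z).bddBelow
  have hbdd' : BddAbove (Set.range z) := (Set.finite_range z).bddAbove
  have hle : ∀ i, z i ≤ X := fun i => le_ciSup hbdd' i
  have hge : ∀ i, m ≤ z i := fun i => ciInf_le hbdd i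
  obtain ⟨i₀, hi₀⟩ := exists_eq_ciInf_of_finite (f := z)
  have hXpos : 0 < X := by
    by_contra hX'
    have hXn : X < 0 := lt_of_le_of_ne (not_lt.1 hX') hX0
    have : 0 ≤ m / X := div_nonneg_of_nonpos ((hge i₀).trans ((hle i₀).trans hXn.le)) hXn.le
    have : 0 < 1 / C := by positivity
    linarith
  have hm1 : m ≤ -(X / C) := by
    have : 1 / C * X ≤ -(m / X) * X := mul_le_mul_of_nonneg_right h1 hXpos.le
    rw [neg_mul, div_mul_cancel₀ _ hX0] at this
    have e : 1 / C * X = X / C := by ring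
    linarith
  have hm2 : -m ≤ C * X := by
    have : -(m / X) * X ≤ C * X := mul_le_mul_of_nonneg_right h2 hXpos.le
    rwa [neg_mul, div_mul_cancel₀ _ hX0] at this
  have hnorm : ‖z‖ ≤ (1 + C) * X := by
    refine (pi_norm_le_iff_of_nonneg (by positivity)).2 fun i => ?_
    rw [Real.norm_eq_abs, abs_le]
    constructor <;> nlinarith [hle i, hge i]
  have hb0 : 0 ≤ b := le_trans (by positivity) hb
  have hsum : pucci a b z ≤ b * m + n * (a * X) := by
    rw [pucci, ← Finset.add_sum_erase _ _ (Finset.mem_univ i₀)]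
    refine add_le_add ?_ ?_
    · rw [hm, ← hi₀]; exact min_le_right _ _
    · have h3 := Finset.sum_le_card_nsmul (Finset.univ.erase i₀)
        (fun i => min (a * z i) (b * z i)) (a * X) fun i _ =>
          (min_le_left _ _).trans (mul_le_mul_of_nonneg_left (hle i) ha)
      refine h3.trans ?_
      rw [nsmul_eq_mul]
      refine mul_le_mul_of_nonneg_right ?_ (mul_nonneg ha hXpos.le)
      have := Finset.card_le_univ (Finset.univ.erase i₀)
      rw [Fintype.card_fin] at this
      exact_mod_cast this
  -- The part `n * a * X` pays for the other coordinates, and what is left, `(1 + C) * X`, dominates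
  -- `‖z‖`.
  have h4 : b * m ≤ -((n * a + 1 + C) * X) := by
    have h5 : b * m ≤ b * -(X / C) := mul_le_mul_of_nonneg_left hm1 hb0
    have h6 : C * (n * a + 1 + C) * (X / C) ≤ b * (X / C) :=
      mul_le_mul_of_nonneg_right hb (by positivity)
    have h7 : C * (n * a + 1 + C) * (X / C) = (n * a + 1 + C) * X := by field_simp
    linarith
  nlinarith

/-- Extension from a set to the whole space of functions that are elliptic with respect to a
superadditive function. -/
theorem exists_extension {s : Set (Fin n → ℝ)} (hs : s.Nonempty) {p G : (Fin n → ℝ) → ℝ}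
    (hp : ∀ u v, p u + p v ≤ p (u + v)) (hp0 : p 0 = 0)
    (hG : ∀ x ∈ s, ∀ y ∈ s, G y + p (x - y) ≤ G x) :
    ∃ f : (Fin n → ℝ) → ℝ, (∀ x ∈ s, f x = G x) ∧ ∀ v x, p v ≤ f (x + v) - f x := by
  obtain ⟨x₀, hx₀⟩ := hs
  have : Nonempty s := ⟨⟨x₀, hx₀⟩⟩
  have hbdd : ∀ x, BddAbove (Set.range fun y : s => G y + p (x - y)) := by
    intro x
    refine ⟨G x₀ - p (x₀ - x), ?_⟩
    rintro _ ⟨y, rfl⟩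
    have h1 := hG x₀ hx₀ y y.2
    have h2 := hp (x₀ - x) (x - y)
    rw [sub_add_sub_cancel] at h2
    change G y + p (x - y) ≤ _
    linarith
  -- The McShane-type extension with `p` in place of a multiple of the norm; superadditivity passes
  -- the lower bound on increments to the supremum.
  refine ⟨fun x => ⨆ y : s, G y + p (x - y), fun x hx => ?_, fun v x => ?_⟩
  · refine le_antisymm (ciSup_le fun y => hG x hx y y.2) ?_
    have := le_ciSup (hbdd x) ⟨x, hx⟩
    simpa [hp0] using this
  · rw [le_sub_iff_add_le']
    change (⨆ y : s, G y + p (x - y)) + p v ≤ _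
    rw [← le_sub_iff_add_le]
    refine ciSup_le fun y => ?_
    have h1 := le_ciSup (hbdd (x + v)) y
    have h2 := hp (x - y) v
    have h3 : x - (y : Fin n → ℝ) + v = x + v - y := by abel
    rw [h3] at h2
    linarith

/-- Mollification of a Lipschitz function preserves lower bounds on increments. -/
theorem exists_mollification {f : (Fin n → ℝ) → ℝ} {L ε : ℝ} (hL : 0 ≤ L) (hε : 0 < ε)
    (hf : ∀ x y, |f x - f y| ≤ L * ‖x - y‖) :
    ∃ g : (Fin n → ℝ) → ℝ, ContDiff ℝ ∞ g ∧ (∀ x, |g x - f x| ≤ L * ε) ∧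
      ∀ v q, (∀ x, q ≤ f (x + v) - f x) → ∀ x, q ≤ g (x + v) - g x := by
  let φ : ContDiffBump (0 : Fin n → ℝ) := ⟨ε / 2, ε, by positivity, by linarith⟩
  have hcont : Continuous f := by
    refine (LipschitzWith.of_dist_le_mul (K := ⟨L, hL⟩) fun x y => ?_).continuous
    rw [dist_eq_norm, dist_eq_norm]
    exact hf x y
  refine ⟨convolution (φ.normed volume) f (ContinuousLinearMap.lsmul ℝ ℝ) volume,
    φ.hasCompactSupport_normed.contDiff_convolution_left _ φ.contDiff_normed
      hcont.locallyIntegrable, fun x => ?_, fun v q hq x => ?_⟩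
  · rw [← Real.dist_eq]
    refine φ.dist_normed_convolution_le hcont.aestronglyMeasurable fun y hy => ?_
    rw [Real.dist_eq]
    refine (hf y x).trans (mul_le_mul_of_nonneg_left ?_ hL)
    rw [← dist_eq_norm]
    exact (Metric.mem_ball.1 hy).le
  · have hint : ∀ x, Integrable (fun t => φ.normed volume t * f (x - t)) volume := fun x =>
      (φ.continuous_normed.mul (hcont.comp (continuous_const.sub continuous_id))).integrable_of_hasCompactSupport
        φ.hasCompactSupport_normed.mul_right
    have h1 : ∀ x, convolution (φ.normed volume) f (ContinuousLinearMap.lsmul ℝ ℝ) volume x =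
        ∫ t, φ.normed volume t * f (x - t) := fun x => rfl
    rw [h1, h1, ← integral_sub (hint _) (hint _)]
    have h2 : q = ∫ t, φ.normed volume t * q := by
      rw [integral_mul_const, φ.integral_normed, one_mul]
    rw [h2]
    refine integral_mono ((φ.continuous_normed.integrable_of_hasCompactSupport
      φ.hasCompactSupport_normed).mul_const q) ((hint _).sub (hint _)) fun t => ?_
    change φ.normed volume t * q ≤ φ.normed volume t * f (x + v - t) - φ.normed volume t * f (x - t)
    rw [← mul_sub]
    refine mul_le_mul_of_nonneg_left ?_ (φ.nonneg_normed t)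
    have := hq (x - t)
    rwa [show x - t + v = x + v - t by abel] at this

theorem le_fderiv_of_le_increment {f : (Fin n → ℝ) → ℝ} {x v : Fin n → ℝ} {q : ℝ}
    (hf : DifferentiableAt ℝ f x) (h : ∀ t : ℝ, 0 ≤ t → t * q ≤ f (x + t • v) - f x) :
    q ≤ fderiv ℝ f x v := by
  have h1 : HasDerivAt (fun t : ℝ => f (x + t • v)) (fderiv ℝ f x v) 0 :=
    hf.hasFDerivAt.hasLineDerivAt v
  have h2 := h1.tendsto_slope_zero_right
  refine ge_of_tendsto h2 ?_
  filter_upwards [self_mem_nhdsWithin] with t ht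
  have ht' : (0 : ℝ) < t := ht
  simp only [zero_add, zero_smul, add_zero, smul_eq_mul]
  rw [le_inv_mul_iff₀ ht']
  exact h t ht'.le

theorem fderiv_eq_sum (L : (Fin n → ℝ) →L[ℝ] ℝ) (v : Fin n → ℝ) :
    L v = ∑ i, L (Pi.single i 1) * v i := by
  conv_lhs => rw [← Finset.univ_sum_single v, map_sum]
  refine Finset.sum_congr rfl fun i _ => ?_
  have : Pi.single i (v i) = v i • (Pi.single i 1 : Fin n → ℝ) := by
    rw [← Pi.single_smul, smul_eq_mul, mul_one]
  rw [this, map_smul, smul_eq_mul, mul_comm]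

theorem exists_smoothTransition_deriv_bound :
    ∃ B : ℝ, 0 ≤ B ∧ ∀ t, |deriv Real.smoothTransition t| ≤ B := by
  have hc : Continuous (deriv Real.smoothTransition) :=
    (Real.smoothTransition.contDiff (n := 1)).continuous_deriv le_rfl
  obtain ⟨B, hB⟩ := (isCompact_Icc (a := (0 : ℝ)) (b := 1)).exists_bound_of_continuousOn hc.continuousOn
  refine ⟨max B 0, le_max_right _ _, fun t => ?_⟩
  by_cases ht : t ∈ Set.Icc (0 : ℝ) 1
  · exact (hB t ht).trans (le_max_left _ _)
  · rw [Set.mem_Icc, not_and_or, not_le, not_le] at ht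
    have : deriv Real.smoothTransition t = 0 := by
      rcases ht with ht | ht
      · have : Real.smoothTransition =ᶠ[nhds t] fun _ => 0 := by
          filter_upwards [Iio_mem_nhds ht] with y hy
          exact Real.smoothTransition.zero_of_nonpos (le_of_lt hy)
        rw [this.deriv_eq, deriv_const]
      · have : Real.smoothTransition =ᶠ[nhds t] fun _ => 1 := by
          filter_upwards [Ioi_mem_nhds ht] with y hy
          exact Real.smoothTransition.one_of_one_le (le_of_lt hy)
        rw [this.deriv_eq, deriv_const]
    rw [this, abs_zero]
    exact le_max_right _ _

/-- A smooth cutoff function around a set, with bounded gradient. -/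
theorem exists_cutoff {M : Set (Fin n → ℝ)} {r : ℝ} (hr : 0 < r) :
    ∃ χ : (Fin n → ℝ) → ℝ, ContDiff ℝ ∞ χ ∧ (∀ x, 0 ≤ χ x ∧ χ x ≤ 1) ∧ (∀ x ∈ M, χ x = 1) ∧
      (∀ x, r ≤ Metric.infDist x M → χ x = 0 ∧ fderiv ℝ χ x = 0) ∧
      ∃ B : ℝ, 0 ≤ B ∧ ∀ x i, |fderiv ℝ χ x (Pi.single i 1)| ≤ B := by
  have hLip : ∀ x y, |Metric.infDist x M - Metric.infDist y M| ≤ 1 * ‖x - y‖ := by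
    intro x y
    have := (Metric.lipschitz_infDist_pt M).dist_le_mul x y
    rwa [Real.dist_eq, dist_eq_norm] at this
  obtain ⟨d, hd, hdd, hdi⟩ := exists_mollification (ε := r / 4) zero_le_one (by positivity) hLip
  have hd1 : ∀ x i, |fderiv ℝ d x (Pi.single i 1)| ≤ 1 := by
    intro x i
    have key : ∀ v : Fin n → ℝ, ‖v‖ = 1 → -1 ≤ fderiv ℝ d x v := by
      intro v hv
      refine le_fderiv_of_le_increment (hd.differentiable (by simp) x) fun t ht => ?_
      refine hdi (t • v) _ (fun y => ?_) x
      have := (abs_le.1 (hLip (y + t • v) y)).1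
      rw [add_sub_cancel_left, norm_smul, hv, Real.norm_of_nonneg ht] at this
      linarith
    have hn : ‖(Pi.single i 1 : Fin n → ℝ)‖ = 1 := by
      rw [Pi.norm_single, norm_one]
    have h1 := key _ hn
    have h2 := key (-Pi.single i 1) (by rw [norm_neg, hn])
    rw [map_neg] at h2
    exact abs_le.2 ⟨h1, by linarith⟩
  obtain ⟨B, hB0, hB⟩ := exists_smoothTransition_deriv_bound
  -- With `d` within `r / 4` of the distance to `M`, this is at least `1` on `M` and at most `0` at
  -- distance `3r/4` or more. Vanishing thus holds near every point at distance `r`, and so does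
  -- vanishing of the gradient.
  set a : (Fin n → ℝ) → ℝ := fun x => 2 - 4 / r * d x with ha
  have has : ContDiff ℝ ∞ a := contDiff_const.sub (contDiff_const.mul hd)
  refine ⟨fun x => Real.smoothTransition (a x), Real.smoothTransition.contDiff.comp has,
    fun x => ⟨Real.smoothTransition.nonneg _, Real.smoothTransition.le_one _⟩, fun x hx => ?_,
    fun x hx => ?_, B * (4 / r), by positivity, fun x i => ?_⟩
  · refine Real.smoothTransition.one_of_one_le ?_
    have h1 := (abs_le.1 (hdd x)).2
    rw [Metric.infDist_zero_of_mem hx] at h1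
    have : 4 / r * d x ≤ 4 / r * (r / 4) := mul_le_mul_of_nonneg_left (by linarith) (by positivity)
    have e : 4 / r * (r / 4) = 1 := by field_simp
    simp only [ha]
    linarith
  · have hev : (fun x => Real.smoothTransition (a x)) =ᶠ[nhds x] fun _ => 0 := by
      have : ∀ᶠ y in nhds x, 3 * r / 4 < Metric.infDist y M :=
        (Metric.continuous_infDist_pt M).continuousAt.eventually_const_lt (by linarith)
      filter_upwards [this] with y hy
      refine Real.smoothTransition.zero_of_nonpos ?_
      have h1 := (abs_le.1 (hdd y)).1
      have : 4 / r * (r / 2) ≤ 4 / r * d y := mul_le_mul_of_nonneg_left (by linarith) (by positivity)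
      have e : 4 / r * (r / 2) = 2 := by field_simp; norm_num
      simp only [ha]
      linarith
    exact ⟨hev.eq_of_nhds, by rw [hev.fderiv_eq, fderiv_const_apply]⟩
  · have hda : HasFDerivAt a (-((4 / r) • fderiv ℝ d x)) x :=
      ((hd.differentiable (by simp) x).hasFDerivAt.const_mul (4 / r)).const_sub 2
    have h1 : HasFDerivAt (fun x => Real.smoothTransition (a x))
        (deriv Real.smoothTransition (a x) • -((4 / r) • fderiv ℝ d x)) x :=
      ((Real.smoothTransition.contDiff (n := 1)).differentiable one_ne_zero
        (a x)).hasDerivAt.comp_hasFDerivAt x hda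
    rw [h1.fderiv]
    simp only [_root_.smul_apply, _root_.neg_apply, smul_eq_mul, abs_mul, abs_neg]
    refine mul_le_mul (hB _) ?_ (by positivity) hB0
    rw [abs_of_pos (by positivity : 0 < 4 / r)]
    exact mul_le_of_le_one_right (by positivity) (hd1 x i)

end HessianEq

/-! ### From a defining function of `M` to a uniformly elliptic operator -/

namespace HessianEq

variable {n : ℕ}

/-- The difference of two distinct points has positive and negative parts of comparable size. -/
def HypDiff (C : ℝ) (M : Set (Fin n → ℝ)) : Prop :=
  ∀ u ∈ M, ∀ v ∈ M, u - v = 0 ∨ (1 / C ≤ -((⨅ i, (u - v) i) / ⨆ i, (u - v) i) ∧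
    -((⨅ i, (u - v) i) / ⨆ i, (u - v) i) ≤ C)

theorem exists_fderiv_eq_sub {G : (Fin n → ℝ) → ℝ} (hG : Differentiable ℝ G) (x y : Fin n → ℝ) :
    ∃ z ∈ segment ℝ y x, G x - G y = fderiv ℝ G z (x - y) :=
  domain_mvt (f' := fderiv ℝ G) (fun z _ => (hG z).hasFDerivAt.hasFDerivWithinAt)
    convex_univ (Set.mem_univ y) (Set.mem_univ x)

/-- A smooth function vanishing on `M` with positive derivatives there gives a smooth function
vanishing on `M` whose derivatives are bounded between positive constants everywhere. -/
theorem exists_global_function {M : Set (Fin n → ℝ)} (hM : M.Nonempty) {C : ℝ} (hC : 0 < C)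
    (hyp : HypDiff C M) {G : (Fin n → ℝ) → ℝ} (hG : ContDiff ℝ ∞ G)
    (hu : ∀ ε > 0, ∃ η > 0, ∀ x y : Fin n → ℝ, ‖x - y‖ < η → ∀ i,
      |fderiv ℝ G x (Pi.single i 1) - fderiv ℝ G y (Pi.single i 1)| ≤ ε)
    {K : ℝ} (hK : ∀ x i, |fderiv ℝ G x (Pi.single i 1)| ≤ K)
    (hG0 : ∀ v ∈ M, G v = 0) {c : ℝ} (hc : 0 < c)
    (hGc : ∀ v ∈ M, ∀ i, c ≤ fderiv ℝ G v (Pi.single i 1)) :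
    ∃ f : (Fin n → ℝ) → ℝ, ContDiff ℝ ∞ f ∧ (∀ v ∈ M, f v = 0) ∧
      ∃ a b : ℝ, 0 < a ∧ ∀ x i, a ≤ fderiv ℝ f x (Pi.single i 1) ∧
        fderiv ℝ f x (Pi.single i 1) ≤ b := by
  have hGd : Differentiable ℝ G := hG.differentiable (by simp)
  set a := c / 2 with ha
  have ha0 : 0 < a := by positivity
  -- Large enough for strict negativity of the Pucci function on differences of points of `M`, and
  -- an upper bound for the partial derivatives of `G`.
  set b := max (max (C * (n * a + 1 + C)) (max K 0)) a with hb
  have hab : a ≤ b := le_max_right _ _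
  have hb1 : C * (n * a + 1 + C) ≤ b := (le_max_left _ _).trans (le_max_left _ _)
  have hKb : max K 0 ≤ b := (le_max_right _ _).trans (le_max_left _ _)
  have hb0 : 0 < b := ha0.trans_le hab
  obtain ⟨η, hη, hηu⟩ := hu a ha0
  have hGlip : ∀ x y, |G x - G y| ≤ n * b * ‖x - y‖ := by
    intro x y
    obtain ⟨z, -, hz⟩ := exists_fderiv_eq_sub hGd x y
    rw [hz, fderiv_eq_sum]
    refine (Finset.abs_sum_le_sum_abs _ _).trans ((Finset.sum_le_card_nsmul _ _ (b * ‖x - y‖)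
      fun i _ => ?_).trans_eq ?_)
    · rw [abs_mul]
      exact mul_le_mul ((hK z i).trans ((le_max_left _ _).trans hKb)) (norm_le_pi_norm (x - y) i)
        (abs_nonneg _) hb0.le
    · simp [mul_assoc]
  -- Replacing two points by points of `M` within `r` costs at most `2r + 4nbr` in the far case
  -- below, and `r` makes this equal to `η / 2`.
  set r := η / (4 * (1 + 2 * (n * b))) with hr
  have hr0 : 0 < r := by positivity
  have hrη : r * (4 * (1 + 2 * (n * b))) = η := by rw [hr]; field_simp
  have hnb : 0 ≤ n * b := by positivity
  have hr4 : 4 * r ≤ η := by nlinarith [mul_nonneg hr0.le hnb]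
  set s := {x : Fin n → ℝ | Metric.infDist x M < r} with hs
  have hsM : ∀ x ∈ s, ∃ x' ∈ M, ‖x - x'‖ < r := by
    intro x hx
    obtain ⟨y, hy, hxy⟩ := (Metric.infDist_lt_iff hM).1 hx
    exact ⟨y, hy, by rwa [← dist_eq_norm]⟩
  have hnear : ∀ x, ∀ x' ∈ M, ‖x - x'‖ < η → ∀ i, a ≤ fderiv ℝ G x (Pi.single i 1) ∧
      fderiv ℝ G x (Pi.single i 1) ≤ b := by
    intro x x' hx' hxx i
    refine ⟨?_, (le_abs_self _).trans ((hK x i).trans ((le_max_left _ _).trans hKb))⟩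
    have h1 := (abs_le.1 (hηu x x' hxx i)).1
    have h2 := hGc x' hx' i
    linarith
  -- Close points: the segment stays within `η` of `M`, where the partial derivatives of `G` lie in
  -- `[a, b]`, and the mean value theorem applies. Distant points: both values of `G` are nearly
  -- zero, and the Pucci term is negative by the hypothesis on differences.
  have hGs : ∀ x ∈ s, ∀ y ∈ s, G y + pucci a b (x - y) ≤ G x := by
    intro x hx y hy
    obtain ⟨x', hx', hxx⟩ := hsM x hx
    obtain ⟨y', hy', hyy⟩ := hsM y hy
    rcases lt_or_ge ‖x - y‖ (η / 2) with hxy | hxy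
    · obtain ⟨z, hz, hze⟩ := exists_fderiv_eq_sub hGd x y
      have hzx : ‖z - x'‖ < η := by
        have h1 : ‖z - x‖ ≤ ‖x - y‖ := by
          rw [← dist_eq_norm, ← dist_eq_norm]
          have := dist_add_dist_of_mem_segment hz
          have h2 := dist_nonneg (x := y) (y := z)
          rw [dist_comm y x] at this
          linarith
        calc ‖z - x'‖ = ‖(z - x) + (x - x')‖ := by rw [sub_add_sub_cancel]
          _ ≤ ‖z - x‖ + ‖x - x'‖ := norm_add_le _ _
          _ < η := by linarith
      have h1 : pucci a b (x - y) ≤ G x - G y := by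
        rw [hze, fderiv_eq_sum]
        exact pucci_le_sum fun i => hnear z x' hx' hzx i
      linarith
    · have h1 := hGlip x x'
      have h2 := hGlip y y'
      rw [hG0 x' hx'] at h1
      rw [hG0 y' hy'] at h2
      have h3 := pucci_le_neg_norm ha0.le hC hb1 (hyp x' hx' y' hy')
      have h4 : ‖(x' - y') - (x - y)‖ ≤ 2 * r := by
        calc ‖(x' - y') - (x - y)‖ = ‖(y - y') - (x - x')‖ := by congr 1; abel
          _ ≤ ‖y - y'‖ + ‖x - x'‖ := norm_sub_le _ _
          _ ≤ 2 * r := by linarith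
      have h5 := abs_pucci_le ha0.le hab ((x' - y') - (x - y))
      have h6 := pucci_add_le (a := a) (b := b) (x - y) ((x' - y') - (x - y))
      rw [add_sub_cancel] at h6
      have h7 : ‖x - y‖ ≤ ‖x' - y'‖ + 2 * r := by
        have := norm_sub_norm_le (x - y) (x' - y')
        rw [norm_sub_rev (x - y) (x' - y')] at this
        linarith
      have h8 : n * b * ‖(x' - y') - (x - y)‖ ≤ n * b * (2 * r) :=
        mul_le_mul_of_nonneg_left h4 hnb
      have h9 : n * b * ‖x - x'‖ ≤ n * b * r := mul_le_mul_of_nonneg_left hxx.le hnb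
      have h10 : n * b * ‖y - y'‖ ≤ n * b * r := mul_le_mul_of_nonneg_left hyy.le hnb
      have h11 := (abs_le.1 h1).1
      have h12 := (abs_le.1 h2).2
      have h13 := (abs_le.1 h5).1
      nlinarith
  have hsne : s.Nonempty := by
    obtain ⟨x, hx⟩ := hM
    exact ⟨x, by change Metric.infDist x M < r; rwa [Metric.infDist_zero_of_mem hx]⟩
  -- The extension starts from the neighbourhood `s`, not from `M`, so that the mollified function
  -- stays close to `G` wherever the cutoff varies.
  obtain ⟨f₁, hf₁s, hf₁⟩ := exists_extension hsne (pucci_add_le (a := a) (b := b))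
    (by simp [pucci]) hGs
  have hf₁lip : ∀ x y, |f₁ x - f₁ y| ≤ n * b * ‖x - y‖ := by
    intro x y
    have h1 := hf₁ (x - y) y
    have h2 := hf₁ (y - x) x
    rw [add_sub_cancel] at h1 h2
    have h3 := (abs_le.1 (abs_pucci_le ha0.le hab (x - y))).1
    have h4 := (abs_le.1 (abs_pucci_le ha0.le hab (y - x))).1
    rw [norm_sub_rev y x] at h4
    exact abs_le.2 ⟨by linarith, by linarith⟩
  obtain ⟨χ, hχ, hχ01, hχM, hχr, B, hB0, hB⟩ := exists_cutoff (M := M) hr0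
  -- Keeps the gluing error, the cutoff gradient times `|G - f₂|`, below `a / 2`.
  set ε := a / (2 * (B * (n * b) + 1)) with hε
  have hBnb : 0 ≤ B * (n * b) := mul_nonneg hB0 hnb
  have hε0 : 0 < ε := by positivity
  have hεB : B * (n * b * ε) ≤ a / 2 := by
    have : ε * (2 * (B * (n * b) + 1)) = a := by rw [hε]; field_simp
    nlinarith
  obtain ⟨f₂, hf₂, hf₂d, hf₂i⟩ := exists_mollification hnb hε0 hf₁lip
  have hf₂' : ∀ x i, a ≤ fderiv ℝ f₂ x (Pi.single i 1) ∧ fderiv ℝ f₂ x (Pi.single i 1) ≤ b := by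
    intro x i
    constructor
    · refine le_fderiv_of_le_increment (hf₂.differentiable (by simp) x) fun t ht => ?_
      refine hf₂i _ _ (fun y => ?_) x
      rw [← pucci_single hab i ht]
      exact hf₁ _ _
    · have : -b ≤ fderiv ℝ f₂ x (-Pi.single i 1) := by
        refine le_fderiv_of_le_increment (hf₂.differentiable (by simp) x) fun t ht => ?_
        refine hf₂i _ _ (fun y => ?_) x
        rw [← pucci_neg_single hab i ht]
        exact hf₁ _ _
      rw [map_neg] at this
      linarith
  refine ⟨fun x => f₂ x + χ x * (G x - f₂ x), hf₂.add (hχ.mul (hG.sub hf₂)), fun v hv => ?_,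
    a / 2, b + a / 2, by positivity, fun x i => ?_⟩
  · change f₂ v + χ v * (G v - f₂ v) = 0
    rw [hχM v hv, hG0 v hv]; ring
  have hder : HasFDerivAt (fun x => f₂ x + χ x * (G x - f₂ x))
      (fderiv ℝ f₂ x + (χ x • (fderiv ℝ G x - fderiv ℝ f₂ x) + (G x - f₂ x) • fderiv ℝ χ x)) x :=
    (hf₂.differentiable (by simp) x).hasFDerivAt.add
      ((hχ.differentiable (by simp) x).hasFDerivAt.mul
        ((hGd x).hasFDerivAt.sub (hf₂.differentiable (by simp) x).hasFDerivAt))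
  rw [hder.fderiv]
  simp only [_root_.add_apply, _root_.smul_apply, _root_.sub_apply, smul_eq_mul]
  obtain ⟨h1, h2⟩ := hf₂' x i
  rcases lt_or_ge (Metric.infDist x M) r with hx | hx
  · obtain ⟨x', hx', hxx⟩ := hsM x hx
    obtain ⟨h3, h4⟩ := hnear x x' hx' (by linarith) i
    obtain ⟨h5, h6⟩ := hχ01 x
    have h7 : |(G x - f₂ x) * fderiv ℝ χ x (Pi.single i 1)| ≤ a / 2 := by
      rw [abs_mul, mul_comm]
      refine (mul_le_mul (hB x i) ?_ (abs_nonneg _) hB0).trans hεB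
      rw [abs_sub_comm, ← hf₁s x hx]
      exact hf₂d x
    obtain ⟨h8, h9⟩ := abs_le.1 h7
    constructor <;> nlinarith
  · obtain ⟨h3, h4⟩ := hχr x hx
    rw [h3, h4]
    simp only [_root_.zero_apply, zero_mul, mul_zero, add_zero]
    constructor <;> linarith

/-- Permutation of the coordinates as a continuous linear map. -/
def permCLM (σ : Equiv.Perm (Fin n)) : (Fin n → ℝ) →L[ℝ] (Fin n → ℝ) where
  toFun v := v ∘ σ
  map_add' _ _ := rfl
  map_smul' _ _ := rfl
  cont := by fun_prop

theorem fderiv_comp_perm {f : (Fin n → ℝ) → ℝ} (hf : Differentiable ℝ f)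
    (σ : Equiv.Perm (Fin n)) (v : Fin n → ℝ) (i : Fin n) :
    HasFDerivAt (fun v : Fin n → ℝ => f (v ∘ σ))
      ((fderiv ℝ f (v ∘ σ)).comp (permCLM σ)) v ∧
    ((fderiv ℝ f (v ∘ σ)).comp (permCLM σ))
      (Pi.single i 1) = fderiv ℝ f (v ∘ σ) (Pi.single (σ.symm i) 1) := by
  constructor
  · have h1 : HasFDerivAt (fun v : Fin n → ℝ => v ∘ σ) (permCLM σ) v := (permCLM σ).hasFDerivAt
    exact (hf (v ∘ σ)).hasFDerivAt.comp v h1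
  · rw [ContinuousLinearMap.comp_apply]
    congr 1
    funext j
    change (Pi.single i (1 : ℝ) : Fin n → ℝ) (σ j) = _
    simp [Pi.single_apply, Equiv.eq_symm_apply]

/-- The symmetrized function. -/
noncomputable def symmetrize (f : (Fin n → ℝ) → ℝ) (v : Fin n → ℝ) : ℝ :=
  (Fintype.card (Equiv.Perm (Fin n)) : ℝ)⁻¹ * ∑ σ : Equiv.Perm (Fin n), f (v ∘ σ)

theorem symmetrize_comp_perm (f : (Fin n → ℝ) → ℝ) (τ : Equiv.Perm (Fin n)) (v : Fin n → ℝ) :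
    symmetrize f (v ∘ τ) = symmetrize f v :=
  congrArg ((Fintype.card (Equiv.Perm (Fin n)) : ℝ)⁻¹ * ·)
    (Fintype.sum_equiv (Equiv.mulLeft τ) (fun σ => f ((v ∘ τ) ∘ σ))
      (fun σ => f (v ∘ σ)) fun _ => rfl)

theorem contDiff_symmetrize {f : (Fin n → ℝ) → ℝ} (hf : ContDiff ℝ ∞ f) :
    ContDiff ℝ ∞ (symmetrize f) := by
  refine contDiff_const.mul (ContDiff.sum fun σ _ => hf.comp ?_)
  exact contDiff_pi.2 fun i => contDiff_apply ℝ ℝ (σ i)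

theorem fderiv_symmetrize_mem {f : (Fin n → ℝ) → ℝ} (hf : Differentiable ℝ f) {a b : ℝ}
    (hab : ∀ x i, a ≤ fderiv ℝ f x (Pi.single i 1) ∧ fderiv ℝ f x (Pi.single i 1) ≤ b)
    (x : Fin n → ℝ) (i : Fin n) : a ≤ fderiv ℝ (symmetrize f) x (Pi.single i 1) ∧
      fderiv ℝ (symmetrize f) x (Pi.single i 1) ≤ b := by
  have h1 : fderiv ℝ (symmetrize f) x (Pi.single i 1) =
      (Fintype.card (Equiv.Perm (Fin n)) : ℝ)⁻¹ *
        ∑ σ : Equiv.Perm (Fin n), fderiv ℝ f (x ∘ σ) (Pi.single (σ.symm i) 1) := by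
    have h2 : HasFDerivAt (symmetrize f) _ x :=
      (HasFDerivAt.fun_sum (u := Finset.univ) fun (σ : Equiv.Perm (Fin n)) _ =>
        (fderiv_comp_perm hf σ x i).1).const_mul (Fintype.card (Equiv.Perm (Fin n)) : ℝ)⁻¹
    rw [h2.fderiv]
    simp only [_root_.smul_apply, _root_.sum_apply, smul_eq_mul]
    exact congrArg _ (Finset.sum_congr rfl fun σ _ => (fderiv_comp_perm hf σ x i).2)
  have hcard : (0 : ℝ) < Fintype.card (Equiv.Perm (Fin n)) := by
    exact_mod_cast Fintype.card_pos
  rw [h1, le_inv_mul_iff₀ hcard, inv_mul_le_iff₀ hcard]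
  constructor
  · have := Finset.card_nsmul_le_sum Finset.univ
      (fun σ : Equiv.Perm (Fin n) => fderiv ℝ f (x ∘ σ) (Pi.single (σ.symm i) 1)) a
      fun σ _ => (hab _ _).1
    simpa using this
  · have := Finset.sum_le_card_nsmul Finset.univ
      (fun σ : Equiv.Perm (Fin n) => fderiv ℝ f (x ∘ σ) (Pi.single (σ.symm i) 1)) b
      fun σ _ => (hab _ _).2
    simpa using this

/-- The operator of a smooth symmetric function with derivatives bounded between positive
constants is uniformly elliptic. -/
theorem uniformlyElliptic_comp_ordEig {f : (Fin n → ℝ) → ℝ} (hf : Differentiable ℝ f) {a b : ℝ}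
    (ha : 0 < a)
    (hab : ∀ x i, a ≤ fderiv ℝ f x (Pi.single i 1) ∧ fderiv ℝ f x (Pi.single i 1) ≤ b) :
    UniformlyElliptic fun S : SymMat n => f (ordEig S) := by
  set C := max (max 1 a⁻¹) (b * n) with hC
  have hC1 : 1 ≤ C := (le_max_left _ _).trans (le_max_left _ _)
  have hCa : C⁻¹ ≤ a := by
    rw [inv_le_comm₀ (by linarith) ha]
    exact (le_max_right _ _).trans (le_max_left _ _)
  refine ⟨C, hC1, fun S N hN => ?_⟩
  have hmono : ∀ i, 0 ≤ ordEig (S + N) i - ordEig S i := fun i => by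
    rw [sub_nonneg]
    refine ordEig_le_of_quad_le (fun x => ?_) i
    rw [quad_add]
    linarith [quad_nonneg_of_posSemidef hN x]
  have hNpos : ∀ i, 0 ≤ ordEig N i := fun i => by
    have := ordEig_le_of_quad_le (S := (0 : ℝ) • N) (T := N) (fun x => by
      rw [quad_smul, zero_mul]; exact quad_nonneg_of_posSemidef hN x) i
    rwa [ordEig_smul le_rfl, zero_smul] at this
  -- The increments of the eigenvalues are nonnegative and sum to `tr N`, which is comparable to
  -- `‖N‖`; a bound on the partial derivatives of `f` needs nothing more.
  have htr : ∑ i, (ordEig (S + N) i - ordEig S i) = ∑ i, ordEig N i := by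
    rw [Finset.sum_sub_distrib, ← trace_eq_sum_ordEig, ← trace_eq_sum_ordEig,
      ← trace_eq_sum_ordEig, Submodule.coe_add, Matrix.trace_add, add_sub_cancel_left]
  have hlow : ‖N‖ ≤ ∑ i, ordEig N i := by
    refine le_of_sq_le_sq ?_ (Finset.sum_nonneg fun i _ => hNpos i)
    rw [norm_sq_eq_sum]
    exact Finset.sum_sq_le_sq_sum_of_nonneg fun i _ => hNpos i
  have hup : ∑ i, ordEig N i ≤ n * ‖N‖ := by
    refine (Finset.sum_le_card_nsmul _ _ ‖N‖ fun i _ =>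
      (le_abs_self _).trans (abs_ordEig_le N i)).trans_eq ?_
    rw [Finset.card_univ, Fintype.card_fin, nsmul_eq_mul]
  obtain ⟨z, -, hz⟩ := exists_fderiv_eq_sub hf (ordEig (S + N)) (ordEig S)
  change _ ≤ f (ordEig (S + N)) - f (ordEig S) ∧ f (ordEig (S + N)) - f (ordEig S) ≤ _
  rw [hz, fderiv_eq_sum]
  simp only [Pi.sub_apply]
  have h1 : a * ∑ i, ordEig N i ≤ ∑ i, fderiv ℝ f z (Pi.single i 1) *
      (ordEig (S + N) i - ordEig S i) := by
    rw [← htr, Finset.mul_sum]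
    exact Finset.sum_le_sum fun i _ => mul_le_mul_of_nonneg_right (hab z i).1 (hmono i)
  have h2 : ∑ i, fderiv ℝ f z (Pi.single i 1) * (ordEig (S + N) i - ordEig S i) ≤
      b * ∑ i, ordEig N i := by
    rw [← htr, Finset.mul_sum]
    exact Finset.sum_le_sum fun i _ => mul_le_mul_of_nonneg_right (hab z i).2 (hmono i)
  constructor
  · refine le_trans (mul_le_mul hCa hlow (norm_nonneg _) ha.le) h1
  · refine h2.trans ?_
    rcases Nat.eq_zero_or_pos n with hn | hn
    · subst hn
      simp only [Finset.univ_eq_empty, Finset.sum_empty, mul_zero]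
      exact mul_nonneg (by linarith) (norm_nonneg _)
    · have hb0 : 0 ≤ b := ha.le.trans ((hab z ⟨0, hn⟩).1.trans (hab z ⟨0, hn⟩).2)
      calc b * ∑ i, ordEig N i ≤ b * (n * ‖N‖) := mul_le_mul_of_nonneg_left hup hb0
        _ = b * n * ‖N‖ := by ring
        _ ≤ C * ‖N‖ := mul_le_mul_of_nonneg_right (le_max_right _ _) (norm_nonneg _)

/-- The matrix operator attached to `M`. -/
theorem exists_operator {M : Set (Fin n → ℝ)} (hM : M.Nonempty)
    (hMσ : ∀ v ∈ M, ∀ σ : Equiv.Perm (Fin n), v ∘ σ ∈ M) {C : ℝ} (hC : 0 < C)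
    (hyp : HypDiff C M) {G : (Fin n → ℝ) → ℝ} (hG : ContDiff ℝ ∞ G)
    (hu : ∀ ε > 0, ∃ η > 0, ∀ x y : Fin n → ℝ, ‖x - y‖ < η → ∀ i,
      |fderiv ℝ G x (Pi.single i 1) - fderiv ℝ G y (Pi.single i 1)| ≤ ε)
    {K : ℝ} (hK : ∀ x i, |fderiv ℝ G x (Pi.single i 1)| ≤ K)
    (hG0 : ∀ v ∈ M, G v = 0) {c : ℝ} (hc : 0 < c)
    (hGc : ∀ v ∈ M, ∀ i, c ≤ fderiv ℝ G v (Pi.single i 1)) :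
    ∃ F : SymMat n → ℝ, IsHessianOperator F ∧ SmoothOperator F ∧ UniformlyElliptic F ∧
      ∀ S, ordEig S ∈ M → F S = 0 := by
  obtain ⟨f, hf, hf0, a, b, ha, hab⟩ := exists_global_function hM hC hyp hG hu hK hG0 hc hGc
  refine ⟨fun S => symmetrize f (ordEig S), ⟨symmetrize f, symmetrize_comp_perm f, fun S => rfl⟩,
    contDiff_comp_ordEig (contDiff_symmetrize hf) (symmetrize_comp_perm f),
    uniformlyElliptic_comp_ordEig ((contDiff_symmetrize hf).differentiable (by simp)) ha
      (fderiv_symmetrize_mem (hf.differentiable (by simp)) hab), fun S hS => ?_⟩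
  change symmetrize f (ordEig S) = 0
  rw [symmetrize, Finset.sum_eq_zero fun σ _ => hf0 _ (hMσ _ hS σ), mul_zero]

end HessianEq

/-! ### Extension of the local defining function with controlled gradient -/

namespace HessianEq

open Filter Topology

variable {n : ℕ}

theorem exists_smooth_cutoff {K W : Set (Fin n → ℝ)} (hK : IsClosed K) (hW : IsOpen W)
    (hKW : K ⊆ W) :
    ∃ χ : (Fin n → ℝ) → ℝ, ContDiff ℝ ∞ χ ∧ (∀ x, 0 ≤ χ x ∧ χ x ≤ 1) ∧
      (∀ x ∈ K, χ =ᶠ[𝓝 x] fun _ => 1) ∧ ∀ x ∉ W, χ =ᶠ[𝓝 x] fun _ => 0 := by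
  obtain ⟨f, h0, h1, h01⟩ := exists_contMDiffMap_zero_one_nhds_of_isClosed (n := ⊤)
    (modelWithCornersSelf ℝ (Fin n → ℝ)) hW.isClosed_compl hK
    (Set.disjoint_left.2 fun x hx hxK => hx (hKW hxK))
  exact ⟨f, f.contMDiff.contDiff, fun x => h01 x,
    fun x hx => eventually_nhdsSet_iff_forall.1 h1 x hx,
    fun x hx => eventually_nhdsSet_iff_forall.1 h0 x hx⟩

theorem contDiff_cutoff_mul {W : Set (Fin n → ℝ)} (hW : IsOpen W) {χ g : (Fin n → ℝ) → ℝ}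
    (hχ : ContDiff ℝ ∞ χ) (hg : ContDiffOn ℝ ∞ g W) (h0 : ∀ x ∉ W, χ =ᶠ[𝓝 x] fun _ => 0) :
    ContDiff ℝ ∞ fun x => χ x * g x := by
  rw [contDiff_iff_contDiffAt]
  intro x
  by_cases hx : x ∈ W
  · exact hχ.contDiffAt.mul (hg.contDiffAt (hW.mem_nhds hx))
  · refine (contDiffAt_const (c := (0 : ℝ))).congr_of_eventuallyEq ?_
    filter_upwards [h0 x hx] with y hy
    rw [hy, zero_mul]

/-- A smooth function whose gradient is eventually constant along rays has bounded and uniformly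
continuous gradient. -/
theorem uniform_fderiv_of_radial {G : (Fin n → ℝ) → ℝ} (hG : ContDiff ℝ ∞ G) {ρ : ℝ} (hρ : 0 < ρ)
    (hr : ∀ x, ρ ≤ ‖x‖ → ∀ s : ℝ, 1 ≤ s → fderiv ℝ G (s • x) = fderiv ℝ G x) :
    (∀ ε > 0, ∃ η > 0, ∀ x y : Fin n → ℝ, ‖x - y‖ < η → ∀ i,
      |fderiv ℝ G x (Pi.single i 1) - fderiv ℝ G y (Pi.single i 1)| ≤ ε) ∧
    ∃ K, ∀ x i, |fderiv ℝ G x (Pi.single i 1)| ≤ K := by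
  have hc : Continuous (fderiv ℝ G) := (contDiff_infty_iff_fderiv.1 hG).2.continuous
  have hcomp : IsCompact (Metric.closedBall (0 : Fin n → ℝ) (3 * ρ)) := isCompact_closedBall _ _
  have hn : ∀ i : Fin n, ‖(Pi.single i 1 : Fin n → ℝ)‖ = 1 := fun i => by
    rw [Pi.norm_single, norm_one]
  have happ : ∀ (L : (Fin n → ℝ) →L[ℝ] ℝ) i, |L (Pi.single i 1)| ≤ ‖L‖ := fun L i => by
    simpa [hn i] using L.le_opNorm (Pi.single i 1)
  constructor
  · intro ε hε
    obtain ⟨δ, hδ, h⟩ := Metric.uniformContinuousOn_iff.1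
      (hcomp.uniformContinuousOn_of_continuous hc.continuousOn) ε hε
    have key : ∀ x y : Fin n → ℝ, ‖x‖ ≤ 2 * ρ → ‖x - y‖ < min δ ρ →
        ‖fderiv ℝ G x - fderiv ℝ G y‖ ≤ ε := by
      intro x y hx hxy
      rw [← dist_eq_norm]
      refine (h x ?_ y ?_ ?_).le
      · rw [mem_closedBall_zero_iff]; linarith
      · rw [mem_closedBall_zero_iff]
        have h1 := norm_sub_norm_le y x
        rw [norm_sub_rev] at h1
        linarith [hxy.trans_le (min_le_right δ ρ)]
      · rw [dist_eq_norm]; exact hxy.trans_le (min_le_left _ _)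
    refine ⟨min δ ρ, lt_min hδ hρ, fun x y hxy i => ?_⟩
    rw [← _root_.sub_apply]
    refine (happ _ i).trans ?_
    rcases le_or_gt ‖x‖ (2 * ρ) with hx | hx
    · exact key x y hx hxy
    -- Both points are shrunk by the same factor, which brings `x` to norm `2ρ`, leaves `y` outside
    -- radius `ρ` and does not increase their distance; compactness then applies.
    · set s := ‖x‖ / (2 * ρ) with hs
      have hs1 : 1 ≤ s := by rw [hs, le_div_iff₀ (by positivity)]; linarith
      have hs0 : 0 < s := by linarith
      have hx' : x = s • (s⁻¹ • x) := by rw [smul_smul, mul_inv_cancel₀ hs0.ne', one_smul]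
      have hy' : y = s • (s⁻¹ • y) := by rw [smul_smul, mul_inv_cancel₀ hs0.ne', one_smul]
      have hnx : ‖s⁻¹ • x‖ = 2 * ρ := by
        rw [norm_smul, norm_inv, Real.norm_of_nonneg hs0.le, hs]
        have : ‖x‖ ≠ 0 := by linarith
        field_simp
      have hd : ‖s⁻¹ • x - s⁻¹ • y‖ < min δ ρ := by
        rw [← smul_sub, norm_smul, norm_inv, Real.norm_of_nonneg hs0.le]
        refine lt_of_le_of_lt ?_ hxy
        exact mul_le_of_le_one_left (norm_nonneg _) (inv_le_one_of_one_le₀ hs1)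
      have hny : ρ ≤ ‖s⁻¹ • y‖ := by
        have := norm_sub_norm_le (s⁻¹ • x) (s⁻¹ • y)
        linarith [hd.trans_le (min_le_right δ ρ)]
      rw [hx', hy', hr _ (by rw [hnx]; linarith) s hs1, hr _ hny s hs1]
      exact key _ _ hnx.le hd
  · obtain ⟨K, hK⟩ := hcomp.exists_bound_of_continuousOn hc.continuousOn
    refine ⟨K, fun x i => (happ _ i).trans ?_⟩
    rcases le_or_gt ‖x‖ ρ with hx | hx
    · exact hK x (by rw [mem_closedBall_zero_iff]; linarith)
    · set s := ‖x‖ / ρ with hs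
      have hs1 : 1 ≤ s := by rw [hs, le_div_iff₀ hρ]; linarith
      have hs0 : 0 < s := by linarith
      have hx' : x = s • (s⁻¹ • x) := by rw [smul_smul, mul_inv_cancel₀ hs0.ne', one_smul]
      have hnx : ‖s⁻¹ • x‖ = ρ := by
        rw [norm_smul, norm_inv, Real.norm_of_nonneg hs0.le, hs]
        have : ‖x‖ ≠ 0 := by linarith
        field_simp
      rw [hx', hr _ hnx.ge s hs1]
      exact hK _ (by rw [mem_closedBall_zero_iff, hnx]; linarith)

/-- Extension of a local defining function of a compact set. -/
theorem exists_defining_function_of_isCompact {M U : Set (Fin n → ℝ)} (hM : IsCompact M)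
    (hU : IsOpen U) (hMU : M ⊆ U) {g : (Fin n → ℝ) → ℝ} (hg : ContDiffOn ℝ ∞ g U) :
    ∃ G : (Fin n → ℝ) → ℝ, ContDiff ℝ ∞ G ∧ (∀ v ∈ M, G =ᶠ[𝓝 v] g) ∧
      ∃ ρ > 0, ∀ x, ρ ≤ ‖x‖ → ∀ s : ℝ, 1 ≤ s → fderiv ℝ G (s • x) = fderiv ℝ G x := by
  obtain ⟨ρ, hρ, hρM⟩ := hM.isBounded.subset_ball_lt 0 0
  obtain ⟨χ, hχ, -, hχ1, hχ0⟩ := exists_smooth_cutoff hM.isClosed (hU.inter Metric.isOpen_ball)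
    (Set.subset_inter hMU hρM)
  refine ⟨fun x => χ x * g x, contDiff_cutoff_mul (hU.inter Metric.isOpen_ball) hχ
    (hg.mono Set.inter_subset_left) hχ0, fun v hv => ?_, ρ, hρ, fun x hx s hs => ?_⟩
  · filter_upwards [hχ1 v hv] with y hy
    rw [hy, one_mul]
  · have key : ∀ x : Fin n → ℝ, ρ ≤ ‖x‖ → fderiv ℝ (fun x => χ x * g x) x = 0 := by
      intro x hx
      have h1 : (fun x => χ x * g x) =ᶠ[𝓝 x] fun _ => 0 := by
        filter_upwards [hχ0 x fun h => by
          have := mem_ball_zero_iff.1 h.2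
          linarith] with y hy
        rw [hy, zero_mul]
      rw [h1.fderiv_eq, fderiv_const_apply]
    rw [key x hx, key (s • x)]
    rw [norm_smul, Real.norm_of_nonneg (by linarith)]
    nlinarith

/-- `g` vanishes at `p`, is stationary in the radial direction there and has partial derivatives
at least `c`. -/
def DefinesAt (c : ℝ) (g : (Fin n → ℝ) → ℝ) (p : Fin n → ℝ) : Prop :=
  g p = 0 ∧ fderiv ℝ g p p = 0 ∧ ∀ i, c ≤ fderiv ℝ g p (Pi.single i 1)

theorem DefinesAt.congr {c : ℝ} {g h : (Fin n → ℝ) → ℝ} {p : Fin n → ℝ} (hg : DefinesAt c g p)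
    (hgh : h =ᶠ[𝓝 p] g) : DefinesAt c h p := by
  rw [DefinesAt, hgh.fderiv_eq, hgh.eq_of_nhds]
  exact hg

/-- Vanishing along an open piece of the ray gives the radial stationarity that homogenization
requires. -/
theorem definesAt_of_ray {c : ℝ} {g : (Fin n → ℝ) → ℝ} {v : Fin n → ℝ} {s : ℝ} (hs : 1 < s)
    (hg : DifferentiableAt ℝ g (s • v)) (h0 : ∀ t : ℝ, 1 < t → g (t • v) = 0)
    (hc : ∀ i, c ≤ fderiv ℝ g (s • v) (Pi.single i 1)) : DefinesAt c g (s • v) := by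
  refine ⟨h0 s hs, ?_, hc⟩
  have h1 : HasDerivAt (fun t : ℝ => g (t • v)) (fderiv ℝ g (s • v) v) s := by
    have h2 : HasDerivAt (fun t : ℝ => t • v) v s := by
      simpa using (hasDerivAt_id s).smul_const v
    exact hg.hasFDerivAt.comp_hasDerivAt s h2
  have h2 : (fun t : ℝ => g (t • v)) =ᶠ[𝓝 s] fun _ => 0 := by
    filter_upwards [Ioi_mem_nhds hs] with t ht
    exact h0 t ht
  have h3 : fderiv ℝ g (s • v) v = 0 := by
    rw [← h1.deriv, h2.deriv_eq, deriv_const]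
  rw [map_smul, h3, smul_zero]

/-- The Euclidean norm on `Fin n → ℝ`. -/
noncomputable def eNorm (x : Fin n → ℝ) : ℝ := ‖WithLp.toLp 2 x‖

theorem eNorm_smul {s : ℝ} (hs : 0 ≤ s) (x : Fin n → ℝ) : eNorm (s • x) = s * eNorm x := by
  rw [eNorm, WithLp.toLp_smul, norm_smul, Real.norm_of_nonneg hs, eNorm]

theorem norm_le_eNorm (x : Fin n → ℝ) : ‖x‖ ≤ eNorm x :=
  (pi_norm_le_iff_of_nonneg (norm_nonneg _)).2 fun i => PiLp.norm_apply_le (WithLp.toLp 2 x) i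

theorem eNorm_pos {x : Fin n → ℝ} (hx : x ≠ 0) : 0 < eNorm x :=
  (norm_pos_iff.2 hx).trans_le (norm_le_eNorm x)

/-- Smoothness off the origin is the reason for using this norm: the sup norm of `Fin n → ℝ` lacks
it in general. -/
theorem contDiffAt_eNorm {x : Fin n → ℝ} (hx : x ≠ 0) : ContDiffAt ℝ ∞ eNorm x := by
  have h1 : ContDiffAt ℝ ∞ (fun y : EuclideanSpace ℝ (Fin n) => ‖y‖) (WithLp.toLp 2 x) :=
    contDiffAt_norm ℝ (by simpa using hx)
  exact h1.comp x (PiLp.continuousLinearEquiv 2 ℝ (fun _ : Fin n => ℝ)).symm.contDiff.contDiffAt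

theorem continuous_eNorm : Continuous (eNorm : (Fin n → ℝ) → ℝ) :=
  continuous_norm.comp (PiLp.continuousLinearEquiv 2 ℝ (fun _ : Fin n => ℝ)).symm.continuous

/-- The extension of `H` from the unit sphere, homogeneous of degree one. -/
noncomputable def homogenize (H : (Fin n → ℝ) → ℝ) (x : Fin n → ℝ) : ℝ :=
  eNorm x * H ((eNorm x)⁻¹ • x)

theorem contDiffAt_homogenize {H : (Fin n → ℝ) → ℝ} (hH : ContDiff ℝ ∞ H) {x : Fin n → ℝ}
    (hx : x ≠ 0) : ContDiffAt ℝ ∞ (homogenize H) x := by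
  have h1 := contDiffAt_eNorm hx
  exact h1.mul (hH.contDiffAt.comp x ((h1.inv (eNorm_pos hx).ne').smul contDiffAt_id))

theorem homogenize_smul (H : (Fin n → ℝ) → ℝ) {s : ℝ} (hs : 0 < s) (x : Fin n → ℝ) :
    homogenize H (s • x) = s * homogenize H x := by
  rw [homogenize, homogenize, eNorm_smul hs.le, smul_smul, mul_assoc]
  congr 4
  rw [mul_inv, mul_right_comm, inv_mul_cancel₀ hs.ne', one_mul]

theorem fderiv_homogenize_smul (H : (Fin n → ℝ) → ℝ) {s : ℝ} (hs : 0 < s) (x : Fin n → ℝ) :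
    fderiv ℝ (homogenize H) (s • x) = fderiv ℝ (homogenize H) x := by
  have h1 := fderiv_comp_smul (𝕜 := ℝ) (f := homogenize H) (x := x) s
  have h2 : (fun x => homogenize H (s • x)) = s • homogenize H :=
    funext fun x => homogenize_smul H hs x
  rw [h2, fderiv_const_smul_field] at h1
  have h3 := congrArg (fun L => s⁻¹ • L) h1
  simpa [smul_smul, inv_mul_cancel₀ hs.ne'] using h3.symm

/-- Differentiating the norm factor contributes nothing because `H` vanishes, and differentiating
the normalization contributes only a radial derivative, which is zero too. The remaining scale
factors cancel, so the partial derivatives are those of `H` at the unit vector. -/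
theorem DefinesAt.homogenize {c : ℝ} {H : (Fin n → ℝ) → ℝ} (hH : ContDiff ℝ ∞ H)
    {p : Fin n → ℝ} (hp : p ≠ 0) (h : DefinesAt c H ((eNorm p)⁻¹ • p)) :
    HessianEq.homogenize H p = 0 ∧
      ∀ i, c ≤ fderiv ℝ (HessianEq.homogenize H) p (Pi.single i 1) := by
  have hN := (contDiffAt_eNorm hp).differentiableAt (by simp)
  have hNp := eNorm_pos hp
  have hk : DifferentiableAt ℝ (fun x : Fin n → ℝ => (eNorm x)⁻¹) p := hN.inv hNp.ne'
  have hq : HasFDerivAt (fun x : Fin n → ℝ => (eNorm x)⁻¹ • x) _ p :=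
    hk.hasFDerivAt.smul (hasFDerivAt_id p)
  have hHq : HasFDerivAt (fun x : Fin n → ℝ => H ((eNorm x)⁻¹ • x)) _ p :=
    HasFDerivAt.comp (f := fun x : Fin n → ℝ => (eNorm x)⁻¹ • x) p
      (hH.differentiable (by simp) ((eNorm p)⁻¹ • p)).hasFDerivAt hq
  have hd : HasFDerivAt (HessianEq.homogenize H) _ p := hN.hasFDerivAt.mul hHq
  obtain ⟨h0, h1, h2⟩ := h
  refine ⟨by rw [HessianEq.homogenize, h0, mul_zero], fun i => ?_⟩
  have h3 : fderiv ℝ H ((eNorm p)⁻¹ • p) p = 0 := by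
    rw [map_smul, smul_eq_mul] at h1
    exact (mul_eq_zero.1 h1).resolve_left (inv_ne_zero hNp.ne')
  rw [hd.fderiv]
  simp only [_root_.add_apply, _root_.smul_apply, ContinuousLinearMap.comp_apply,
    h0, zero_smul, map_add, map_smul, ContinuousLinearMap.smulRight_apply,
    h3, ContinuousLinearMap.id_apply, smul_eq_mul, mul_zero, add_zero]
  rw [mul_inv_cancel_left₀ hNp.ne']
  exact h2 i

theorem DefinesAt.rescale {c R : ℝ} (hR : 0 < R) {g : (Fin n → ℝ) → ℝ} {t : Fin n → ℝ}
    (h : DefinesAt c g (R • t)) : DefinesAt c (fun x => R⁻¹ * g (R • x)) t := by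
  obtain ⟨h0, h1, h2⟩ := h
  have hd : fderiv ℝ (fun x => R⁻¹ * g (R • x)) t = fderiv ℝ g (R • t) := by
    have h3 : (fun x => R⁻¹ * g (R • x)) = R⁻¹ • (g <| R • ·) := rfl
    rw [h3, fderiv_const_smul_field, Pi.smul_apply, fderiv_comp_smul, smul_smul, inv_mul_cancel₀ hR.ne', one_smul]
  refine ⟨by simp only [h0, mul_zero], ?_, fun i => by rw [hd]; exact h2 i⟩
  rw [hd]
  rw [map_smul, smul_eq_mul] at h1
  exact (mul_eq_zero.1 h1).resolve_left hR.ne'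

/-- Interpolation between defining functions: where the weight is stationary and extreme, only one
of the two is required to be defining. -/
theorem definesAt_interpolate {c : ℝ} {χ g h : (Fin n → ℝ) → ℝ} {p : Fin n → ℝ}
    (hχd : DifferentiableAt ℝ χ p) (hχ : 0 ≤ χ p ∧ χ p ≤ 1)
    (hgd : DifferentiableAt ℝ g p) (hhd : DifferentiableAt ℝ h p)
    (hg : DefinesAt c g p)
    (hh : DefinesAt c h p ∨ χ p = 1 ∧ fderiv ℝ χ p = 0) :
    DefinesAt c (fun x => χ x * g x + (1 - χ x) * h x) p := by
  have hd : HasFDerivAt (fun x => χ x * g x + (1 - χ x) * h x) _ p :=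
    (hχd.hasFDerivAt.mul hgd.hasFDerivAt).add
      ((hχd.hasFDerivAt.const_sub 1).mul hhd.hasFDerivAt)
  obtain ⟨g0, g1, g2⟩ := hg
  rw [DefinesAt, hd.fderiv]
  rcases hh with ⟨h0, h1, h2⟩ | ⟨hχ1, hχ2⟩
  · simp only [_root_.add_apply, _root_.smul_apply, smul_eq_mul, g0, h0, g1, h1]
    refine ⟨by ring, by ring, fun i => ?_⟩
    nlinarith [g2 i, h2 i, hχ.1, hχ.2]
  · simp only [_root_.add_apply, _root_.smul_apply, smul_eq_mul, g0, g1, hχ1, hχ2,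
      _root_.zero_apply, neg_zero]
    refine ⟨by ring, by ring, fun i => ?_⟩
    have := g2 i
    linarith

theorem fderiv_eq_zero_of_cutoff_eq_one {χ : (Fin n → ℝ) → ℝ} (h01 : ∀ x, 0 ≤ χ x ∧ χ x ≤ 1)
    {p : Fin n → ℝ} (hp : χ p = 1) : fderiv ℝ χ p = 0 :=
  IsLocalMax.fderiv_eq_zero (Filter.Eventually.of_forall fun x => by rw [hp]; exact (h01 x).2)

/-- A smooth function, homogeneous of degree one, that defines the cone over `M₁`. -/
theorem exists_homogeneous_defining_function {M₁ U : Set (Fin n → ℝ)} (hM₁ : IsCompact M₁)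
    (hU : IsOpen U) {g g₀ : (Fin n → ℝ) → ℝ} (hg : ContDiffOn ℝ ∞ g U) {c : ℝ}
    (hMU : ∀ v ∈ M₁, ∀ s : ℝ, 1 < s → s • v ∈ U)
    (hMg : ∀ v ∈ M₁, ∀ s : ℝ, 1 < s → DefinesAt c g (s • v))
    (hg₀ : ContDiff ℝ ∞ g₀) {r : ℝ} (hr : 0 < r)
    (hMg₀ : ∀ v ∈ M₁, ∀ s : ℝ, 1 < s → ‖s • v‖ ≤ r → DefinesAt c g₀ (s • v)) :
    ∃ H : (Fin n → ℝ) → ℝ, ContDiff ℝ ∞ H ∧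
      ∀ v ∈ M₁, v ≠ 0 → DefinesAt c H ((eNorm v)⁻¹ • v) := by
  obtain ⟨R₀, hR₀⟩ := hM₁.exists_bound_of_continuousOn continuous_eNorm.continuousOn
  set R := max R₀ r + 1 with hR
  have hR0 : 0 < R := by have := le_max_right R₀ r; linarith
  have hRv : ∀ v ∈ M₁, eNorm v < R := fun v hv => by
    have h1 := (le_abs_self _).trans (hR₀ v hv)
    have h2 := le_max_left R₀ r
    linarith
  -- The directions of all of `M₁ \ {0}` need not form a compact set when `0 ∈ M₁`. Those of points
  -- of norm at least `r` do, and on them the rescaled `g` is used alone; for the remaining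
  -- directions it is blended with the rescaled `g₀`.
  set K : Set (Fin n → ℝ) := (fun v => (eNorm v)⁻¹ • v) '' (M₁ ∩ {v | r ≤ eNorm v}) with hK
  set W : Set (Fin n → ℝ) := {x | R • x ∈ U} with hW
  have hWo : IsOpen W := hU.preimage (continuous_const_smul R)
  have hKc : IsCompact K := by
    refine (hM₁.inter_right (isClosed_le continuous_const continuous_eNorm)).image_of_continuousOn ?_
    refine ContinuousOn.smul (continuous_eNorm.continuousOn.inv₀ fun v hv => ?_) continuousOn_id
    have : r ≤ eNorm v := hv.2
    linarith
  have hdir : ∀ v ∈ M₁, v ≠ 0 → ∀ ρ, eNorm v < ρ → ∃ s : ℝ, 1 < s ∧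
      ρ • ((eNorm v)⁻¹ • v) = s • v := by
    intro v _ hv0 ρ hρ
    have := eNorm_pos hv0
    exact ⟨ρ * (eNorm v)⁻¹, by rw [← div_eq_mul_inv, one_lt_div this]; exact hρ, smul_smul _ _ _⟩
  have hKW : K ⊆ W := by
    rintro _ ⟨v, ⟨hv, hvr⟩, rfl⟩
    have hv0 : v ≠ 0 := by
      rintro rfl
      have h1 : r ≤ eNorm (0 : Fin n → ℝ) := hvr
      have h2 : eNorm (0 : Fin n → ℝ) = 0 := by simp [eNorm]
      linarith
    obtain ⟨s, hs, hse⟩ := hdir v hv hv0 R (hRv v hv)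
    change R • ((eNorm v)⁻¹ • v) ∈ U
    rw [hse]
    exact hMU v hv s hs
  obtain ⟨χ, hχ, hχ01, hχ1, hχ0⟩ := exists_smooth_cutoff hKc.isClosed hWo hKW
  have hα : ContDiffOn ℝ ∞ (fun x => R⁻¹ * g (R • x)) W :=
    contDiffOn_const.mul (hg.comp (contDiff_const_smul R).contDiffOn fun x hx => hx)
  have hβ : ContDiff ℝ ∞ fun x => r⁻¹ * g₀ (r • x) :=
    contDiff_const.mul (hg₀.comp (contDiff_const_smul r))
  refine ⟨fun x => χ x * (R⁻¹ * g (R • x)) + (1 - χ x) * (r⁻¹ * g₀ (r • x)),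
    (contDiff_cutoff_mul hWo hχ hα hχ0).add ((contDiff_const.sub hχ).mul hβ), fun v hv hv0 => ?_⟩
  set t := (eNorm v)⁻¹ • v with ht
  obtain ⟨s, hs, hse⟩ := hdir v hv hv0 R (hRv v hv)
  have htW : t ∈ W := by
    change R • t ∈ U
    rw [hse]
    exact hMU v hv s hs
  refine definesAt_interpolate (hχ.differentiable (by simp) t) (hχ01 t)
    ((hα.contDiffAt (hWo.mem_nhds htW)).differentiableAt (by simp))
    (hβ.differentiable (by simp) t) (DefinesAt.rescale hR0 (by rw [hse]; exact hMg v hv s hs)) ?_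
  rcases le_or_gt r (eNorm v) with hvr | hvr
  · right
    have : χ t = 1 := (hχ1 t ⟨v, ⟨hv, hvr⟩, rfl⟩).eq_of_nhds
    exact ⟨this, fderiv_eq_zero_of_cutoff_eq_one hχ01 this⟩
  · left
    obtain ⟨s', hs', hse'⟩ := hdir v hv hv0 r hvr
    refine DefinesAt.rescale hr ?_
    rw [hse']
    refine hMg₀ v hv s' hs' ?_
    rw [← hse', norm_smul, Real.norm_of_nonneg hr.le]
    refine mul_le_of_le_one_right hr.le ((norm_le_eNorm _).trans_eq ?_)
    rw [eNorm_smul (inv_nonneg.2 (eNorm_pos hv0).le), inv_mul_cancel₀ (eNorm_pos hv0).ne']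

/-- The homogeneous function is singular only at the origin and is replaced there by `g₀`. Both
vanish on the cone in the transition zone, so the cutoff adds nothing to the gradient there; far
out, degree-one homogeneity makes the gradient constant along rays. -/
theorem exists_defining_function_of_local {M₁ U : Set (Fin n → ℝ)} (hM₁ : IsCompact M₁)
    (hU : IsOpen U) {g g₀ : (Fin n → ℝ) → ℝ} (hg : ContDiffOn ℝ ∞ g U) {c : ℝ}
    (hMU : ∀ v ∈ M₁, ∀ s : ℝ, 1 < s → s • v ∈ U)
    (hMg : ∀ v ∈ M₁, ∀ s : ℝ, 1 < s → DefinesAt c g (s • v))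
    (hg₀ : ContDiff ℝ ∞ g₀) {r : ℝ} (hr : 0 < r)
    (hMg₀ : ∀ v ∈ M₁, ∀ s : ℝ, 1 < s → ‖s • v‖ ≤ r → DefinesAt c g₀ (s • v)) :
    ∃ G : (Fin n → ℝ) → ℝ, ContDiff ℝ ∞ G ∧
      (∀ v ∈ M₁, ∀ s : ℝ, 1 < s → G (s • v) = 0 ∧ ∀ i, c ≤ fderiv ℝ G (s • v) (Pi.single i 1)) ∧
      ∃ ρ > 0, ∀ x, ρ ≤ ‖x‖ → ∀ s : ℝ, 1 ≤ s → fderiv ℝ G (s • x) = fderiv ℝ G x := by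
  obtain ⟨H, hH, hMH⟩ := exists_homogeneous_defining_function hM₁ hU hg hMU hMg hg₀ hr hMg₀
  obtain ⟨ψ, hψ, hψ01, hψ1, hψ0⟩ := exists_smooth_cutoff
    (K := Metric.closedBall (0 : Fin n → ℝ) (r / 2)) (W := Metric.ball 0 r)
    Metric.isClosed_closedBall Metric.isOpen_ball (Metric.closedBall_subset_ball (by linarith))
  set G : (Fin n → ℝ) → ℝ := fun x => ψ x * g₀ x + (1 - ψ x) * homogenize H x with hG
  have hG0 : G =ᶠ[𝓝 0] g₀ := by
    filter_upwards [hψ1 0 (Metric.mem_closedBall_self (by positivity))] with x hx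
    simp only [hG, hx]
    ring
  have hGfar : ∀ x : Fin n → ℝ, r ≤ ‖x‖ → G =ᶠ[𝓝 x] homogenize H := by
    intro x hx
    filter_upwards [hψ0 x fun h => by
      have := mem_ball_zero_iff.1 h
      linarith] with y hy
    simp only [hG, hy]
    ring
  refine ⟨G, ?_, fun v hv s hs => ?_, r, hr, fun x hx s hs => ?_⟩
  · rw [contDiff_iff_contDiffAt]
    intro x
    by_cases hx : x = 0
    · rw [hx]; exact hg₀.contDiffAt.congr_of_eventuallyEq hG0
    · exact (hψ.contDiffAt.mul hg₀.contDiffAt).add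
        ((contDiffAt_const.sub hψ.contDiffAt).mul (contDiffAt_homogenize hH hx))
  · have hs0 : 0 < s := by linarith
    by_cases hv0 : v = 0
    · have h1 := hMg₀ v hv s hs (by rw [hv0, smul_zero, norm_zero]; exact hr.le)
      rw [hv0, smul_zero] at h1 ⊢
      have h2 := h1.congr hG0
      exact ⟨h2.1, h2.2.2⟩
    have hp0 : s • v ≠ 0 := smul_ne_zero hs0.ne' hv0
    have hpd : (eNorm (s • v))⁻¹ • (s • v) = (eNorm v)⁻¹ • v := by
      rw [eNorm_smul hs0.le, smul_smul, mul_inv, mul_right_comm, inv_mul_cancel₀ hs0.ne', one_mul]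
    obtain ⟨h1, h2⟩ := DefinesAt.homogenize hH hp0 (by rw [hpd]; exact hMH v hv hv0)
    rcases le_or_gt r ‖s • v‖ with hr' | hr'
    · rw [(hGfar _ hr').fderiv_eq, (hGfar _ hr').eq_of_nhds]
      exact ⟨h1, h2⟩
    · obtain ⟨h3, -, h4⟩ := hMg₀ v hv s hs hr'.le
      have hd : HasFDerivAt G _ (s • v) :=
        ((hψ.differentiable (by simp) (s • v)).hasFDerivAt.mul
          (hg₀.differentiable (by simp) (s • v)).hasFDerivAt).add
        (((hψ.differentiable (by simp) (s • v)).hasFDerivAt.const_sub 1).mul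
          ((contDiffAt_homogenize hH hp0).differentiableAt (by simp)).hasFDerivAt)
      refine ⟨by simp only [hG, h1, h3]; ring, fun i => ?_⟩
      rw [hd.fderiv]
      simp only [_root_.add_apply, _root_.smul_apply, smul_eq_mul, h1, h3]
      nlinarith [h2 i, h4 i, (hψ01 (s • v)).1, (hψ01 (s • v)).2]
  · have hsx : r ≤ ‖s • x‖ := by
      rw [norm_smul, Real.norm_of_nonneg (by linarith)]
      nlinarith
    rw [(hGfar x hx).fderiv_eq, (hGfar _ hsx).fderiv_eq]
    exact fderiv_homogenize_smul H (by linarith) x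

/-- Extension of a local defining function of a truncated cone. -/
theorem exists_defining_function_of_cone {M₁ U : Set (Fin n → ℝ)} (hM₁ : IsCompact M₁)
    (hU : IsOpen U) {g : (Fin n → ℝ) → ℝ} (hg : ContDiffOn ℝ ∞ g U) {c : ℝ}
    (hMU : ∀ v ∈ M₁, ∀ s : ℝ, 1 < s → s • v ∈ U)
    (hM0 : ∀ v ∈ M₁, ∀ s : ℝ, 1 < s → g (s • v) = 0)
    (hMc : ∀ v ∈ M₁, ∀ s : ℝ, 1 < s → ∀ i, c ≤ fderiv ℝ g (s • v) (Pi.single i 1)) :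
    ∃ G : (Fin n → ℝ) → ℝ, ContDiff ℝ ∞ G ∧
      (∀ v ∈ M₁, ∀ s : ℝ, 1 < s → G (s • v) = 0 ∧ ∀ i, c ≤ fderiv ℝ G (s • v) (Pi.single i 1)) ∧
      ∃ ρ > 0, ∀ x, ρ ≤ ‖x‖ → ∀ s : ℝ, 1 ≤ s → fderiv ℝ G (s • x) = fderiv ℝ G x := by
  have hMg : ∀ v ∈ M₁, ∀ s : ℝ, 1 < s → DefinesAt c g (s • v) := fun v hv s hs =>
    definesAt_of_ray hs ((hg.contDiffAt (hU.mem_nhds (hMU v hv s hs))).differentiableAt (by simp))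
      (hM0 v hv) (hMc v hv s hs)
  -- If `0 ∈ M₁` then `0 ∈ U`, and a cutoff of `g` serves as `g₀`. Otherwise `M₁` misses a ball
  -- about the origin, and the requirement on `g₀` is vacuous.
  by_cases h0 : (0 : Fin n → ℝ) ∈ M₁
  · have h0U : (0 : Fin n → ℝ) ∈ U := by simpa using hMU 0 h0 2 (by norm_num)
    obtain ⟨r, hr, hrU⟩ := Metric.nhds_basis_closedBall.mem_iff.1 (hU.mem_nhds h0U)
    obtain ⟨g₀, hg₀, hgg₀, -⟩ := exists_defining_function_of_isCompact
      (isCompact_closedBall (0 : Fin n → ℝ) r) hU hrU hg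
    exact exists_defining_function_of_local hM₁ hU hg hMU hMg hg₀ hr fun v hv s hs hvs =>
      (hMg v hv s hs).congr (hgg₀ _ (mem_closedBall_zero_iff.2 hvs))
  · obtain ⟨r, hr, hrM⟩ := Metric.nhds_basis_closedBall.mem_iff.1
      (hM₁.isClosed.isOpen_compl.mem_nhds h0)
    refine exists_defining_function_of_local hM₁ hU hg hMU hMg (contDiff_const (c := (0 : ℝ))) hr
      fun v hv s hs hvs => (hrM (mem_closedBall_zero_iff.2 ?_) hv).elim
    rw [norm_smul, Real.norm_of_nonneg (by linarith)] at hvs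
    nlinarith [norm_nonneg v]

end HessianEq

/-! ### Hessians, Taylor expansion and scaling -/

namespace HessianEq

open Filter Topology Asymptotics

variable {n : ℕ}

/-- The symmetric part of a matrix. -/
noncomputable def symPart : (Fin n → Fin n → ℝ) →ₗ[ℝ] SymMat n where
  toFun A := ⟨Matrix.of fun i j => (A i j + A j i) / 2, by
    change (_ : Matrix (Fin n) (Fin n) ℝ).transpose = _
    ext i j
    simp [Matrix.transpose_apply, add_comm]⟩
  map_add' A B := by
    apply Subtype.ext
    ext i j
    simp only [Submodule.coe_add, Matrix.add_apply, Matrix.of_apply, Pi.add_apply]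
    ring
  map_smul' c A := by
    apply Subtype.ext
    ext i j
    simp only [Submodule.coe_smul, Matrix.smul_apply, Matrix.of_apply, Pi.smul_apply, smul_eq_mul,
      RingHom.id_apply]
    ring

theorem hess_eq_symPart (u : E n → ℝ) (x : E n) : hess u x = symPart (secondPartial u x) := rfl

theorem quad_symPart (A : Fin n → Fin n → ℝ) (v : Fin n → ℝ) :
    quad (symPart A) v = ∑ i, ∑ j, v i * v j * A i j := by
  have h1 : quad (symPart A) v = ∑ i, ∑ j, v i * v j * ((A i j + A j i) / 2) := by
    simp only [quad, dotProduct, Matrix.mulVec, Finset.mul_sum]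
    refine Finset.sum_congr rfl fun i _ => Finset.sum_congr rfl fun j _ => ?_
    change v i * ((A i j + A j i) / 2 * v j) = _
    ring
  have h2 : ∑ i, ∑ j, v i * v j * A j i = ∑ i, ∑ j, v i * v j * A i j := by
    rw [Finset.sum_comm]
    exact Finset.sum_congr rfl fun i _ => Finset.sum_congr rfl fun j _ => by ring
  rw [h1]
  have h3 : ∑ i, ∑ j, v i * v j * ((A i j + A j i) / 2) =
      ((∑ i, ∑ j, v i * v j * A i j) + ∑ i, ∑ j, v i * v j * A j i) / 2 := by
    rw [← Finset.sum_add_distrib, Finset.sum_div]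
    refine Finset.sum_congr rfl fun i _ => ?_
    rw [← Finset.sum_add_distrib, Finset.sum_div]
    exact Finset.sum_congr rfl fun j _ => by ring
  rw [h3, h2]
  ring

theorem sum_single_euclidean (v : E n) : v = ∑ i, v i • EuclideanSpace.single i (1 : ℝ) := by
  ext j
  simp [Finset.sum_apply, Pi.single_apply]

theorem quad_hess {u : E n → ℝ} {x : E n} (hu : ContDiffAt ℝ 2 u x) (v : E n) :
    quad (hess u x) v = fderiv ℝ (fderiv ℝ u) x v v := by
  have hd : DifferentiableAt ℝ (fderiv ℝ u) x :=
    (hu.fderiv_right (m := 1) (by norm_num)).differentiableAt one_ne_zero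
  have hsp : ∀ i j, secondPartial u x i j =
      fderiv ℝ (fderiv ℝ u) x (EuclideanSpace.single i 1) (EuclideanSpace.single j 1) := by
    intro i j
    rw [secondPartial]
    have h1 : HasFDerivAt (fun y => fderiv ℝ u y (EuclideanSpace.single j 1)) _ x :=
      hd.hasFDerivAt.clm_apply (hasFDerivAt_const _ x)
    rw [h1.fderiv]
    simp
  rw [hess_eq_symPart, quad_symPart]
  conv_rhs => rw [sum_single_euclidean v]
  simp only [map_sum, _root_.sum_apply, map_smul, _root_.smul_apply, smul_eq_mul, hsp]
  rw [Finset.sum_comm]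
  refine Finset.sum_congr rfl fun i _ => ?_
  rw [Finset.mul_sum]
  refine Finset.sum_congr rfl fun j _ => ?_
  ring

/-- Second-order Taylor expansion along a line. -/
theorem taylor_two {u : E n → ℝ} {x : E n} (hu : ContDiffAt ℝ 2 u x) (v : E n) :
    (fun t : ℝ => u (x + t • v) - u x - t * fderiv ℝ u x v - t ^ 2 / 2 * quad (hess u x) v)
      =o[𝓝 0] fun t => t ^ 2 := by
  rw [quad_hess hu]
  have hd : DifferentiableAt ℝ (fderiv ℝ u) x :=
    (hu.fderiv_right (m := 1) (by norm_num)).differentiableAt one_ne_zero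
  set A := fderiv ℝ (fderiv ℝ u) x v v with hA
  set k : ℝ → ℝ := fun t => u (x + t • v) - u x - t * fderiv ℝ u x v - t ^ 2 / 2 * A with hk
  set k' : ℝ → ℝ := fun t => fderiv ℝ u (x + t • v) v - fderiv ℝ u x v - t * A with hk'
  have hline : ∀ t : ℝ, HasDerivAt (fun t : ℝ => x + t • v) v t := fun t => by
    simpa using ((hasDerivAt_id t).smul_const v).const_add x
  have hcont : Tendsto (fun t : ℝ => x + t • v) (𝓝 0) (𝓝 x) := by
    simpa using (hline 0).continuousAt.tendsto
  have hev : ∀ᶠ t : ℝ in 𝓝 0, HasDerivAt k (k' t) t := by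
    have h1 : ∀ᶠ y in 𝓝 x, DifferentiableAt ℝ u y := by
      filter_upwards [hu.eventually (by simp)] with y hy using hy.differentiableAt two_ne_zero
    filter_upwards [hcont.eventually h1] with t ht
    have h2 : HasDerivAt (fun t : ℝ => u (x + t • v)) (fderiv ℝ u (x + t • v) v) t :=
      ht.hasFDerivAt.comp_hasDerivAt t (hline t)
    have h3 : HasDerivAt (fun t : ℝ => t ^ 2 / 2 * A) (t * A) t := by
      have := (((hasDerivAt_id t).pow 2).div_const 2).mul_const A
      refine this.congr_deriv ?_
      simp
    have h4 : HasDerivAt (fun t : ℝ => t * fderiv ℝ u x v) (fderiv ℝ u x v) t := by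
      simpa using (hasDerivAt_id t).mul_const (fderiv ℝ u x v)
    exact ((h2.sub_const (u x)).sub h4).sub h3
  -- Differentiability of the gradient makes the derivative of the remainder `o(t)`; the mean value
  -- inequality then makes the remainder `o(t²)`.
  have hk'o : k' =o[𝓝 0] fun t : ℝ => t := by
    have h1 : HasDerivAt (fun t : ℝ => fderiv ℝ u (x + t • v) v) A 0 := by
      have h2 : HasFDerivAt (fun y => fderiv ℝ u y v) ((fderiv ℝ (fderiv ℝ u) x).flip v) x := by
        have := hd.hasFDerivAt.clm_apply (hasFDerivAt_const v x)
        refine this.congr_fderiv ?_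
        ext y
        simp
      have h3 := HasFDerivAt.comp_hasDerivAt (f := fun t : ℝ => x + t • v) (0 : ℝ)
        (by simpa using h2) (hline 0)
      exact h3
    have h4 := h1.isLittleO
    simpa [hk', mul_comm] using h4
  rw [isLittleO_iff]
  intro ε hε
  rw [isLittleO_iff] at hk'o
  obtain ⟨δ, hδ, hball⟩ := Metric.eventually_nhds_iff_ball.1 (hev.and (hk'o hε))
  filter_upwards [Metric.ball_mem_nhds 0 hδ] with t ht
  have hsub : ∀ s ∈ Set.uIcc 0 t, s ∈ Metric.ball (0 : ℝ) δ ∧ ‖s‖ ≤ ‖t‖ := by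
    intro s hs
    have : ‖s‖ ≤ ‖t‖ := by
      have := Set.abs_sub_left_of_mem_uIcc hs
      simpa using this
    exact ⟨mem_ball_zero_iff.2 (this.trans_lt (mem_ball_zero_iff.1 ht)), this⟩
  have := Convex.norm_image_sub_le_of_norm_hasDerivWithin_le (f := k) (f' := k') (C := ε * ‖t‖)
    (s := Set.uIcc 0 t) (x := 0) (y := t)
    (fun s hs => (hball s (hsub s hs).1).1.hasDerivWithinAt)
    (fun s hs => ((hball s (hsub s hs).1).2).trans
      (mul_le_mul_of_nonneg_left (hsub s hs).2 hε.le))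
    (convex_uIcc 0 t) Set.left_mem_uIcc Set.right_mem_uIcc
  have h0 : k 0 = 0 := by simp [hk]
  rw [h0, sub_zero, sub_zero] at this
  rw [norm_pow, sq, ← mul_assoc]
  exact this

/-- Adding the inequalities at `t` and `-t` cancels the linear term. -/
theorem second_order_nonpos {p : ℝ → ℝ} {a A : ℝ}
    (h : (fun t => p t - t * a - t ^ 2 / 2 * A) =o[𝓝 0] fun t => t ^ 2)
    (hp : ∀ᶠ t in 𝓝 0, p t ≤ 0) : A ≤ 0 := by
  by_contra! hA
  have hneg : Tendsto (fun t : ℝ => -t) (𝓝 0) (𝓝 0) := by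
    simpa using (continuous_neg (G := ℝ)).tendsto 0
  have h1 := h.def (c := A / 4) (by positivity)
  have h2 := hneg.eventually h1
  have h3 := hneg.eventually hp
  have hall := ((h1.and h2).and (hp.and h3))
  obtain ⟨δ, hδ, hball⟩ := Metric.eventually_nhds_iff_ball.1 hall
  obtain ⟨⟨q1, q2⟩, q3, q4⟩ := hball (δ / 2) (by
    rw [mem_ball_zero_iff, Real.norm_of_nonneg (by positivity)]; linarith)
  have hd2 : 0 < (δ / 2) ^ 2 := by positivity
  rw [Real.norm_eq_abs, Real.norm_of_nonneg (by positivity)] at q1 q2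
  have e1 := (abs_le.1 q1).1
  have e2 := (abs_le.1 q2).1
  rw [neg_sq] at e2
  nlinarith

theorem quad_hess_le_of_isLocalMax {w φ : E n → ℝ} {x : E n} (hw : ContDiffAt ℝ 2 w x)
    (hφ : ContDiffAt ℝ 2 φ x) (h : IsLocalMax (fun y => w y - φ y) x) (v : E n) :
    quad (hess w x) v ≤ quad (hess φ x) v := by
  rw [← sub_nonpos]
  have h1 := (taylor_two hw v).sub (taylor_two hφ v)
  have hcont : Tendsto (fun t : ℝ => x + t • v) (𝓝 0) (𝓝 x) := by
    have : Continuous fun t : ℝ => x + t • v := by fun_prop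
    simpa using this.tendsto 0
  refine second_order_nonpos (p := fun t => (w (x + t • v) - φ (x + t • v)) - (w x - φ x))
    (a := fderiv ℝ w x v - fderiv ℝ φ x v) ?_ ?_
  · refine h1.congr_left fun t => ?_
    ring
  · filter_upwards [hcont.eventually h] with t ht
    linarith

theorem hess_smul_of_eventually {u : E n → ℝ} {x : E n} {t κ : ℝ} (ht : t ≠ 0)
    (h : ∀ᶠ y in 𝓝 x, u (t • y) = κ * u y) : hess u (t • x) = (κ / t ^ 2) • hess u x := by
  have key : ∀ (g : E n → ℝ) (y : E n) (κ : ℝ), (∀ᶠ z in 𝓝 y, g (t • z) = κ * g z) →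
      fderiv ℝ g (t • y) = (κ / t) • fderiv ℝ g y := by
    intro g y κ hg
    have h1 := fderiv_comp_smul (𝕜 := ℝ) (f := g) (x := y) t
    have h2 : (fun z => g (t • z)) =ᶠ[𝓝 y] κ • g := hg
    rw [h2.fderiv_eq, fderiv_const_smul_field, Pi.smul_apply] at h1
    rw [div_eq_inv_mul, mul_smul, h1, smul_smul, inv_mul_cancel₀ ht, one_smul]
  have hsp : secondPartial u (t • x) = (κ / t ^ 2) • secondPartial u x := by
    funext i j
    have h1 : ∀ᶠ y in 𝓝 x, fderiv ℝ u (t • y) (EuclideanSpace.single j 1) =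
        (κ / t) * fderiv ℝ u y (EuclideanSpace.single j 1) := by
      filter_upwards [eventually_eventually_nhds.2 h] with y hy
      rw [key u y κ hy]
      rfl
    simp only [Pi.smul_apply, secondPartial]
    rw [key (fun y => fderiv ℝ u y (EuclideanSpace.single j 1)) x (κ / t) h1, div_div, ← sq]
    rfl
  rw [hess_eq_symPart, hsp, map_smul, hess_eq_symPart]

theorem hess_neg (u : E n → ℝ) (x : E n) : hess (fun y => -u y) x = -hess u x := by
  have hsp : secondPartial (fun y => -u y) x = -secondPartial u x := by
    funext i j
    simp only [secondPartial, Pi.neg_apply]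
    have h1 : (fun y => fderiv ℝ (fun y => -u y) y (EuclideanSpace.single j 1)) =
        fun y => -fderiv ℝ u y (EuclideanSpace.single j 1) := by
      funext y
      rw [fderiv_fun_neg]
      rfl
    rw [h1, fderiv_fun_neg]
    rfl
  rw [hess_eq_symPart, hsp, map_neg, hess_eq_symPart]

theorem isOpen_punctured : IsOpen (unitBall n \ {0}) :=
  Metric.isOpen_ball.sdiff isClosed_singleton

theorem continuousOn_hess {u : E n → ℝ} {Ω : Set (E n)} (hΩ : IsOpen Ω)
    (hu : ContDiffOn ℝ ∞ u Ω) : ContinuousOn (hess u) Ω := by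
  have hs : ContinuousOn (secondPartial u) Ω := by
    refine continuousOn_pi.2 fun i => continuousOn_pi.2 fun j => ?_
    have h1 : ContDiffOn ℝ ∞ (fderiv ℝ u) Ω := hu.fderiv_of_isOpen hΩ (by simp)
    have h2 : ContDiffOn ℝ ∞ (fun y => fderiv ℝ u y (EuclideanSpace.single j 1)) Ω :=
      h1.clm_apply contDiffOn_const
    exact (h2.continuousOn_fderiv_of_isOpen hΩ (by simp)).clm_apply continuousOn_const
  exact (LinearMap.continuous_of_finiteDimensional (symPart (n := n))).comp_continuousOn hs

end HessianEq

/-! ### Odd homogeneous functions as viscosity solutions -/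

namespace HessianEq

open Filter Topology Asymptotics

variable {n : ℕ} {δ : ℝ} {w : E n → ℝ}

/-- Odd functions on the unit ball, homogeneous of degree `2 - δ` and smooth away from `0`. -/
structure OddHomogeneous (δ : ℝ) (w : E n → ℝ) : Prop where
  odd : ∀ x ∈ unitBall n, w (-x) = -w x
  hom : ∀ x ∈ unitBall n, ∀ t : ℝ, 0 < t → t • x ∈ unitBall n → w (t • x) = t ^ (2 - δ) * w x
  smooth : ContDiffOn ℝ ∞ w (unitBall n \ {0})

theorem OddHomogeneous.neg (h : OddHomogeneous δ w) : OddHomogeneous δ fun x => -w x where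
  odd x hx := by rw [h.odd x hx]
  hom x hx t ht htx := by rw [h.hom x hx t ht htx]; ring
  smooth := h.smooth.neg

theorem zero_mem_unitBall : (0 : E n) ∈ unitBall n := Metric.mem_ball_self one_pos

theorem mem_unitBall {x : E n} : x ∈ unitBall n ↔ ‖x‖ < 1 := mem_ball_zero_iff

theorem neg_mem_unitBall {x : E n} (hx : x ∈ unitBall n) : -x ∈ unitBall n := by
  rw [mem_unitBall, norm_neg]; exact mem_unitBall.1 hx

theorem neg_mem_punctured {x : E n} (hx : x ∈ unitBall n \ {0}) : -x ∈ unitBall n \ {0} :=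
  ⟨neg_mem_unitBall hx.1, fun h => hx.2 (by simpa using h)⟩

theorem OddHomogeneous.zero (h : OddHomogeneous δ w) : w 0 = 0 := by
  have := h.odd 0 zero_mem_unitBall
  rw [neg_zero] at this
  linarith

theorem OddHomogeneous.contDiffAt (h : OddHomogeneous δ w) {x : E n} (hx : x ∈ unitBall n \ {0}) :
    ContDiffAt ℝ ∞ w x := h.smooth.contDiffAt (isOpen_punctured.mem_nhds hx)

theorem OddHomogeneous.hess_smul (h : OddHomogeneous δ w) {x : E n} (hx : x ∈ unitBall n) {t : ℝ}
    (ht : 0 < t) (htx : t • x ∈ unitBall n) : hess w (t • x) = t ^ (-δ) • hess w x := by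
  have hcont : Continuous fun y : E n => t • y := continuous_const_smul t
  rw [hess_smul_of_eventually (κ := t ^ (2 - δ)) ht.ne']
  · congr 1
    rw [sub_eq_add_neg, Real.rpow_add ht, Real.rpow_two]
    field_simp
  · filter_upwards [Metric.isOpen_ball.mem_nhds hx,
      hcont.continuousAt.preimage_mem_nhds (Metric.isOpen_ball.mem_nhds htx)] with y hy hy'
    exact h.hom y hy t ht hy'

theorem OddHomogeneous.hess_neg_arg (h : OddHomogeneous δ w) {x : E n} (hx : x ∈ unitBall n) :
    hess w (-x) = -hess w x := by
  have h1 : hess w ((-1 : ℝ) • x) = (-1 / (-1) ^ 2 : ℝ) • hess w x := by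
    refine hess_smul_of_eventually (by norm_num) ?_
    filter_upwards [Metric.isOpen_ball.mem_nhds hx] with y hy
    rw [neg_one_smul, h.odd y hy, neg_one_mul]
  rw [neg_one_smul, show (-1 / (-1) ^ 2 : ℝ) = -1 by norm_num] at h1
  exact h1.trans (neg_one_smul ℝ (hess w x))

/-- The sphere of radius `1/2`. -/
def halfSphere (n : ℕ) : Set (E n) := Metric.sphere 0 (1 / 2)

/-- Radius `1/2` is used because the unit sphere is not in the open ball; by homogeneity this sphere
carries all the information about `w`. -/
theorem halfSphere_subset : halfSphere n ⊆ unitBall n \ {0} := by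
  intro x hx
  have h : ‖x‖ = 1 / 2 := by simpa [halfSphere] using hx
  refine ⟨mem_unitBall.2 (by rw [h]; norm_num), ?_⟩
  rintro rfl
  norm_num at h

theorem isCompact_halfSphere : IsCompact (halfSphere n) := isCompact_sphere _ _

theorem norm_of_mem_halfSphere {x : E n} (hx : x ∈ halfSphere n) : ‖x‖ = 1 / 2 := by
  simpa [halfSphere] using hx

theorem exists_smul_halfSphere {y : E n} (hy : y ≠ 0) :
    (2 * ‖y‖)⁻¹ • y ∈ halfSphere n ∧ y = (2 * ‖y‖) • ((2 * ‖y‖)⁻¹ • y) := by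
  have hy' : 0 < ‖y‖ := norm_pos_iff.2 hy
  constructor
  · have : ‖(2 * ‖y‖)⁻¹ • y‖ = 1 / 2 := by
      rw [norm_smul, Real.norm_of_nonneg (by positivity)]
      field_simp
    simpa [halfSphere] using this
  · rw [smul_smul, mul_inv_cancel₀ (by positivity), one_smul]

theorem halfSphere_nonempty (hn : 0 < n) : (halfSphere n).Nonempty := by
  have : (EuclideanSpace.single ⟨0, hn⟩ 1 : E n) ≠ 0 := by
    intro h
    have := congrFun (congrArg WithLp.ofLp h) ⟨0, hn⟩
    simp at this
  exact ⟨_, (exists_smul_halfSphere this).1⟩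

theorem OddHomogeneous.continuousOn (h : OddHomogeneous δ w) (hδ : δ < 1) :
    ContinuousOn w (unitBall n) := by
  intro x hx
  by_cases hx0 : x = 0
  · subst hx0
    obtain ⟨K, hK⟩ := isCompact_halfSphere.exists_bound_of_continuousOn
      (h.smooth.continuousOn.mono halfSphere_subset)
    have hlim : Tendsto (fun y : E n => (2 * ‖y‖) ^ (2 - δ) * K) (𝓝 0) (𝓝 0) := by
      have h1 : Continuous fun y : E n => (2 * ‖y‖) ^ (2 - δ) * K :=
        (Continuous.rpow_const (by fun_prop) fun y => Or.inr (by linarith)).mul continuous_const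
      have h2 := h1.tendsto 0
      rwa [norm_zero, mul_zero, Real.zero_rpow (by linarith), zero_mul] at h2
    refine ContinuousAt.continuousWithinAt ?_
    rw [ContinuousAt, h.zero]
    refine squeeze_zero_norm' ?_ hlim
    filter_upwards [Metric.isOpen_ball.mem_nhds hx] with y hy
    by_cases hy0 : y = 0
    · rw [hy0, h.zero, norm_zero, norm_zero, mul_zero, Real.zero_rpow (by linarith), zero_mul]
    · obtain ⟨h1, h2⟩ := exists_smul_halfSphere hy0
      have h3 : 0 < 2 * ‖y‖ := by have := norm_pos_iff.2 hy0; positivity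
      have h4 := h.hom _ (halfSphere_subset h1).1 _ h3 (by rw [← h2]; exact hy)
      rw [← h2] at h4
      rw [h4, norm_mul, Real.norm_of_nonneg (Real.rpow_nonneg h3.le _)]
      exact mul_le_mul_of_nonneg_left (hK _ h1) (Real.rpow_nonneg h3.le _)
  · exact (h.contDiffAt ⟨hx, hx0⟩).continuousAt.continuousWithinAt

/-- A function touching `w` from above at the origin is stationary there. -/
theorem OddHomogeneous.touching_above (h : OddHomogeneous δ w) (hδ0 : 0 ≤ δ) (hδ1 : δ < 1)
    {φ : E n → ℝ} (hφ : ContDiffAt ℝ 2 φ 0) (hmax : IsLocalMax (fun y => w y - φ y) 0)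
    {x : E n} (hx : x ∈ unitBall n) :
    (0 < δ → w x ≤ 0) ∧ (δ = 0 → w x ≤ quad (hess φ 0) x / 2) := by
  have hT : ∀ v : E n, (fun t : ℝ => φ (t • v) - φ 0 - t * fderiv ℝ φ 0 v -
      t ^ 2 / 2 * quad (hess φ 0) v) =o[𝓝[>] 0] fun t => t ^ 2 := fun v => by
    have := (taylor_two hφ v).mono (nhdsWithin_le_nhds (s := Set.Ioi 0))
    simpa using this
  have hle : ∀ v ∈ unitBall n, ∀ᶠ t : ℝ in 𝓝[>] 0, t ^ (2 - δ) * w v ≤ φ (t • v) - φ 0 := by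
    intro v hv
    have hcont : Tendsto (fun t : ℝ => t • v) (𝓝[>] 0) (𝓝 0) := by
      have : Continuous fun t : ℝ => t • v := by fun_prop
      have h1 := this.tendsto 0
      rw [zero_smul] at h1
      exact h1.mono_left nhdsWithin_le_nhds
    filter_upwards [hcont.eventually hmax, self_mem_nhdsWithin,
      hcont.eventually (Metric.isOpen_ball.mem_nhds zero_mem_unitBall)] with t ht ht0 htb
    rw [h.hom v hv t ht0 htb, h.zero] at ht
    linarith
  have hrem : ∀ v : E n, Tendsto (fun t : ℝ => (φ (t • v) - φ 0 - t * fderiv ℝ φ 0 v -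
      t ^ 2 / 2 * quad (hess φ 0) v) / t ^ 2) (𝓝[>] 0) (𝓝 0) := fun v =>
    (hT v).tendsto_div_nhds_zero
  have hpow : ∀ a : ℝ, 0 < a → Tendsto (fun t : ℝ => t ^ a) (𝓝[>] 0) (𝓝 0) := by
    intro a ha
    have h1 := (Real.continuous_rpow_const ha.le).tendsto 0
    rw [Real.zero_rpow ha.ne'] at h1
    exact h1.mono_left nhdsWithin_le_nhds
  have hid : Tendsto (fun t : ℝ => t) (𝓝[>] 0) (𝓝 0) := tendsto_id.mono_left nhdsWithin_le_nhds
  -- Dividing by `t` leaves `t^(1-δ) w(v)` on the left, which tends to zero since `δ < 1`. The same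
  -- bound for `-v` then forces the gradient to vanish.
  have hgrad : ∀ v ∈ unitBall n, 0 ≤ fderiv ℝ φ 0 v := by
    intro v hv
    have hL : Tendsto (fun t : ℝ => t ^ (1 - δ) * w v) (𝓝[>] 0) (𝓝 0) := by
      simpa using (hpow (1 - δ) (by linarith)).mul_const (w v)
    have hR : Tendsto (fun t : ℝ => fderiv ℝ φ 0 v + t * (quad (hess φ 0) v / 2) +
        t * ((φ (t • v) - φ 0 - t * fderiv ℝ φ 0 v - t ^ 2 / 2 * quad (hess φ 0) v) / t ^ 2))
        (𝓝[>] 0) (𝓝 (fderiv ℝ φ 0 v)) := by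
      have := (tendsto_const_nhds (x := fderiv ℝ φ 0 v)).add
        (hid.mul_const (quad (hess φ 0) v / 2)) |>.add (hid.mul (hrem v))
      simpa using this
    refine le_of_tendsto_of_tendsto hL hR ?_
    filter_upwards [hle v hv, self_mem_nhdsWithin] with t ht ht0
    have ht0' : (0 : ℝ) < t := ht0
    have e1 : t ^ (2 - δ) = t * t ^ (1 - δ) := by
      rw [show 2 - δ = 1 + (1 - δ) by ring, Real.rpow_add ht0', Real.rpow_one]
    rw [e1, mul_assoc] at ht
    refine le_of_mul_le_mul_left (ht.trans_eq ?_) ht0'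
    field_simp
    ring
  have hg0 : fderiv ℝ φ 0 x = 0 := by
    have h1 := hgrad x hx
    have h2 := hgrad (-x) (neg_mem_unitBall hx)
    rw [map_neg] at h2
    linarith
  have hR : Tendsto (fun t : ℝ => quad (hess φ 0) x / 2 +
      (φ (t • x) - φ 0 - t * fderiv ℝ φ 0 x - t ^ 2 / 2 * quad (hess φ 0) x) / t ^ 2)
      (𝓝[>] 0) (𝓝 (quad (hess φ 0) x / 2)) := by
    simpa using (tendsto_const_nhds (x := quad (hess φ 0) x / 2)).add (hrem x)
  -- Division by `t^(2-δ)`; the factor `t^δ` tends to zero for `δ > 0` and is `1` for `δ = 0`,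
  -- whence the two conclusions.
  have hev : ∀ᶠ t : ℝ in 𝓝[>] 0, w x ≤ t ^ δ * (quad (hess φ 0) x / 2 +
      (φ (t • x) - φ 0 - t * fderiv ℝ φ 0 x - t ^ 2 / 2 * quad (hess φ 0) x) / t ^ 2) := by
    filter_upwards [hle x hx, self_mem_nhdsWithin] with t ht ht0
    have ht0' : (0 : ℝ) < t := ht0
    have hp : 0 < t ^ (2 - δ) := Real.rpow_pos_of_pos ht0' _
    refine le_of_mul_le_mul_left (ht.trans_eq ?_) hp
    rw [← mul_assoc, ← Real.rpow_add ht0', sub_add_cancel, Real.rpow_two, hg0]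
    field_simp
    ring
  constructor
  · intro hδ
    have hlim := (hpow δ hδ).mul hR
    rw [zero_mul] at hlim
    exact ge_of_tendsto hlim hev
  · rintro rfl
    refine ge_of_tendsto hR ?_
    simpa using hev

theorem quad_line (S : SymMat n) (x v : E n) (t : ℝ) :
    quad S (x + t • v : E n) = quad S x +
      t * ((x : Fin n → ℝ) ⬝ᵥ (S : Matrix (Fin n) (Fin n) ℝ).mulVec v +
        (v : Fin n → ℝ) ⬝ᵥ (S : Matrix (Fin n) (Fin n) ℝ).mulVec x) + t ^ 2 * quad S v := by
  simp only [quad, WithLp.ofLp_add, WithLp.ofLp_smul, Matrix.mulVec_add, Matrix.mulVec_smul,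
    dotProduct_add, add_dotProduct, smul_dotProduct, dotProduct_smul, smul_eq_mul]
  ring

theorem quad_smul_arg (S : SymMat n) (x : E n) (t : ℝ) :
    quad S (t • x : E n) = t ^ 2 * quad S x := by
  simp only [quad, WithLp.ofLp_smul, Matrix.mulVec_smul, dotProduct_smul, smul_dotProduct,
    smul_eq_mul]
  ring

theorem continuous_quad (S : SymMat n) : Continuous fun x : E n => quad S x := by
  have h1 : Continuous fun x : E n => (x : Fin n → ℝ) := PiLp.continuous_ofLp 2 _
  have h2 : Continuous fun x : Fin n → ℝ => quad S x := by
    unfold quad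
    fun_prop
  exact h2.comp h1

theorem dotProduct_self_eq_norm_sq (x : E n) : (x : Fin n → ℝ) ⬝ᵥ (x : Fin n → ℝ) = ‖x‖ ^ 2 := by
  rw [EuclideanSpace.real_norm_sq_eq, dotProduct]
  exact Finset.sum_congr rfl fun i _ => (sq _).symm

/-- A paraboloid above a function homogeneous of degree two can be lowered until it touches it. -/
theorem OddHomogeneous.exists_hess_le (h : OddHomogeneous 0 w) (hn : 0 < n) {S : SymMat n}
    (hS : ∀ x ∈ unitBall n, w x ≤ quad S x / 2) :
    ∃ x ∈ unitBall n \ {0}, ∀ v : E n, quad (hess w x) v ≤ quad S v := by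
  obtain ⟨x₀, hx₀, hmin⟩ := isCompact_halfSphere.exists_isMinOn (halfSphere_nonempty hn)
    (f := fun x : E n => quad S x / 2 - w x)
    (((continuous_quad S).div_const 2).continuousOn.sub
      (h.smooth.continuousOn.mono halfSphere_subset))
  set m := quad S x₀ / 2 - w x₀ with hm
  have hx₀' := halfSphere_subset hx₀
  have hm0 : 0 ≤ m := sub_nonneg.2 (hS x₀ hx₀'.1)
  -- On the sphere of radius `1/2` one has `‖x‖² / 2 = 1/8`, so this lowers the paraboloid there by
  -- exactly `m`, the least gap.
  set T : SymMat n := S - (8 * m) • oneS n with hT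
  have hTq : ∀ x : E n, quad T x = quad S x - 8 * m * ‖x‖ ^ 2 := fun x => by
    rw [hT, quad_sub, quad_smul, quad_one, dotProduct_self_eq_norm_sq]
  have hTs : ∀ x ∈ halfSphere n, w x ≤ quad T x / 2 := by
    intro x hx
    have h1 : m ≤ quad S x / 2 - w x := hmin hx
    rw [hTq, norm_of_mem_halfSphere hx]
    linarith
  have hTx₀ : w x₀ = quad T x₀ / 2 := by
    rw [hTq, norm_of_mem_halfSphere hx₀, hm]
    ring
  have hTb : ∀ y ∈ unitBall n \ {0}, w y ≤ quad T y / 2 := by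
    intro y hy
    obtain ⟨h1, h2⟩ := exists_smul_halfSphere hy.2
    have h3 : 0 < 2 * ‖y‖ := by have := norm_pos_iff.2 hy.2; positivity
    have h4 := h.hom _ (halfSphere_subset h1).1 _ h3 (by rw [← h2]; exact hy.1)
    have h5 := quad_smul_arg T ((2 * ‖y‖)⁻¹ • y) (2 * ‖y‖)
    rw [← h2] at h4 h5
    rw [h4, h5, sub_zero, Real.rpow_two, mul_div_assoc]
    exact mul_le_mul_of_nonneg_left (hTs _ h1) (by positivity)
  refine ⟨x₀, hx₀', fun v => ?_⟩
  have hle : quad (hess w x₀) v - quad T v ≤ 0 := by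
    have h1 := taylor_two ((h.contDiffAt hx₀').of_le (ENat.LEInfty.out)) v
    have hcont : Tendsto (fun t : ℝ => x₀ + t • v) (𝓝 0) (𝓝 x₀) := by
      have : Continuous fun t : ℝ => x₀ + t • v := by fun_prop
      simpa using this.tendsto 0
    refine second_order_nonpos (p := fun t => w (x₀ + t • v) - quad T (x₀ + t • v : E n) / 2)
      (a := fderiv ℝ w x₀ v - ((x₀ : Fin n → ℝ) ⬝ᵥ (T : Matrix (Fin n) (Fin n) ℝ).mulVec v +
        (v : Fin n → ℝ) ⬝ᵥ (T : Matrix (Fin n) (Fin n) ℝ).mulVec x₀) / 2) ?_ ?_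
    · refine h1.congr_left fun t => ?_
      rw [quad_line, hTx₀]
      ring
    · filter_upwards [hcont.eventually (isOpen_punctured.mem_nhds hx₀')] with t ht
      linarith [hTb _ ht]
  have h2 := hTq v
  nlinarith [sq_nonneg ‖v‖, mul_nonneg hm0 (sq_nonneg ‖v‖)]

/-- Away from the origin Hessians are compared at the contact point. At the origin, `δ = 0`
transfers the comparison to a contact point elsewhere, and for `δ > 0` a positive value of `w`
excludes every test function from above. -/
theorem OddHomogeneous.subsolution (h : OddHomogeneous δ w) (hδ0 : 0 ≤ δ) (hδ1 : δ < 1)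
    (hn : 0 < n) (hsign : 0 < δ → ∃ x ∈ unitBall n, 0 < w x) {F : SymMat n → ℝ}
    (hF : ∀ S T : SymMat n, (∀ x, quad S x ≤ quad T x) → F S ≤ F T)
    (hF0 : ∀ x ∈ unitBall n \ {0}, 0 ≤ F (hess w x)) {x : E n} (hx : x ∈ unitBall n)
    {φ : E n → ℝ} (hφ : ContDiffAt ℝ 2 φ x) (hmax : IsLocalMax (fun y => w y - φ y) x) :
    0 ≤ F (hess φ x) := by
  have hquad : ∀ S T : SymMat n, (∀ v : E n, quad S v ≤ quad T v) → F S ≤ F T := fun S T hST =>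
    hF S T fun v => hST (WithLp.toLp 2 v)
  by_cases hx0 : x = 0
  · subst hx0
    rcases hδ0.eq_or_lt with hδ | hδ
    · subst hδ
      obtain ⟨y, hy, hle⟩ := h.exists_hess_le hn fun y hy =>
        (h.touching_above hδ0 hδ1 hφ hmax hy).2 rfl
      exact (hF0 y hy).trans (hquad _ _ hle)
    · obtain ⟨y, hy, hwy⟩ := hsign hδ
      exact absurd ((h.touching_above hδ0 hδ1 hφ hmax hy).1 hδ) (not_le.2 hwy)
  · exact (hF0 x ⟨hx, hx0⟩).trans (hquad _ _ fun v => quad_hess_le_of_isLocalMax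
      ((h.contDiffAt ⟨hx, hx0⟩).of_le (ENat.LEInfty.out)) hφ hmax v)

/-- An odd homogeneous function that solves a degenerate elliptic equation classically away from
the origin is a viscosity solution. -/
theorem OddHomogeneous.isViscositySolution (h : OddHomogeneous δ w) (hδ0 : 0 ≤ δ) (hδ1 : δ < 1)
    (hn : 0 < n)
    (hsign : 0 < δ → (∃ x ∈ unitBall n, 0 < w x) ∧ ∃ y ∈ unitBall n, w y < 0)
    {F : SymMat n → ℝ} (hF : ∀ S T : SymMat n, (∀ x, quad S x ≤ quad T x) → F S ≤ F T)
    (hF0 : ∀ x ∈ unitBall n \ {0}, F (hess w x) = 0) :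
    IsViscositySolution F w (unitBall n) := by
  refine ⟨h.continuousOn hδ1, fun x hx φ hφ hmax => h.subsolution hδ0 hδ1 hn
    (fun hδ => (hsign hδ).1) hF (fun y hy => (hF0 y hy).ge) hx hφ hmax, fun x hx φ hφ hmin => ?_⟩
  -- The supersolution property of `w` is the subsolution property of `-w` for the dual operator.
  have h1 := h.neg.subsolution (F := fun S => -F (-S)) hδ0 hδ1 hn
    (fun hδ => by
      obtain ⟨y, hy, hwy⟩ := (hsign hδ).2
      exact ⟨y, hy, by linarith⟩)
    (fun S T hST => neg_le_neg (hF _ _ fun v => by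
      rw [quad_neg, quad_neg]
      exact neg_le_neg (hST v)))
    (fun y hy => by rw [hess_neg, neg_neg, hF0 y hy, neg_zero]) hx hφ.neg
    (φ := fun y => -φ y) (by
      have := hmin.neg
      refine this.congr ?_
      exact Filter.Eventually.of_forall fun y => by ring)
  rw [hess_neg, neg_neg] at h1
  linarith

end HessianEq

/-! ### The set of Hessian eigenvalues and assertion (i) -/

namespace HessianEq

open Filter Topology

variable {n : ℕ} {δ : ℝ} {w : E n → ℝ}

/-- The Hessians of `w`, rotated arbitrarily, have differences that are zero or have positive and
negative parts of comparable size. -/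
def HypHess (C : ℝ) (w : E n → ℝ) : Prop :=
  ∀ a ∈ unitBall n \ {0}, ∀ b ∈ unitBall n \ {0}, ∀ O : Matrix.orthogonalGroup (Fin n) ℝ,
    hess w a - conj O (hess w b) = 0 ∨
      (1 / C ≤ -(minEig (hess w a - conj O (hess w b)) / maxEig (hess w a - conj O (hess w b))) ∧
        -(minEig (hess w a - conj O (hess w b)) / maxEig (hess w a - conj O (hess w b))) ≤ C)

/-- The rotation `Q⁻¹ * P` puts both Hessians in one eigenbasis with the eigenvalues in the
prescribed orders, so the eigenvalues of the matrix difference are the coordinate differences. -/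
theorem HypHess.hypDiff {C : ℝ} (h : HypHess C w) : HypDiff C (eigImage w) := by
  rintro _ ⟨a, ha, σ, rfl⟩ _ ⟨b, hb, τ, rfl⟩
  obtain ⟨P, hP⟩ := exists_conj_diagS (hess w a) σ
  obtain ⟨Q, hQ⟩ := exists_conj_diagS (hess w b) τ
  have key : hess w a - conj (Q⁻¹ * P) (hess w b) =
      conj P (diagS (ordEig (hess w a) ∘ σ - ordEig (hess w b) ∘ τ)) := by
    have h1 : conj (Q⁻¹ * P) (hess w b) = conj P (diagS (ordEig (hess w b) ∘ τ)) := by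
      rw [conj_mul]
      congr 1
      nth_rewrite 1 [hQ]
      rw [← conj_mul, mul_inv_cancel, conj_one]
    rw [h1, conj_diagS_sub, ← hP]
  have h2 := h a ha b hb (Q⁻¹ * P)
  rwa [key, conj_eq_zero_iff, minEig_conj_diagS, maxEig_conj_diagS] at h2

theorem ordEig_mem_eigImage {x : E n} (hx : x ∈ unitBall n \ {0}) :
    ordEig (hess w x) ∈ eigImage w := ⟨x, hx, 1, rfl⟩

theorem comp_mem_eigImage {v : Fin n → ℝ} (hv : v ∈ eigImage w) (σ : Equiv.Perm (Fin n)) :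
    v ∘ σ ∈ eigImage w := by
  obtain ⟨x, hx, τ, rfl⟩ := hv
  exact ⟨x, hx, σ.trans τ, rfl⟩

theorem eigImage_nonempty (hn : 0 < n) : (eigImage w).Nonempty := by
  obtain ⟨x, hx⟩ := halfSphere_nonempty hn
  exact ⟨_, ordEig_mem_eigImage (halfSphere_subset hx)⟩

/-- The permuted Hessian eigenvalues over the sphere of radius `1/2`. -/
def eigSphere (w : E n → ℝ) : Set (Fin n → ℝ) :=
  ⋃ σ : Equiv.Perm (Fin n), (fun x => ordEig (hess w x) ∘ σ) '' halfSphere n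

theorem OddHomogeneous.isCompact_eigSphere (h : OddHomogeneous δ w) :
    IsCompact (eigSphere w) := by
  refine isCompact_iUnion fun σ => isCompact_halfSphere.image_of_continuousOn ?_
  have h1 : ContinuousOn (hess w) (halfSphere n) :=
    (continuousOn_hess isOpen_punctured h.smooth).mono halfSphere_subset
  have h2 : Continuous fun v : Fin n → ℝ => v ∘ σ := by fun_prop
  exact (h2.comp continuous_ordEig).comp_continuousOn h1

theorem OddHomogeneous.eigImage_eq (h : OddHomogeneous 0 w) : eigImage w = eigSphere w := by
  ext v
  simp only [eigSphere, Set.mem_iUnion, Set.mem_image]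
  constructor
  · rintro ⟨y, hy, σ, rfl⟩
    obtain ⟨h1, h2⟩ := exists_smul_halfSphere hy.2
    have h3 : 0 < 2 * ‖y‖ := by have := norm_pos_iff.2 hy.2; positivity
    refine ⟨σ, _, h1, ?_⟩
    have h4 := h.hess_smul (halfSphere_subset h1).1 h3 (by rw [← h2]; exact hy.1)
    rw [← h2, neg_zero, Real.rpow_zero, one_smul ℝ (hess w _)] at h4
    rw [h4]
  · rintro ⟨σ, x, hx, rfl⟩
    exact ⟨x, halfSphere_subset hx, σ, rfl⟩

/-- The Hessian at `y` is `‖y‖^(-δ)` times its value extrapolated to the unit sphere, and `‖y‖^(-δ)`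
runs through all numbers above `1`. The factor `2^(-δ)` passes from radius `1/2` to radius `1`. -/
theorem OddHomogeneous.mem_eigImage_iff (h : OddHomogeneous δ w) (hδ : 0 < δ) {v : Fin n → ℝ} :
    v ∈ eigImage w ↔ ∃ u ∈ (fun u => (2 : ℝ) ^ (-δ) • u) '' eigSphere w,
      ∃ s : ℝ, 1 < s ∧ v = s • u := by
  simp only [eigSphere, Set.mem_image, Set.mem_iUnion]
  have hcomp : ∀ (c : ℝ) (u : Fin n → ℝ) (σ : Equiv.Perm (Fin n)), (c • u) ∘ σ = c • (u ∘ σ) :=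
    fun _ _ _ => rfl
  constructor
  · rintro ⟨y, hy, σ, rfl⟩
    obtain ⟨h1, h2⟩ := exists_smul_halfSphere hy.2
    have hy0 : 0 < ‖y‖ := norm_pos_iff.2 hy.2
    have hy1 : ‖y‖ < 1 := mem_unitBall.1 hy.1
    have h3 : 0 < 2 * ‖y‖ := by positivity
    refine ⟨_, ⟨_, ⟨σ, _, h1, rfl⟩, rfl⟩, ‖y‖ ^ (-δ),
      Real.one_lt_rpow_of_pos_of_lt_one_of_neg hy0 hy1 (by linarith), ?_⟩
    have h4 := h.hess_smul (halfSphere_subset h1).1 h3 (by rw [← h2]; exact hy.1)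
    rw [← h2] at h4
    rw [h4, ordEig_smul (by positivity), hcomp, smul_smul, Real.mul_rpow two_pos.le hy0.le,
      mul_comm]
  · rintro ⟨_, ⟨_, ⟨σ, x, hx, rfl⟩, rfl⟩, s, hs, rfl⟩
    have hs0 : 0 < s := one_pos.trans hs
    set r := s ^ (-δ⁻¹) with hr
    have hr0 : 0 < r := by positivity
    have hr1 : r < 1 := Real.rpow_lt_one_of_one_lt_of_neg hs (by simpa using hδ)
    have hrs : r ^ (-δ) = s := by
      rw [hr, ← Real.rpow_mul hs0.le, neg_mul_neg, inv_mul_cancel₀ hδ.ne', Real.rpow_one]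
    have hnorm : ‖(2 * r) • x‖ = r := by
      rw [norm_smul, norm_of_mem_halfSphere hx, Real.norm_of_nonneg (by positivity)]
      ring
    have hmem : (2 * r) • x ∈ unitBall n := mem_unitBall.2 (by rw [hnorm]; exact hr1)
    refine ⟨(2 * r) • x, ⟨hmem, fun h0 => ?_⟩, σ, ?_⟩
    · rw [Set.mem_singleton_iff.1 h0, norm_zero] at hnorm
      exact hr0.ne hnorm
    · rw [h.hess_smul (halfSphere_subset hx).1 (by positivity) hmem, ordEig_smul (by positivity),
        hcomp, smul_smul, Real.mul_rpow two_pos.le hr0.le, hrs, mul_comm]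

/-- A global defining function of the set of Hessian eigenvalues, with radially constant
derivative near infinity. -/
theorem OddHomogeneous.exists_defining_function (h : OddHomogeneous δ w) (hδ0 : 0 ≤ δ)
    {U : Set (Fin n → ℝ)} (hU : IsOpen U) (hMU : eigImage w ⊆ U) {g : (Fin n → ℝ) → ℝ}
    (hg : ContDiffOn ℝ ∞ g U) (hg0 : ∀ v ∈ eigImage w, g v = 0) {c : ℝ}
    (hc : ∀ v ∈ eigImage w, ∀ i, c ≤ fderiv ℝ g v (Pi.single i 1)) :
    ∃ G : (Fin n → ℝ) → ℝ, ContDiff ℝ ∞ G ∧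
      (∀ v ∈ eigImage w, G v = 0 ∧ ∀ i, c ≤ fderiv ℝ G v (Pi.single i 1)) ∧
      ∃ ρ > 0, ∀ x, ρ ≤ ‖x‖ → ∀ s : ℝ, 1 ≤ s → fderiv ℝ G (s • x) = fderiv ℝ G x := by
  rcases hδ0.eq_or_lt with hδ | hδ
  · subst hδ
    obtain ⟨G, hG, hGg, hGr⟩ := exists_defining_function_of_isCompact
      (h.eigImage_eq ▸ h.isCompact_eigSphere) hU hMU hg
    refine ⟨G, hG, fun v hv => ?_, hGr⟩
    rw [(hGg v hv).fderiv_eq, (hGg v hv).eq_of_nhds]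
    exact ⟨hg0 v hv, hc v hv⟩
  · have hmem : ∀ u ∈ (fun u => (2 : ℝ) ^ (-δ) • u) '' eigSphere w, ∀ s : ℝ, 1 < s →
        s • u ∈ eigImage w := fun u hu s hs => (h.mem_eigImage_iff hδ).2 ⟨u, hu, s, hs, rfl⟩
    obtain ⟨G, hG, hGg, hGr⟩ := exists_defining_function_of_cone
      (h.isCompact_eigSphere.image (continuous_const_smul ((2 : ℝ) ^ (-δ)))) hU hg
      (fun u hu s hs => hMU (hmem u hu s hs)) (fun u hu s hs => hg0 _ (hmem u hu s hs))
      (fun u hu s hs => hc _ (hmem u hu s hs))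
    refine ⟨G, hG, fun v hv => ?_, hGr⟩
    obtain ⟨u, hu, s, hs, rfl⟩ := (h.mem_eigImage_iff hδ).1 hv
    exact hGg u hu s hs

theorem UniformlyElliptic.monotone {F : SymMat n → ℝ} (hF : UniformlyElliptic F) {S T : SymMat n}
    (hST : ∀ x, quad S x ≤ quad T x) : F S ≤ F T := by
  obtain ⟨C, hC, h⟩ := hF
  have h1 := (h S (T - S) (posSemidef_of_quad_nonneg fun x => by
    rw [quad_sub]; linarith [hST x])).1
  rw [add_sub_cancel] at h1
  have : 0 ≤ C⁻¹ * ‖T - S‖ := by positivity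
  linarith

theorem OddHomogeneous.exists_hessian_equation (h : OddHomogeneous δ w) (hδ0 : 0 ≤ δ)
    (hδ1 : δ < 1) (hn : 0 < n)
    (hsign : 0 < δ → (∃ x ∈ unitBall n, 0 < w x) ∧ ∃ y ∈ unitBall n, w y < 0)
    {U : Set (Fin n → ℝ)} (hU : IsOpen U) (hMU : eigImage w ⊆ U) {g : (Fin n → ℝ) → ℝ}
    (hg : ContDiffOn ℝ ∞ g U) (hg0 : ∀ v ∈ eigImage w, g v = 0) {c : ℝ} (hc0 : 0 < c)
    (hc : ∀ v ∈ eigImage w, ∀ i, c ≤ fderiv ℝ g v (Pi.single i 1)) {C : ℝ} (hC : 0 < C)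
    (hyp : HypHess C w) :
    ∃ F : SymMat n → ℝ, IsHessianOperator F ∧ SmoothOperator F ∧ UniformlyElliptic F ∧
      IsViscositySolution F w (unitBall n) := by
  obtain ⟨G, hG, hGM, ρ, hρ, hGr⟩ := h.exists_defining_function hδ0 hU hMU hg hg0 hc
  obtain ⟨hu, K, hK⟩ := uniform_fderiv_of_radial hG hρ hGr
  obtain ⟨F, hF1, hF2, hF3, hF4⟩ := exists_operator (eigImage_nonempty hn)
    (fun v hv σ => comp_mem_eigImage hv σ) hC hyp.hypDiff hG hu hK (fun v hv => (hGM v hv).1) hc0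
    (fun v hv => (hGM v hv).2)
  exact ⟨F, hF1, hF2, hF3, h.isViscositySolution hδ0 hδ1 hn hsign
    (fun S T hST => hF3.monotone hST) fun x hx => hF4 _ (ordEig_mem_eigImage hx)⟩

end HessianEq

/-! ### Elliptic matrices and sup-inf operators -/

namespace HessianEq

open Filter Topology Matrix

variable {n : ℕ} {δ : ℝ} {w : E n → ℝ}

/-- The trace pairing `∑ Lᵢⱼ Sᵢⱼ` of symmetric matrices. -/
noncomputable def pair : SymMat n →ₗ[ℝ] SymMat n →ₗ[ℝ] ℝ :=
  LinearMap.mk₂ ℝ (fun L S => ∑ i, ∑ j, (L : Matrix (Fin n) (Fin n) ℝ) i j *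
      (S : Matrix (Fin n) (Fin n) ℝ) i j)
    (fun L L' S => by simp [add_mul, Finset.sum_add_distrib])
    (fun c L S => by simp [mul_assoc, Finset.mul_sum])
    (fun L S S' => by simp [mul_add, Finset.sum_add_distrib])
    (fun c L S => by simp [mul_left_comm, Finset.mul_sum])

theorem pair_apply (L S : SymMat n) : pair L S = ∑ i, ∑ j,
    (L : Matrix (Fin n) (Fin n) ℝ) i j * (S : Matrix (Fin n) (Fin n) ℝ) i j := rfl

/-- The trace computed in the orthonormal eigenbasis given by the rows of `P`. -/
theorem pair_conj_diagS (L : SymMat n) (P : Matrix.orthogonalGroup (Fin n) ℝ) (v : Fin n → ℝ) :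
    pair L (conj P (diagS v)) =
      ∑ k, v k * quad L ((P : Matrix (Fin n) (Fin n) ℝ) k) := by
  have h : ∀ i j, (conj P (diagS v) : Matrix (Fin n) (Fin n) ℝ) i j =
      ∑ k, (P : Matrix (Fin n) (Fin n) ℝ) k i * v k * (P : Matrix (Fin n) (Fin n) ℝ) k j :=
    fun i j => by
      rw [coe_conj, mul_apply]
      exact Finset.sum_congr rfl fun k _ => by rw [diagS, mul_diagonal, transpose_apply]
  simp only [pair_apply, quad, dotProduct, mulVec, h, Finset.mul_sum]
  rw [Finset.sum_congr rfl fun i _ => Finset.sum_comm, Finset.sum_comm]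
  refine Finset.sum_congr rfl fun k _ => Finset.sum_congr rfl fun i _ =>
    Finset.sum_congr rfl fun j _ => by ring

theorem mulVec_row (P : Matrix.orthogonalGroup (Fin n) ℝ) (k : Fin n) :
    (P : Matrix (Fin n) (Fin n) ℝ) *ᵥ (P : Matrix (Fin n) (Fin n) ℝ) k = Pi.single k 1 := by
  ext i
  have h := congrFun (congrFun (orth_mul_transpose P) i) k
  rw [mul_apply] at h
  rw [Pi.single_apply, ← one_apply, ← h]
  rfl

theorem quad_conj_diagS_row (P : Matrix.orthogonalGroup (Fin n) ℝ) (v : Fin n → ℝ) (k : Fin n) :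
    quad (conj P (diagS v)) ((P : Matrix (Fin n) (Fin n) ℝ) k) = v k := by
  rw [quad_conj, mulVec_row, quad_diagS, Finset.sum_eq_single k] <;> simp +contextual

theorem row_dot_self (P : Matrix.orthogonalGroup (Fin n) ℝ) (k : Fin n) :
    (P : Matrix (Fin n) (Fin n) ℝ) k ⬝ᵥ (P : Matrix (Fin n) (Fin n) ℝ) k = 1 := by
  rw [← orth_dot P, mulVec_row, Finset.sum_eq_single k] <;> simp +contextual

/-- Symmetric matrices with eigenvalues in `[1, Λ]`. -/
def ellipticSet (n : ℕ) (Λ : ℝ) : Set (SymMat n) :=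
  {L | ∀ x, x ⬝ᵥ x ≤ quad L x ∧ quad L x ≤ Λ * (x ⬝ᵥ x)}

theorem dot_self_nonneg (x : Fin n → ℝ) : 0 ≤ x ⬝ᵥ x :=
  Finset.sum_nonneg fun i _ => mul_self_nonneg (x i)

theorem abs_pair_le {Λ : ℝ} {L : SymMat n} (hL : L ∈ ellipticSet n Λ) (S : SymMat n) :
    |pair L S| ≤ n * Λ * ‖S‖ := by
  obtain ⟨P, hP⟩ := exists_conj_diagS_ordEig S
  conv_lhs => rw [hP, pair_conj_diagS]
  refine (Finset.abs_sum_le_sum_abs _ _).trans ((Finset.sum_le_card_nsmul _ _ (‖S‖ * Λ)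
    fun k _ => ?_).trans_eq ?_)
  · have h := hL ((P : Matrix (Fin n) (Fin n) ℝ) k)
    rw [row_dot_self, mul_one] at h
    rw [abs_mul, abs_of_nonneg (zero_le_one.trans h.1)]
    exact mul_le_mul (abs_ordEig_le S k) h.2 (zero_le_one.trans h.1) (norm_nonneg S)
  · rw [Finset.card_univ, Fintype.card_fin, nsmul_eq_mul]
    ring

theorem pair_mono {Λ : ℝ} {L : SymMat n} (hL : L ∈ ellipticSet n Λ) {S T : SymMat n}
    (hST : ∀ x, quad S x ≤ quad T x) : pair L S ≤ pair L T := by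
  rw [← sub_nonneg, ← map_sub]
  obtain ⟨P, hP⟩ := exists_conj_diagS_ordEig (T - S)
  rw [hP, pair_conj_diagS]
  refine Finset.sum_nonneg fun k _ => mul_nonneg ?_ ((dot_self_nonneg _).trans (hL _).1)
  rw [← quad_conj_diagS_row P (ordEig (T - S)) k, ← hP, quad_sub]
  linarith [hST ((P : Matrix (Fin n) (Fin n) ℝ) k)]

theorem oneS_mem_ellipticSet {Λ : ℝ} (hΛ : 1 ≤ Λ) : oneS n ∈ ellipticSet n Λ := fun x => by
  rw [quad_one]
  exact ⟨le_rfl, le_mul_of_one_le_left (dot_self_nonneg x) hΛ⟩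

theorem conj_diagS_mem_ellipticSet {Λ : ℝ} (P : Matrix.orthogonalGroup (Fin n) ℝ)
    {v : Fin n → ℝ} (hv : ∀ i, 1 ≤ v i ∧ v i ≤ Λ) : conj P (diagS v) ∈ ellipticSet n Λ := by
  intro x
  rw [quad_conj, quad_diagS, ← orth_dot P, Finset.mul_sum]
  exact ⟨Finset.sum_le_sum fun i _ => le_mul_of_one_le_left (sq_nonneg _) (hv i).1,
    Finset.sum_le_sum fun i _ => mul_le_mul_of_nonneg_right (hv i).2 (sq_nonneg _)⟩

theorem convex_ellipticSet (Λ : ℝ) : Convex ℝ (ellipticSet n Λ) := by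
  intro L hL L' hL' s t hs ht hst x
  rw [quad_add, quad_smul, quad_smul]
  have h1 := mul_le_mul_of_nonneg_left (hL x).1 hs
  have h2 := mul_le_mul_of_nonneg_left (hL' x).1 ht
  have h3 := mul_le_mul_of_nonneg_left (hL x).2 hs
  have h4 := mul_le_mul_of_nonneg_left (hL' x).2 ht
  constructor
  · calc x ⬝ᵥ x = s * (x ⬝ᵥ x) + t * (x ⬝ᵥ x) := by rw [← add_mul, hst, one_mul]
      _ ≤ _ := add_le_add h1 h2
  · calc s * quad L x + t * quad L' x ≤ s * (Λ * (x ⬝ᵥ x)) + t * (Λ * (x ⬝ᵥ x)) :=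
        add_le_add h3 h4
      _ = _ := by rw [← add_mul, hst, one_mul]

theorem continuous_quad_left (x : Fin n → ℝ) : Continuous fun L : SymMat n => quad L x :=
  LinearMap.continuous_of_finiteDimensional
    (⟨⟨fun L => quad L x, fun L L' => quad_add L L' x⟩, fun c L => quad_smul c L x⟩ :
      SymMat n →ₗ[ℝ] ℝ)

theorem isCompact_ellipticSet (Λ : ℝ) : IsCompact (ellipticSet n Λ) := by
  have : ProperSpace (SymMat n) := FiniteDimensional.proper ℝ _
  refine Metric.isCompact_of_isClosed_isBounded ?_ ?_
  · have : ellipticSet n Λ = ⋂ x, ({L | x ⬝ᵥ x ≤ quad L x} ∩ {L | quad L x ≤ Λ * (x ⬝ᵥ x)}) := by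
      ext L
      simp [ellipticSet]
    rw [this]
    exact isClosed_iInter fun x => (isClosed_le continuous_const (continuous_quad_left x)).inter
      (isClosed_le (continuous_quad_left x) continuous_const)
  · refine (isBounded_iff_forall_norm_le).2 ⟨Real.sqrt (n * Λ ^ 2), fun L hL => ?_⟩
    refine Real.le_sqrt_of_sq_le ?_
    rw [norm_sq_eq_sum]
    refine (Finset.sum_le_card_nsmul _ _ (Λ ^ 2) fun k _ => ?_).trans_eq (by simp)
    obtain ⟨P, hP⟩ := exists_conj_diagS_ordEig L
    have h := hL ((P : Matrix (Fin n) (Fin n) ℝ) k)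
    rw [row_dot_self, mul_one] at h
    nth_rewrite 1 [hP] at h
    nth_rewrite 2 [hP] at h
    rw [quad_conj_diagS_row] at h
    exact pow_le_pow_left₀ (zero_le_one.trans h.1) h.2 2

/-- A matrix with comparable positive and negative parts is annihilated or made negative by a
uniformly elliptic operator. -/
theorem exists_pair_nonpos {C : ℝ} (hC : 0 < C) {Z : SymMat n}
    (hZ : Z = 0 ∨ 1 / C ≤ -(minEig Z / maxEig Z)) :
    ∃ L ∈ ellipticSet n (1 + n * C), pair L Z ≤ 0 := by
  have hΛ : 1 ≤ 1 + n * C := by have : 0 ≤ n * C := by positivity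
                                linarith
  rcases hZ with rfl | hZ
  · exact ⟨oneS n, oneS_mem_ellipticSet hΛ, by rw [map_zero]⟩
  rcases Nat.eq_zero_or_pos n with rfl | hn
  · exact ⟨oneS 0, oneS_mem_ellipticSet hΛ, by simp [pair_apply]⟩
  have : Nonempty (Fin n) := ⟨⟨0, hn⟩⟩
  obtain ⟨P, hP⟩ := exists_conj_diagS_ordEig Z
  obtain ⟨k, hk⟩ := exists_eq_ciInf_of_finite (f := ordEig Z)
  have hmk : minEig Z = ordEig Z k := hk.symm
  have hmax : ∀ i, ordEig Z i ≤ maxEig Z := fun i => le_ciSup (Set.finite_range _).bddAbove i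
  have hC' : 0 < 1 / C := by positivity
  have hkM := hmax k
  rw [hmk] at hZ
  have hM : 0 < maxEig Z := by
    by_contra hM
    have : 0 ≤ ordEig Z k / maxEig Z := div_nonneg_of_nonpos (hkM.trans (not_lt.1 hM)) (not_lt.1 hM)
    linarith
  have hMC : maxEig Z + C * ordEig Z k ≤ 0 := by
    rw [← neg_div, div_le_div_iff₀ hC hM] at hZ
    linarith
  -- The identity plus weight `nC` on the eigenvector of the least eigenvalue: the pairing is at
  -- most `n (maxEig Z + C minEig Z) ≤ 0`.
  refine ⟨conj P (diagS (1 + Pi.single k (n * C))), conj_diagS_mem_ellipticSet P fun i => ?_, ?_⟩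
  · rw [Pi.add_apply, Pi.one_apply, Pi.single_apply]
    split_ifs <;> constructor <;> linarith
  · rw [hP, pair_conj_diagS]
    have h1 : ∑ i, ordEig Z i ≤ n * maxEig Z :=
      (Finset.sum_le_card_nsmul _ _ _ fun i _ => hmax i).trans_eq (by simp)
    have h2 : ∀ i, ordEig Z i * quad (conj P (diagS (1 + Pi.single k (n * C))))
        ((P : Matrix (Fin n) (Fin n) ℝ) i) =
        ordEig Z i + (if i = k then ordEig Z k * (n * C) else 0) := fun i => by
      rw [quad_conj_diagS_row, Pi.add_apply, Pi.one_apply, Pi.single_apply]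
      split_ifs with h
      · rw [h]; ring
      · ring
    rw [Finset.sum_congr rfl fun i _ => h2 i, Finset.sum_add_distrib, Finset.sum_ite_eq',
      if_pos (Finset.mem_univ k)]
    have := mul_nonpos_of_nonneg_of_nonpos (Nat.cast_nonneg (α := ℝ) n) hMC
    linarith

section MinMax

variable {α β : Type} [Nonempty α]

/-- The bound `κ` makes the infima genuine, real `⨅` of an unbounded family being a default value.
-/
theorem iSup_iInf_eq_zero [Nonempty β] {Φ : α → β → ℝ} {κ : ℝ} (hΦ : ∀ a b, |Φ a b| ≤ κ)
    (hpos : ∃ b, ∀ a, 0 ≤ Φ a b) (hneg : ∀ b, ∃ a, Φ a b ≤ 0) : ⨆ b, ⨅ a, Φ a b = 0 := by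
  have hbelow : ∀ b, BddBelow (Set.range fun a => Φ a b) := fun b =>
    ⟨-κ, by rintro _ ⟨a, rfl⟩; exact (abs_le.1 (hΦ a b)).1⟩
  have hle : ∀ b, ⨅ a, Φ a b ≤ 0 := fun b => by
    obtain ⟨a, ha⟩ := hneg b
    exact (ciInf_le (hbelow b) a).trans ha
  obtain ⟨b, hb⟩ := hpos
  exact le_antisymm (ciSup_le hle)
    ((le_ciInf hb).trans (le_ciSup (f := fun b => ⨅ a, Φ a b) ⟨0, by rintro _ ⟨b, rfl⟩; exact hle b⟩ b))

theorem iSup_iInf_mono {Φ Ψ : α → β → ℝ} {κ : ℝ} (hΦ : ∀ a b, |Φ a b| ≤ κ)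
    (hΨ : ∀ a b, |Ψ a b| ≤ κ) (h : ∀ a b, Φ a b ≤ Ψ a b) :
    ⨆ b, ⨅ a, Φ a b ≤ ⨆ b, ⨅ a, Ψ a b := by
  have hbelow : ∀ {Φ : α → β → ℝ}, (∀ a b, |Φ a b| ≤ κ) → ∀ b,
      BddBelow (Set.range fun a => Φ a b) := fun hΦ b =>
    ⟨-κ, by rintro _ ⟨a, rfl⟩; exact (abs_le.1 (hΦ a b)).1⟩
  refine ciSup_mono ⟨κ, ?_⟩ fun b => ciInf_mono (hbelow hΦ b) fun a => h a b
  rintro _ ⟨b, rfl⟩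
  exact (ciInf_le (hbelow hΨ b) (Classical.arbitrary α)).trans (abs_le.1 (hΨ _ b)).2

end MinMax

theorem uniformlyEllipticFamily_of_mem {α β : Type} {A : α → β → SymMat n} {Λ : ℝ} (hΛ : 1 ≤ Λ)
    (hA : ∀ a b, A a b ∈ ellipticSet n Λ) : UniformlyEllipticFamily A :=
  ⟨Λ, by linarith, fun a b x => ⟨(mul_le_of_le_one_left (dot_self_nonneg x)
    (inv_le_one_of_one_le₀ hΛ)).trans (hA a b x).1, (hA a b x).2⟩⟩

theorem abs_pair_add_le {Λ : ℝ} {L : SymMat n} (hL : L ∈ ellipticSet n Λ) (S : SymMat n) {f κ : ℝ}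
    (hf : |f| ≤ κ) : |pair L S + f| ≤ n * Λ * ‖S‖ + κ :=
  (abs_add_le _ _).trans (add_le_add (abs_pair_le hL S) hf)

theorem isaacs_mono {α β : Type} [Nonempty α] {A : α → β → SymMat n}
    {f : α → β → ℝ} {Λ κ : ℝ} (hΛ : 0 ≤ Λ) (hA : ∀ a b, A a b ∈ ellipticSet n Λ)
    (hf : ∀ a b, |f a b| ≤ κ) {S T : SymMat n} (hST : ∀ x, quad S x ≤ quad T x) :
    isaacs A f S ≤ isaacs A f T := by
  refine iSup_iInf_mono (Φ := fun a b => pair (A a b) S + f a b)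
    (Ψ := fun a b => pair (A a b) T + f a b) (κ := n * Λ * max ‖S‖ ‖T‖ + κ)
    (fun a b => (abs_pair_add_le (hA a b) S (hf a b)).trans ?_)
    (fun a b => (abs_pair_add_le (hA a b) T (hf a b)).trans ?_)
    fun a b => add_le_add_left (pair_mono (hA a b) hST) _
  · gcongr; exact le_max_left _ _
  · gcongr; exact le_max_right _ _

theorem isaacs_eq_zero {α β : Type} [Nonempty α] [Nonempty β] {A : α → β → SymMat n}
    {f : α → β → ℝ} {Λ κ : ℝ} (hA : ∀ a b, A a b ∈ ellipticSet n Λ)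
    (hf : ∀ a b, |f a b| ≤ κ) {S : SymMat n} (hpos : ∃ b, ∀ a, 0 ≤ pair (A a b) S + f a b)
    (hneg : ∀ b, ∃ a, pair (A a b) S + f a b ≤ 0) : isaacs A f S = 0 :=
  iSup_iInf_eq_zero (fun a b => abs_pair_add_le (hA a b) S (hf a b)) hpos hneg

end HessianEq

/-! ### The Isaacs equation and assertion (ii) -/

namespace HessianEq

open Filter Topology Matrix

variable {n : ℕ} {δ : ℝ} {w : E n → ℝ}

theorem HypHess.exists_pair_nonpos {C : ℝ} (hC : 0 < C) (hyp : HypHess C w) {x y : E n}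
    (hx : x ∈ unitBall n \ {0}) (hy : y ∈ unitBall n \ {0}) :
    ∃ L ∈ ellipticSet n (1 + n * C), pair L (hess w x - hess w y) ≤ 0 := by
  have h := hyp x hx y hy 1
  rw [conj_one] at h
  exact HessianEq.exists_pair_nonpos hC (h.imp_right And.left)

/-- Moving towards the origin multiplies the Hessian by any factor at least `1`, and passing to the
antipode changes its sign. The condition `κ ≤ |s|` keeps the point inside the ball. -/
theorem OddHomogeneous.exists_smul_hess (h : OddHomogeneous δ w) (hδ : 0 < δ) {x : E n}
    (hx : x ∈ unitBall n \ {0}) {s κ : ℝ} (hκ : 0 < κ) (hs : κ ≤ |s|) :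
    ∃ y ∈ unitBall n \ {0}, s • hess w x = κ • hess w y := by
  have key : ∃ y ∈ unitBall n \ {0}, |s| • hess w x = κ • hess w y := by
    set r := (|s| / κ) ^ (-δ⁻¹) with hr
    have h1 : 1 ≤ |s| / κ := (one_le_div hκ).2 hs
    have h0 : 0 < |s| / κ := one_pos.trans_le h1
    have hr0 : 0 < r := by positivity
    have hr1 : r ≤ 1 := Real.rpow_le_one_of_one_le_of_nonpos h1 (by simpa using hδ.le)
    have hrs : r ^ (-δ) = |s| / κ := by
      rw [hr, ← Real.rpow_mul h0.le, neg_mul_neg, inv_mul_cancel₀ hδ.ne', Real.rpow_one]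
    have hmem : r • x ∈ unitBall n := by
      rw [mem_unitBall, norm_smul, Real.norm_of_nonneg hr0.le]
      exact (mul_le_of_le_one_left (norm_nonneg x) hr1).trans_lt (mem_unitBall.1 hx.1)
    refine ⟨r • x, ⟨hmem, smul_ne_zero hr0.ne' hx.2⟩, ?_⟩
    rw [h.hess_smul hx.1 hr0 hmem, hrs, smul_smul, mul_div_cancel₀ _ hκ.ne']
  obtain ⟨y, hy, hxy⟩ := key
  rcases abs_cases s with ⟨hs', -⟩ | ⟨hs', -⟩
  · exact ⟨y, hy, by rw [← hxy, hs']⟩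
  · refine ⟨-y, neg_mem_punctured hy, ?_⟩
    rw [h.hess_neg_arg hy.1, smul_neg κ (hess w y), ← hxy, hs', neg_smul s (hess w x), neg_neg]

theorem OddHomogeneous.exists_smul_hess_eq (h : OddHomogeneous δ w) (hδ : 0 < δ) {x : E n}
    (hx : x ∈ unitBall n \ {0}) (s : ℝ) :
    ∃ κ : ℝ, 0 ≤ κ ∧ ∃ x' ∈ unitBall n \ {0}, ∃ y' ∈ unitBall n \ {0},
      s • hess w x = κ • (hess w x' - hess w y') := by
  rcases eq_or_ne s 0 with rfl | hs
  · exact ⟨0, le_rfl, x, hx, x, hx, by rw [zero_smul ℝ (hess w x), zero_smul ℝ (_ - _)]⟩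
  obtain ⟨y, hy, hxy⟩ := h.exists_smul_hess hδ hx (abs_pos.2 hs) le_rfl
  refine ⟨|s| / 2, by positivity, y, hy, -y, neg_mem_punctured hy, ?_⟩
  rw [h.hess_neg_arg hy.1, hxy, sub_neg_eq_add, ← two_smul ℝ (hess w y), smul_smul]
  congr 1
  ring

/-- With `κ = min |s| |t|` both terms become `κ` times a Hessian, and oddness turns the sum into a
difference. A zero coefficient is handled by writing a single Hessian as half the difference of
antipodal ones. -/
theorem OddHomogeneous.exists_combination_eq (h : OddHomogeneous δ w) (hδ : 0 < δ) {x y : E n}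
    (hx : x ∈ unitBall n \ {0}) (hy : y ∈ unitBall n \ {0}) (s t : ℝ) :
    ∃ κ : ℝ, 0 ≤ κ ∧ ∃ x' ∈ unitBall n \ {0}, ∃ y' ∈ unitBall n \ {0},
      s • hess w x + t • hess w y = κ • (hess w x' - hess w y') := by
  rcases eq_or_ne s 0 with rfl | hs
  · rw [zero_smul ℝ (hess w x), zero_add]
    exact h.exists_smul_hess_eq hδ hy t
  rcases eq_or_ne t 0 with rfl | ht
  · rw [zero_smul ℝ (hess w y), add_zero]
    exact h.exists_smul_hess_eq hδ hx s
  have hκ : 0 < min |s| |t| := lt_min (abs_pos.2 hs) (abs_pos.2 ht)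
  obtain ⟨x', hx', h1⟩ := h.exists_smul_hess hδ hx hκ (min_le_left _ _)
  obtain ⟨y', hy', h2⟩ := h.exists_smul_hess hδ hy hκ (min_le_right _ _)
  refine ⟨_, hκ.le, x', hx', -y', neg_mem_punctured hy', ?_⟩
  rw [h1, h2, h.hess_neg_arg hy'.1, sub_neg_eq_add, smul_add _ (hess w x')]

/-- Any two Hessians of `w` are annihilated by a common uniformly elliptic operator. -/
theorem OddHomogeneous.exists_pair_eq_zero (h : OddHomogeneous δ w) (hδ : 0 < δ) {C : ℝ}
    (hC : 0 < C) (hyp : HypHess C w) {x y : E n} (hx : x ∈ unitBall n \ {0})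
    (hy : y ∈ unitBall n \ {0}) :
    ∃ L ∈ ellipticSet n (1 + n * C), pair L (hess w x) = 0 ∧ pair L (hess w y) = 0 := by
  set T : SymMat n →ₗ[ℝ] ℝ × ℝ := (pair.flip (hess w x)).prod (pair.flip (hess w y)) with hT
  by_contra hne
  have h0 : (0 : ℝ × ℝ) ∉ T '' ellipticSet n (1 + n * C) := by
    rintro ⟨L, hL, hL0⟩
    exact hne ⟨L, hL, congrArg Prod.fst hL0, congrArg Prod.snd hL0⟩
  -- If no common annihilator existed, a separating functional would give a combination of the two
  -- Hessians on which every elliptic `L` is positive. That combination is a nonnegative multiple of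
  -- a difference of Hessians, on which some `L` is nonpositive.
  obtain ⟨f, u, hu, hf⟩ := geometric_hahn_banach_point_closed
    ((convex_ellipticSet (1 + n * C)).linear_image T)
    ((isCompact_ellipticSet _).image T.continuous_of_finiteDimensional).isClosed h0
  rw [map_zero] at hu
  obtain ⟨κ, hκ, x', hx', y', hy', heq⟩ :=
    h.exists_combination_eq hδ hx hy (f (1, 0)) (f (0, 1))
  obtain ⟨L, hL, hL0⟩ := hyp.exists_pair_nonpos hC hx' hy'
  have h1 : f (T L) = pair L (f (1, 0) • hess w x + f (0, 1) • hess w y) := by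
    have h2 : T L = pair L (hess w x) • ((1 : ℝ), (0 : ℝ)) + pair L (hess w y) • (0, 1) := by
      ext <;> simp [hT]
    rw [h2, map_add, map_smul, map_smul, map_add, map_smul, map_smul]
    simp only [smul_eq_mul]
    ring
  have h3 := hf _ ⟨L, hL, rfl⟩
  rw [h1, heq, map_smul, smul_eq_mul] at h3
  have := mul_nonpos_of_nonneg_of_nonpos hκ hL0
  linarith

theorem OddHomogeneous.exists_norm_hess_le (h : OddHomogeneous 0 w) :
    ∃ R : ℝ, ∀ x ∈ unitBall n \ {0}, ‖hess w x‖ ≤ R := by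
  obtain ⟨R, hR⟩ := (isCompact_halfSphere (n := n)).exists_bound_of_continuousOn
    ((continuousOn_hess isOpen_punctured h.smooth).mono halfSphere_subset)
  refine ⟨R, fun y hy => ?_⟩
  obtain ⟨h1, h2⟩ := exists_smul_halfSphere hy.2
  have h3 : 0 < 2 * ‖y‖ := by have := norm_pos_iff.2 hy.2; positivity
  have h4 := h.hess_smul (halfSphere_subset h1).1 h3 (by rw [← h2]; exact hy.1)
  rw [← h2, neg_zero, Real.rpow_zero, one_smul ℝ (hess w _)] at h4
  rw [h4]
  exact hR _ h1

theorem OddHomogeneous.exists_isaacs_equation (h : OddHomogeneous δ w) (hδ0 : 0 ≤ δ)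
    (hδ1 : δ < 1) (hn : 0 < n)
    (hsign : 0 < δ → (∃ x ∈ unitBall n, 0 < w x) ∧ ∃ y ∈ unitBall n, w y < 0)
    {C : ℝ} (hC : 0 < C) (hyp : HypHess C w) :
    ∃ (α β : Type) (_ : Nonempty α) (_ : Nonempty β) (A : α → β → SymMat n) (f : α → β → ℝ),
      UniformlyEllipticFamily A ∧ (∃ K : ℝ, ∀ a b, |f a b| ≤ K) ∧ (0 < δ → ∀ a b, f a b = 0) ∧
      IsViscositySolution (isaacs A f) w (unitBall n) := by
  set Λ := 1 + n * C with hΛdef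
  have hΛ : 1 ≤ Λ := le_add_of_nonneg_right (by positivity)
  have hβ : Nonempty {x : E n // x ∈ unitBall n \ {0}} := by
    obtain ⟨x, hx⟩ := halfSphere_nonempty hn
    exact ⟨x, halfSphere_subset hx⟩
  rcases hδ0.eq_or_lt with hδ | hδ
  · subst hδ
    have hα : Nonempty {L : SymMat n // L ∈ ellipticSet n Λ} := ⟨_, oneS_mem_ellipticSet hΛ⟩
    obtain ⟨R, hR⟩ := h.exists_norm_hess_le
    have hf : ∀ (a : {L : SymMat n // L ∈ ellipticSet n Λ})
        (b : {x : E n // x ∈ unitBall n \ {0}}), |-pair a.1 (hess w b)| ≤ n * Λ * R :=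
      fun a b => by
        rw [abs_neg]
        exact (abs_pair_le a.2 _).trans (mul_le_mul_of_nonneg_left (hR b b.2) (by positivity))
    -- This is `sup_b inf_L L·(S - D²w(b))`. At `S = D²w(x)` the index `b = x` gives zero, and every
    -- other `b` admits an `L` giving a nonpositive value. The constants are bounded because the
    -- Hessian has degree zero.
    refine ⟨_, _, hα, hβ, fun a _ => a.1, fun a b => -pair a.1 (hess w b),
      uniformlyEllipticFamily_of_mem hΛ fun a _ => a.2, ⟨_, hf⟩,
      fun h0 => absurd h0 (lt_irrefl _), h.isViscositySolution hδ0 hδ1 hn hsign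
        (fun S T hST => isaacs_mono (by linarith) (fun a _ => a.2) hf hST)
        fun x hx => isaacs_eq_zero (fun a _ => a.2) hf
          ⟨⟨x, hx⟩, fun a => (add_neg_cancel _).ge⟩ fun b => ?_⟩
    obtain ⟨L, hL, hL0⟩ := hyp.exists_pair_nonpos hC hx b.2
    refine ⟨⟨L, hL⟩, ?_⟩
    rwa [map_sub, sub_eq_add_neg] at hL0
  -- At `S = D²w(x)` every term with `b = x` vanishes, and for any other `b` the term with `a = x`
  -- vanishes.
  · choose L hL hLx hLy using fun x y : {x : E n // x ∈ unitBall n \ {0}} =>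
      h.exists_pair_eq_zero hδ hC hyp x.2 y.2
    refine ⟨_, _, hβ, hβ, L, fun _ _ => 0, uniformlyEllipticFamily_of_mem hΛ hL,
      ⟨0, fun _ _ => by rw [abs_zero]⟩, fun _ _ _ => rfl,
      h.isViscositySolution hδ0 hδ1 hn hsign
        (fun S T hST => isaacs_mono (κ := 0) (by linarith) hL (fun _ _ => by rw [abs_zero]) hST)
        fun x hx => isaacs_eq_zero hL (κ := 0) (fun _ _ => by rw [abs_zero])
          ⟨⟨x, hx⟩, fun a => ?_⟩ fun b => ⟨⟨x, hx⟩, ?_⟩⟩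
    · rw [add_zero]; exact (hLy a ⟨x, hx⟩).ge
    · rw [add_zero]; exact (hLx ⟨x, hx⟩ b).le

theorem isViscositySolution_of_dim_zero {F : SymMat 0 → ℝ} (hF : ∀ S, F S = 0) (w : E 0 → ℝ)
    (Ω : Set (E 0)) : IsViscositySolution F w Ω :=
  ⟨(continuous_of_const fun x y => by rw [Subsingleton.elim x y]).continuousOn,
    fun _ _ _ _ _ => (hF _).ge, fun _ _ _ _ _ => (hF _).le⟩

theorem uniformlyElliptic_of_dim_zero : UniformlyElliptic fun _ : SymMat 0 => (0 : ℝ) :=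
  ⟨1, le_rfl, fun _ N _ => by rw [Subsingleton.elim N 0, norm_zero]; norm_num⟩

end HessianEq

/-- The condition `μₙ ≠ 0` needs no separate clause in `hhyp`: a zero denominator would make the
quotient `0`, against the lower bound `1 / C`. -/
theorem lemma2p1 (n : ℕ) (δ : ℝ) (hδ0 : 0 ≤ δ) (hδ1 : δ < 1) (w : E n → ℝ)
    (hodd : ∀ x ∈ unitBall n, w (-x) = -w x)
    (hhom : ∀ x ∈ unitBall n, ∀ t : ℝ, 0 < t → t • x ∈ unitBall n →
      w (t • x) = t ^ (2 - δ) * w x)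
    (hsmooth : ContDiffOn ℝ ∞ w (unitBall n \ {0}))
    (U : Set (Fin n → ℝ)) (hU : IsOpen U) (hMU : eigImage w ⊆ U)
    (g : (Fin n → ℝ) → ℝ) (hg : ContDiffOn ℝ ∞ g U)
    (hg0 : ∀ v ∈ eigImage w, g v = 0)
    (hgpos : ∃ c : ℝ, 0 < c ∧ ∀ v ∈ eigImage w, ∀ i : Fin n,
      c ≤ fderiv ℝ g v (Pi.single i 1))
    (hhyp : ∃ C : ℝ, 0 < C ∧ ∀ a ∈ unitBall n \ {0}, ∀ b ∈ unitBall n \ {0},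
      ∀ O : Matrix.orthogonalGroup (Fin n) ℝ,
        hess w a - conj O (hess w b) = 0 ∨
        (1 / C ≤ -(minEig (hess w a - conj O (hess w b)) /
              maxEig (hess w a - conj O (hess w b))) ∧
          -(minEig (hess w a - conj O (hess w b)) /
              maxEig (hess w a - conj O (hess w b))) ≤ C))
    (hsign : 0 < δ → (∃ x ∈ unitBall n, 0 < w x) ∧ ∃ y ∈ unitBall n, w y < 0) :
    (∃ F : SymMat n → ℝ, IsHessianOperator F ∧ SmoothOperator F ∧ UniformlyElliptic F ∧
      IsViscositySolution F w (unitBall n)) ∧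
    (∃ (α β : Type) (_ : Nonempty α) (_ : Nonempty β) (A : α → β → SymMat n) (f : α → β → ℝ),
      UniformlyEllipticFamily A ∧ (∃ K : ℝ, ∀ a b, |f a b| ≤ K) ∧
      (0 < δ → ∀ a b, f a b = 0) ∧
      IsViscositySolution (isaacs A f) w (unitBall n)) := by
  obtain ⟨c, hc0, hc⟩ := hgpos
  obtain ⟨C, hC, hyp⟩ := hhyp
  -- In dimension zero the punctured ball, and with it `M`, is empty, so the general argument has no
  -- points to start from; the zero operators work since the only matrix has norm zero.
  rcases Nat.eq_zero_or_pos n with rfl | hn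
  · refine ⟨⟨fun _ => 0, ⟨fun _ => 0, fun _ _ => rfl, fun _ => rfl⟩, contDiff_const,
      uniformlyElliptic_of_dim_zero, isViscositySolution_of_dim_zero (fun _ => rfl) _ _⟩,
      Unit, Unit, ⟨()⟩, ⟨()⟩, fun _ _ => 0, fun _ _ => 0,
      ⟨1, one_pos, fun _ _ ξ => by simp⟩, ⟨0, fun _ _ => by simp⟩, fun _ _ _ => rfl,
      isViscositySolution_of_dim_zero (fun S => by simp [isaacs]) _ _⟩
  · have h : OddHomogeneous δ w := ⟨hodd, hhom, hsmooth⟩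
    exact ⟨h.exists_hessian_equation hδ0 hδ1 hn hsign hU hMU hg hg0 hc0 hc hC hyp,
      h.exists_isaacs_equation hδ0 hδ1 hn hsign hC hyp⟩
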